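/- Let $\gamma\in\mathbb R\setminus\{0\}$, let $\mathbb T^2=\mathbb R^2/(\mathbb Z\times\gamma\mathbb Z)$ be the corresponding flat torus with Lebesgue measure, and let $\Delta$ be its Laplacian. Fix $T>0$. For $1\le p<\infty$, $L^p(\mathbb T^2;L^2(0,T))$ is the space of measurable $f:(0,T)\times\mathbb T^2\to\mathbb C$ for which $z\mapsto\|f(\cdot,z)\|_{L^2(0,T)}$ belongs to $L^p(\mathbb T^2)$. For a real-valued function $a$ on $\mathbb T^2$, a control $f$ and $u_0\in L^2(\mathbb T^2)$ (complex-valued), consider the control problem $$(i\partial_t+\Delta)u=a(z)\,f(t,z)\ \text{ for } 0<t<T,\qquad u|_{t=0}=u_0, \tag{$*$}$$ whose solution $u\in C^0([0,T];L^2(\mathbb T^2))\cap L^4(\mathbb T^2;L^2(0,T))$ is understood in the weak sense: for every $\varphi\in C^\infty(\mathbb T^2)$ and $t\in[0,T]$, $$i\int_{\mathbb T^2}\bigl(u(t)-u_0\bigr)\varphi\,dz+\int_0^t\!\!\int_{\mathbb T^2}u(s)\,\Delta\varphi\,dz\,ds=\int_0^t\!\!\int_{\mathbb T^2}a\,f(s)\,\varphi\,dz\,ds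 .$$ Let $e^{it\Delta}$ be the free Schrödinger group on $L^2(\mathbb T^2)$. **Proposition 4.1.** The following three statements are equivalent. 1. For every $a\in L^2(\mathbb T^2;\mathbb R)$ with $\|a\|_{L^2}>0$ and every $u_0\in L^2(\mathbb T^2)$ there exists $f\in L^4(\mathbb T^2;L^2(0,T))$ such that the solution $u$ of $(*)$ satisfies $u|_{t=T}=0$. 2. For every $a\in L^4(\mathbb T^2;\mathbb R)$ with $\|a\|_{L^4}>0$ and every $u_0\in L^2(\mathbb T^2)$ there exists $f\in L^2((0,T)\times\mathbb T^2)$ such that the solution $u$ of $(*)$ satisfies $u|_{t=T}=0$. 3. For every $a\in L^4(\mathbb T^2;\mathbb R)$ with $\|a\|_{L^4}>0$ there exists $C>0$ such that for every $v_0\in L^2(\mathbb T^2)$, $$\|v_0\|_{L^2(\mathbb T^2)}^2\le C\int_0^T\!\!\int_{\mathbb T^2}\bigl|a(z)\,(e^{it\Delta}v_0)(z)\bigr|^2\,dz\,dt .$$ -/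

import Mathlib

open MeasureTheory
open scoped NNReal ENNReal

noncomputable section

namespace TorusControl

/-- The flat torus `ℝ² / (ℤ × Lℤ)`, with the (unnormalised) Lebesgue measure `volume`, of total
mass `L`. -/
abbrev Torus (L : ℝ) : Type := AddCircle (1 : ℝ) × AddCircle L

/-- The Hilbert space `L²` of complex valued functions on the torus. -/
abbrev L2 (L : ℝ) [Fact (0 < L)] : Type := Lp ℂ 2 (volume : Measure (Torus L))

/-- Lebesgue measure on `(0, T) × 𝕋²`; time is the first variable. -/
def spaceTime (L : ℝ) [Fact (0 < L)] (T : ℝ) : Measure (ℝ × Torus L) :=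
  (volume.restrict (Set.Ioo 0 T)).prod volume

/-- `f ∈ Lᵖ(𝕋²; L²(0, T))`: `f` is measurable on `(0, T) × 𝕋²` and the `Lᵖ(𝕋²)` norm of
`z ↦ ‖f(·, z)‖_{L²(0, T)}` is finite. -/
def MemLpL2 (L : ℝ) [Fact (0 < L)] (T : ℝ) (p : ℝ≥0∞) (f : ℝ × Torus L → ℂ) : Prop :=
  AEStronglyMeasurable f (spaceTime L T) ∧
    eLpNorm (fun z : Torus L =>
      eLpNorm (fun t : ℝ => f (t, z)) 2 (volume.restrict (Set.Ioo 0 T))) p volume < ∞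

/-- Smooth functions on the torus: those whose pull-back to `ℝ²` is smooth. -/
def IsSmooth (L : ℝ) (φ : Torus L → ℂ) : Prop :=
  ContDiff ℝ ((⊤ : ℕ∞) : WithTop ℕ∞) (fun x : ℝ × ℝ => φ ((x.1 : AddCircle (1 : ℝ)), (x.2 : AddCircle L)))

/-- The Laplacian on the torus: the sum of the second derivatives along the two coordinates. -/
def laplacian (L : ℝ) (φ : Torus L → ℂ) (z : Torus L) : ℂ :=
  iteratedDeriv 2 (fun s : ℝ => φ (z.1 + (s : AddCircle (1 : ℝ)), z.2)) 0 +
    iteratedDeriv 2 (fun s : ℝ => φ (z.1, z.2 + (s : AddCircle L))) 0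

/-- `u` is a solution on `[0, T]`, in the class `C⁰([0, T]; L²(𝕋²)) ∩ L⁴(𝕋²; L²(0, T))`, of
`(i ∂ₜ + Δ) u = g`, `u(0) = u₀`. The equation is understood weakly: tested against smooth functions
on the torus and integrated in time. Only the values of `u` on `[0, T]` and of `g` on
`(0, T) × 𝕋²` matter. -/
structure IsSolution (L : ℝ) [Fact (0 < L)] (T : ℝ) (g : ℝ × Torus L → ℂ) (u₀ : L2 L)
    (u : ℝ → L2 L) : Prop where
  continuousOn : ContinuousOn u (Set.Icc 0 T)
  memLpL2 : ∃ w : ℝ × Torus L → ℂ, MemLpL2 L T 4 w ∧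
    ∀ᵐ t ∂(volume.restrict (Set.Ioo 0 T)), (fun z => w (t, z)) =ᵐ[volume] u t
  initial : u 0 = u₀
  weak : ∀ φ : Torus L → ℂ, IsSmooth L φ → ∀ t ∈ Set.Icc 0 T,
    Complex.I * ((∫ z, u t z * φ z) - ∫ z, u₀ z * φ z)
        + ∫ s in (0 : ℝ)..t, ∫ z, u s z * laplacian L φ z
      = ∫ s in (0 : ℝ)..t, ∫ z, g (s, z) * φ z

/-- The characters `(x, y) ↦ exp (2πi (n₁ x + n₂ y / L))` of the torus. -/
def character (L : ℝ) (n : ℤ × ℤ) : C(Torus L, ℂ) where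
  toFun z := fourier n.1 z.1 * fourier n.2 z.2
  continuous_toFun := by fun_prop

/-- The eigenvalue of `-Δ` on the character of frequency `n`. -/
def eigenvalue (L : ℝ) (n : ℤ × ℤ) : ℝ :=
  (2 * Real.pi * n.1) ^ 2 + (2 * Real.pi * n.2 / L) ^ 2

/-- The Fourier coefficients of `v ∈ L²(𝕋²)`, so that `v = ∑ₙ (fourierCoef v n) eₙ`. -/
def fourierCoef (L : ℝ) [Fact (0 < L)] (v : L2 L) (n : ℤ × ℤ) : ℂ :=
  (L : ℂ)⁻¹ * ∫ z, (starRingEnd ℂ) (character L n z) * v z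

/-- The free Schrödinger group `e^{itΔ}` on `L²(𝕋²)`: the series (convergent in `L²`)
`∑ₙ e^{-it λₙ} (fourierCoef v n) eₙ`. -/
def freeEvolution (L : ℝ) [Fact (0 < L)] (t : ℝ) (v : L2 L) : L2 L :=
  ∑' n : ℤ × ℤ, (Complex.exp (-Complex.I * t * eigenvalue L n) * fourierCoef L v n) •
    ContinuousMap.toLp 2 volume ℂ (character L n)

/-- The control `f`, localised by `a`, drives the state `u₀` to rest in time `T`: the solution of
`(i ∂ₜ + Δ) u = a f`, `u(0) = u₀`, satisfies `u(T) = 0`. -/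
def DrivesToRest (L : ℝ) [Fact (0 < L)] (T : ℝ) (a : Torus L → ℝ) (f : ℝ × Torus L → ℂ)
    (u₀ : L2 L) : Prop :=
  ∃ u : ℝ → L2 L, IsSolution L T (fun p => (a p.2 : ℂ) * f p) u₀ u ∧ u T = 0

end TorusControl

end

/-! The equivalence combines the Hilbert uniqueness method with one estimate from harmonic analysis,
which allows passing between weights in `L²` and in `L⁴`.

That estimate is Zygmund's inequality: `v ↦ e^{itΔ} v` is bounded from `L²` to `L⁴(𝕋²; L²(0, T))`
(`exists_lintegral_sum_phase_le`, `exists_representative_evol`). Cut the spectrum into windows of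
width `2π/T` and replace each eigenvalue by the left end of its window. Distinct windows are then
orthogonal on `(0, T)`, so the time integral is `T` times the sum of the squared moduli of the
window pieces, and it suffices to bound a single piece from `L²` to `L⁴` in space. After squaring
the piece this is a count: `p ≠ 0` is a sum of two frequencies of one window in boundedly many ways
(`exists_card_window_le`). What remains of each phase has frequency at most `2π/T`. Writing a slowly
varying coefficient as its value at `0` plus the integral of its derivative absorbs these phases,
and also the `C¹` profiles of Duhamel's formula.

From 1 to 2: use the weight `a²`. If `f` is a control for it in `L⁴(𝕋²; L²(0, T))`, then `a f` is a
control for `a`, and it is in `L²` by Hölder.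

From 2 to 3: testing the equation with characters writes `⟨v, u₀⟩` as a pairing of `a e^{itΔ} v`
with the control, for `v` a trigonometric polynomial. The functionals `⟨v, ·⟩` of observed norm at
most one are thus pointwise bounded; Banach–Steinhaus makes the bound uniform, which is
observability for trigonometric polynomials (`exists_norm_trunc_le`). Zygmund's inequality makes `a
e^{itΔ}` continuous for `a ∈ L⁴`, and density concludes (`exists_observability`).

From 3 to 1: a nonzero `a` satisfies `|a| > ε` on some set `E` of positive measure. Observability
from `E` makes the Gramian coercive, hence surjective (`gramian_surjective`), and yields a source
`1_E e^{itΔ} v` steering `u₀` to `0`. Dividing it by `a` costs at most `1/ε`, and Zygmund's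
inequality puts the resulting control in `L⁴(𝕋²; L²(0, T))` (`exists_control`). -/

noncomputable section

namespace TorusControl

open Set Filter Topology ComplexConjugate

/-! ### Density of trigonometric polynomials, by Stone–Weierstrass. -/

section Characters

variable {L : ℝ}

theorem character_apply (n : ℤ × ℤ) (z : Torus L) :
    character L n z = fourier n.1 z.1 * fourier n.2 z.2 := rfl

theorem character_add (m n : ℤ × ℤ) (z : Torus L) :
    character L (m + n) z = character L m z * character L n z := by
  simp only [character_apply, Prod.fst_add, Prod.snd_add, fourier_add]; ring

theorem character_neg (n : ℤ × ℤ) (z : Torus L) :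
    character L (-n) z = conj (character L n z) := by
  simp only [character_apply, Prod.fst_neg, Prod.snd_neg, fourier_neg, map_mul]

theorem character_zero (z : Torus L) : character L 0 z = 1 := by
  simp [character_apply]

theorem norm_character_apply (n : ℤ × ℤ) (z : Torus L) : ‖character L n z‖ = 1 := by
  simp only [character_apply, fourier_apply, norm_mul, Circle.norm_coe, mul_one]

variable (L) in
/-- The star subalgebra of trigonometric polynomials on the torus. -/
def characterSubalgebra : StarSubalgebra ℂ C(Torus L, ℂ) where
  toSubalgebra := Algebra.adjoin ℂ (range (character L))
  star_mem' := by
    change Algebra.adjoin ℂ (range (character L)) ≤ star (Algebra.adjoin ℂ (range (character L)))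
    refine Algebra.adjoin_le ?_
    rintro _ ⟨n, rfl⟩
    refine Algebra.subset_adjoin ⟨-n, ?_⟩
    ext1 x
    simp only [character_neg, starRingEnd_apply, ContinuousMap.star_apply]

/-- A product of characters is a character and so is the constant `1`; hence the linear span is
already an algebra. -/
theorem characterSubalgebra_coe :
    (characterSubalgebra L).toSubalgebra.toSubmodule =
      Submodule.span ℂ (range (character L)) := by
  apply Algebra.adjoin_eq_span_of_subset
  refine .trans (fun x ↦ Submonoid.closure_induction (fun _ ↦ id) ⟨0, ?_⟩ ?_) Submodule.subset_span
  · ext z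
    simp [character_zero]
  · rintro _ _ _ _ ⟨m, rfl⟩ ⟨n, rfl⟩
    refine ⟨m + n, ?_⟩
    ext z
    simp only [character_add, ContinuousMap.mul_apply]

theorem characterSubalgebra_separatesPoints [hL : Fact (0 < L)] :
    (characterSubalgebra L).SeparatesPoints := by
  intro x y hxy
  by_cases h1 : x.1 = y.1
  · refine ⟨_, ⟨character L (0, 1), Algebra.subset_adjoin ⟨_, rfl⟩, rfl⟩, ?_⟩
    have h2 : x.2 ≠ y.2 := fun h => hxy (Prod.ext h1 h)
    change character L (0, 1) x ≠ character L (0, 1) y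
    simp only [character_apply, fourier_zero, fourier_one, one_mul]
    exact fun h => h2 (AddCircle.injective_toCircle hL.out.ne' (Subtype.coe_injective h))
  · refine ⟨_, ⟨character L (1, 0), Algebra.subset_adjoin ⟨_, rfl⟩, rfl⟩, ?_⟩
    change character L (1, 0) x ≠ character L (1, 0) y
    simp only [character_apply, fourier_zero, fourier_one, mul_one]
    exact fun h => h1 (AddCircle.injective_toCircle one_ne_zero (Subtype.coe_injective h))

theorem span_character_closure_eq_top [Fact (0 < L)] :
    (Submodule.span ℂ (range (character L))).topologicalClosure = ⊤ := by
  rw [← characterSubalgebra_coe]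
  exact congr_arg (Subalgebra.toSubmodule <| StarSubalgebra.toSubalgebra ·)
    (ContinuousMap.starSubalgebra_topologicalClosure_eq_top_of_separatesPoints _
      characterSubalgebra_separatesPoints)

end Characters

/-! ### The Fourier basis of `L²` and the free group as a phase multiplier. -/

section HilbertBasis

variable {L : ℝ} [hL : Fact (0 < L)]

theorem integral_fourier (n : ℤ) :
    ∫ x : AddCircle L, fourier n x = if n = 0 then (L : ℂ) else 0 := by
  have h := fourierCoeff_fourier (T := L) 0
  have h2 := congrFun h (-n)
  rw [fourierCoeff] at h2
  rw [AddCircle.volume_eq_smul_haarAddCircle, integral_smul_measure,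
    ENNReal.toReal_ofReal hL.out.le]
  simp only [neg_neg, fourier_zero, smul_eq_mul, mul_one, Pi.single_apply] at h2
  rw [h2]
  by_cases hn : n = 0 <;> simp [hn]

theorem integral_character (n : ℤ × ℤ) :
    ∫ z : Torus L, character L n z = if n = 0 then (L : ℂ) else 0 := by
  simp only [character_apply]
  rw [Measure.volume_eq_prod, integral_prod_mul (fun x => fourier n.1 x) (fun y => fourier n.2 y)]
  rw [integral_fourier, integral_fourier]
  obtain ⟨n1, n2⟩ := n
  by_cases h1 : n1 = 0 <;> by_cases h2 : n2 = 0 <;> simp [h1, h2]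

variable (L) in
/-- The character of frequency `n`, as an element of `L²`. -/
def charLp (n : ℤ × ℤ) : L2 L := ContinuousMap.toLp 2 volume ℂ (character L n)

theorem coeFn_charLp (n : ℤ × ℤ) : charLp L n =ᵐ[volume] character L n :=
  ContinuousMap.coeFn_toLp _ _

theorem inner_charLp (n : ℤ × ℤ) (v : L2 L) :
    inner ℂ (charLp L n) v = ∫ z, conj (character L n z) * v z := by
  rw [L2.inner_def]
  refine integral_congr_ae ?_
  filter_upwards [coeFn_charLp n] with z hz
  rw [hz, RCLike.inner_apply, mul_comm]

theorem inner_charLp_charLp (m n : ℤ × ℤ) :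
    inner ℂ (charLp L m) (charLp L n) = if m = n then (L : ℂ) else 0 := by
  rw [inner_charLp]
  have : ∫ z, conj (character L m z) * (charLp L n) z = ∫ z, character L (-m + n) z := by
    refine integral_congr_ae ?_
    filter_upwards [coeFn_charLp n] with z hz
    rw [hz, character_add, character_neg]
  rw [this, integral_character]
  congr 1
  simp [neg_add_eq_zero]

variable (L) in
/-- The normalised characters. -/
def unitChar (n : ℤ × ℤ) : L2 L := ((√L : ℝ) : ℂ)⁻¹ • charLp L n

omit hL in
theorem sqrt_mul_sqrt_complex (h : 0 < L) : ((√L : ℝ) : ℂ) * ((√L : ℝ) : ℂ) = L := by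
  rw [← Complex.ofReal_mul, Real.mul_self_sqrt h.le]

theorem sqrt_complex_ne_zero : ((√L : ℝ) : ℂ) ≠ 0 := by
  simpa using (Real.sqrt_pos.2 hL.out).ne'

theorem orthonormal_unitChar : Orthonormal ℂ (unitChar L) := by
  classical
  rw [orthonormal_iff_ite]
  intro m n
  rw [unitChar, unitChar, inner_smul_left, inner_smul_right, inner_charLp_charLp]
  split_ifs with h
  · have := sqrt_mul_sqrt_complex hL.out
    have h0 := sqrt_complex_ne_zero (L := L)
    rw [map_inv₀, Complex.conj_ofReal, ← this]
    field_simp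
  · simp

theorem span_unitChar_closure_eq_top :
    (Submodule.span ℂ (range (unitChar L))).topologicalClosure = ⊤ := by
  have h1 : (Submodule.span ℂ (range (charLp L))).topologicalClosure = ⊤ := by
    convert! (ContinuousMap.toLp_denseRange ℂ (volume : Measure (Torus L))
      ℂ (p := 2) (by simp)).topologicalClosure_map_submodule span_character_closure_eq_top
    rw [Submodule.map_span]
    congr 1
    rw [← range_comp]
    rfl
  rw [eq_top_iff, ← h1]
  refine Submodule.topologicalClosure_mono (Submodule.span_le.2 ?_)
  rintro _ ⟨n, rfl⟩
  have : charLp L n = ((√L : ℝ) : ℂ) • unitChar L n := by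
    rw [unitChar, smul_smul, mul_inv_cancel₀ sqrt_complex_ne_zero, one_smul]
  rw [this]
  exact Submodule.smul_mem _ _ (Submodule.subset_span ⟨n, rfl⟩)

variable (L) in
/-- The Hilbert basis of normalised characters. -/
def charBasis : HilbertBasis (ℤ × ℤ) ℂ (L2 L) :=
  HilbertBasis.mk orthonormal_unitChar span_unitChar_closure_eq_top.ge

theorem charBasis_apply (n : ℤ × ℤ) : charBasis L n = unitChar L n := by
  rw [charBasis, HilbertBasis.coe_mk]

/-- The torus has mass `L`, so characters have norm `√L`; this is the conversion factor between
coefficients in the unit basis and `fourierCoef`. -/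
theorem charBasis_repr (v : L2 L) (n : ℤ × ℤ) :
    (charBasis L).repr v n = ((√L : ℝ) : ℂ) * fourierCoef L v n := by
  rw [HilbertBasis.repr_apply_apply, charBasis_apply, unitChar, inner_smul_left, inner_charLp,
    fourierCoef, map_inv₀, Complex.conj_ofReal, ← sqrt_mul_sqrt_complex hL.out]
  have h0 := sqrt_complex_ne_zero (L := L)
  field_simp

/-- The phase `e^{-itλ}` of frequency `n`. -/
def phase (L t : ℝ) (n : ℤ × ℤ) : ℂ := Complex.exp (-Complex.I * t * eigenvalue L n)

omit hL in
theorem norm_phase (t : ℝ) (n : ℤ × ℤ) : ‖phase L t n‖ = 1 := by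
  rw [phase, show -Complex.I * t * eigenvalue L n = ((-(t * eigenvalue L n) : ℝ) : ℂ) * Complex.I by
    push_cast; ring]
  exact Complex.norm_exp_ofReal_mul_I _

omit hL in
theorem phase_add (s t : ℝ) (n : ℤ × ℤ) : phase L (s + t) n = phase L s n * phase L t n := by
  rw [phase, phase, phase, ← Complex.exp_add]; push_cast; ring_nf

omit hL in
theorem phase_zero (n : ℤ × ℤ) : phase L 0 n = 1 := by simp [phase]

omit hL in
theorem continuous_phase (n : ℤ × ℤ) : Continuous fun t => phase L t n := by
  unfold phase; fun_prop

omit hL in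
theorem hasDerivAt_phase (t : ℝ) (n : ℤ × ℤ) :
    HasDerivAt (fun t => phase L t n) (-Complex.I * eigenvalue L n * phase L t n) t := by
  unfold phase
  have h1 : HasDerivAt (fun t : ℝ => -Complex.I * (t : ℂ) * eigenvalue L n)
      (-Complex.I * 1 * eigenvalue L n) t :=
    ((Complex.ofRealCLM.hasDerivAt (x := t)).const_mul _).mul_const _
  have := h1.cexp
  convert this using 1
  ring

theorem memlp_phase_mul (t : ℝ) (v : L2 L) :
    Memℓp (fun n => phase L t n * (charBasis L).repr v n) 2 := by
  have := lp.memℓp ((charBasis L).repr v)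
  rw [memℓp_gen_iff (by simp)] at this ⊢
  simpa [norm_mul, norm_phase] using this

/-- The phase multiplier on `ℓ²`. -/
def phaseMul (t : ℝ) (v : L2 L) : lp (fun _ : ℤ × ℤ => ℂ) 2 := ⟨_, memlp_phase_mul t v⟩

theorem hasSum_freeEvolution (t : ℝ) (v : L2 L) :
    HasSum (fun n => (phase L t n * (charBasis L).repr v n) • charBasis L n)
      ((charBasis L).repr.symm (phaseMul t v)) :=
  (charBasis L).hasSum_repr_symm (phaseMul t v)

theorem freeEvolution_eq (t : ℝ) (v : L2 L) :
    freeEvolution L t v = (charBasis L).repr.symm (phaseMul t v) := by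
  rw [← (hasSum_freeEvolution t v).tsum_eq, freeEvolution]
  congr 1
  ext1 n
  rw [charBasis_repr, charBasis_apply, unitChar, smul_smul]
  change (phase L t n * _) • charLp L n = _
  congr 1
  have h0 := sqrt_complex_ne_zero (L := L)
  field_simp

theorem repr_freeEvolution (t : ℝ) (v : L2 L) (n : ℤ × ℤ) :
    (charBasis L).repr (freeEvolution L t v) n = phase L t n * (charBasis L).repr v n := by
  rw [freeEvolution_eq, LinearIsometryEquiv.apply_symm_apply]; rfl

theorem repr_ext {v w : L2 L} (h : ∀ n, (charBasis L).repr v n = (charBasis L).repr w n) :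
    v = w :=
  (charBasis L).repr.injective (lp.ext (funext h))

/-- The free Schrödinger group as a family of linear isometric equivalences. -/
def evol (L : ℝ) [Fact (0 < L)] (t : ℝ) : L2 L ≃ₗᵢ[ℂ] L2 L where
  toFun v := freeEvolution L t v
  map_add' v w := repr_ext fun n => by
    simp only [repr_freeEvolution, map_add, lp.coeFn_add, Pi.add_apply]; ring
  map_smul' c v := repr_ext fun n => by
    simp only [repr_freeEvolution, map_smul, lp.coeFn_smul, Pi.smul_apply, smul_eq_mul,
      RingHom.id_apply]; ring
  invFun v := freeEvolution L (-t) v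
  left_inv v := repr_ext fun n => by
    simp only [repr_freeEvolution]
    rw [← mul_assoc, ← phase_add, neg_add_cancel, phase_zero, one_mul]
  right_inv v := repr_ext fun n => by
    simp only [repr_freeEvolution]
    rw [← mul_assoc, ← phase_add, add_neg_cancel, phase_zero, one_mul]
  norm_map' v := by
    change ‖freeEvolution L t v‖ = _
    rw [← (charBasis L).repr.norm_map, ← (charBasis L).repr.norm_map v]
    rw [lp.norm_eq_tsum_rpow (by simp), lp.norm_eq_tsum_rpow (by simp)]
    simp only [repr_freeEvolution, norm_mul, norm_phase, one_mul]

theorem evol_apply (t : ℝ) (v : L2 L) : evol L t v = freeEvolution L t v := rfl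

theorem repr_evol (t : ℝ) (v : L2 L) (n : ℤ × ℤ) :
    (charBasis L).repr (evol L t v) n = phase L t n * (charBasis L).repr v n :=
  repr_freeEvolution t v n

theorem evol_evol (s t : ℝ) (v : L2 L) : evol L s (evol L t v) = evol L (s + t) v :=
  repr_ext fun n => by simp only [repr_evol, phase_add, mul_assoc]

theorem evol_zero (v : L2 L) : evol L 0 v = v :=
  repr_ext fun n => by simp only [repr_evol, phase_zero, one_mul]

theorem inner_evol_left (t : ℝ) (v w : L2 L) :
    inner ℂ (evol L t v) w = inner ℂ v (evol L (-t) w) := by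
  rw [← (evol L (-t)).inner_map_map, evol_evol, neg_add_cancel, evol_zero]

theorem norm_sq_sum_smul_charBasis (F : Finset (ℤ × ℤ)) (c : ℤ × ℤ → ℂ) :
    ‖∑ n ∈ F, c n • charBasis L n‖ ^ 2 = ∑ n ∈ F, ‖c n‖ ^ 2 := by
  have h := (charBasis L).orthonormal.inner_sum c c F
  rw [inner_self_eq_norm_sq_to_K] at h
  have h2 : ∀ n, conj (c n) * c n = ((‖c n‖ ^ 2 : ℝ) : ℂ) := fun n => by
    rw [RCLike.conj_mul]; push_cast; rfl
  simp only [h2, ← Complex.ofReal_sum] at h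
  refine Complex.ofReal_injective (Eq.trans ?_ h)
  push_cast; rfl

variable (L) in
/-- Orthogonal projection onto the span of the characters with frequencies in `F`. -/
def trunc (F : Finset (ℤ × ℤ)) (v : L2 L) : L2 L :=
  ∑ n ∈ F, (charBasis L).repr v n • charBasis L n

theorem repr_trunc [DecidableEq (ℤ × ℤ)] (F : Finset (ℤ × ℤ)) (v : L2 L) (n : ℤ × ℤ) :
    (charBasis L).repr (trunc L F v) n = if n ∈ F then (charBasis L).repr v n else 0 := by
  classical
  rw [trunc, HilbertBasis.repr_apply_apply, inner_sum]
  simp only [inner_smul_right, orthonormal_iff_ite.1 (charBasis L).orthonormal]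
  simp

theorem norm_trunc_le (F : Finset (ℤ × ℤ)) (v : L2 L) : ‖trunc L F v‖ ≤ ‖v‖ := by
  classical
  have h : ‖trunc L F v‖ ^ 2 ≤ ‖v‖ ^ 2 := by
    have h1 : ‖trunc L F v‖ ^ 2 = ∑ n ∈ F, ‖inner ℂ (charBasis L n) v‖ ^ 2 := by
      rw [trunc, norm_sq_sum_smul_charBasis]
      simp [HilbertBasis.repr_apply_apply]
    rw [h1]
    exact (charBasis L).orthonormal.sum_inner_products_le v
  exact le_of_sq_le_sq h (norm_nonneg _)

theorem norm_sub_trunc_le (F : Finset (ℤ × ℤ)) (v : L2 L) : ‖v - trunc L F v‖ ≤ 2 * ‖v‖ := by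
  have := norm_sub_le v (trunc L F v)
  have := norm_trunc_le F v
  linarith

/-- An exhaustion of the frequencies by finite sets. -/
def freqs (N : ℕ) : Finset (ℤ × ℤ) :=
  (Finset.range N).map (Denumerable.eqv (ℤ × ℤ)).symm.toEmbedding

theorem tendsto_trunc (v : L2 L) :
    Tendsto (fun N => trunc L (freqs N) v) atTop (𝓝 v) := by
  have h := (charBasis L).hasSum_repr v
  rw [← (Denumerable.eqv (ℤ × ℤ)).symm.hasSum_iff] at h
  have h2 := h.tendsto_sum_nat
  simpa [trunc, freqs] using h2

theorem evol_trunc (F : Finset (ℤ × ℤ)) (t : ℝ) (v : L2 L) :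
    evol L t (trunc L F v) = trunc L F (evol L t v) := by
  classical
  refine repr_ext fun n => ?_
  simp only [repr_evol, repr_trunc]
  split_ifs <;> simp

/-- The group is isometric and commutes with truncation, so truncating converges uniformly in `t`;
truncated orbits are finite sums of continuous phases. -/
theorem continuous_evol (v : L2 L) : Continuous fun t => evol L t v := by
  have hu : TendstoUniformly (fun N t => trunc L (freqs N) (evol L t v))
      (fun t => evol L t v) atTop := by
    rw [Metric.tendstoUniformly_iff]
    intro ε hε
    filter_upwards [Metric.tendsto_nhds.1 (tendsto_trunc v) ε hε] with N hN t
    rw [← evol_trunc, LinearIsometryEquiv.dist_map, dist_comm]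
    exact hN
  refine hu.continuous (Frequently.of_forall fun N => ?_)
  simp only [trunc, repr_evol]
  exact continuous_finsetSum _ fun n _ => ((continuous_phase n).mul continuous_const).smul continuous_const

/-- Strong continuity becomes joint continuity because each `evol` is an isometry. -/
theorem continuous_evol_comp {X : Type*} [TopologicalSpace X] {τ : X → ℝ} {q : X → L2 L}
    (hτ : Continuous τ) (hq : Continuous q) : Continuous fun x => evol L (τ x) (q x) := by
  rw [continuous_iff_continuousAt]
  intro x
  have h1 : Tendsto (fun y => evol L (τ y) (q x)) (𝓝 x) (𝓝 (evol L (τ x) (q x))) :=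
    ((continuous_evol (q x)).comp hτ).continuousAt
  refine (tendsto_iff_of_dist ?_).1 h1
  have : ∀ y, dist (evol L (τ y) (q x)) (evol L (τ y) (q y)) = dist (q x) (q y) :=
    fun y => (evol L (τ y)).dist_map _ _
  simp only [this]
  have h2 : Tendsto (fun y => dist (q x) (q y)) (𝓝 x) (𝓝 (dist (q x) (q x))) :=
    (tendsto_const_nhds.dist hq.continuousAt)
  simpa using h2

end HilbertBasis

/-! ### Counting frequencies in thin annuli. -/

section Counting

variable {L : ℝ}

/-- Used to see that bounded differences of frequencies take finitely many values. -/
theorem finite_eigenvalue_le (hL : 0 < L) (R : ℝ) : {n : ℤ × ℤ | eigenvalue L n ≤ R}.Finite := by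
  have key : ∀ (c : ℝ), 0 < c → ∀ k : ℤ, c * (k : ℝ) ^ 2 ≤ R → k ∈ Set.Icc (-⌈R / c⌉) ⌈R / c⌉ := by
    intro c hc k hk
    have h1 : (k : ℝ) ^ 2 ≤ R / c := by rw [le_div_iff₀ hc]; linarith
    have h2 : |(k : ℝ)| ≤ (k : ℝ) ^ 2 := by
      rw [← sq_abs]
      have : |(k : ℝ)| = ((|k| : ℤ) : ℝ) := by push_cast; rfl
      rw [this]
      exact_mod_cast Int.le_self_sq _
    have h3 : ((|k| : ℤ) : ℝ) ≤ ⌈R / c⌉ := by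
      push_cast; exact (h2.trans h1).trans (Int.le_ceil _)
    exact abs_le.1 (by exact_mod_cast h3)
  refine ((Set.finite_Icc (-⌈R / (2 * Real.pi) ^ 2⌉) ⌈R / (2 * Real.pi) ^ 2⌉).prod
    (Set.finite_Icc (-⌈R / (2 * Real.pi / L) ^ 2⌉) ⌈R / (2 * Real.pi / L) ^ 2⌉)).subset ?_
  rintro ⟨n1, n2⟩ hn
  simp only [eigenvalue, mem_ofPred_eq] at hn
  refine ⟨key _ (by positivity) _ ?_, key _ (by positivity) _ ?_⟩
  · nlinarith [sq_nonneg (2 * Real.pi * n2 / L)]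
  · have : (2 * Real.pi * n2 / L) ^ 2 = (2 * Real.pi / L) ^ 2 * (n2 : ℝ) ^ 2 := by ring
    nlinarith [sq_nonneg (2 * Real.pi * n1)]

/-- The spectral gap makes the count below uniform in `p ≠ 0`, where one divides by `eigenvalue L
p`. -/
theorem exists_pos_le_eigenvalue (hL : 0 < L) : ∃ c : ℝ, 0 < c ∧ ∀ n : ℤ × ℤ, n ≠ 0 →
    c ≤ eigenvalue L n := by
  refine ⟨min ((2 * Real.pi) ^ 2) ((2 * Real.pi / L) ^ 2), by positivity, ?_⟩
  rintro ⟨n1, n2⟩ hn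
  have hone : ∀ k : ℤ, k ≠ 0 → (1 : ℝ) ≤ (k : ℝ) ^ 2 := fun k hk => by
    exact_mod_cast (show 0 < k ^ 2 by positivity)
  have e : eigenvalue L (n1, n2) = (2 * Real.pi) ^ 2 * (n1 : ℝ) ^ 2
    + (2 * Real.pi / L) ^ 2 * (n2 : ℝ) ^ 2 := by simp only [eigenvalue]; ring
  rw [e]
  by_cases h1 : n1 = 0
  · have h2 : n2 ≠ 0 := fun h => hn (by simp [h1, h])
    refine (min_le_right _ _).trans ?_
    have : 0 ≤ (2 * Real.pi) ^ 2 * (n1 : ℝ) ^ 2 := by positivity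
    nlinarith [hone n2 h2, sq_nonneg (2 * Real.pi / L)]
  · refine (min_le_left _ _).trans ?_
    have : 0 ≤ (2 * Real.pi / L) ^ 2 * (n2 : ℝ) ^ 2 := by positivity
    nlinarith [hone n1 h1, sq_nonneg (2 * Real.pi)]

/-- For equal signs `|x - y| ≤ |x + y|`, so `(x - y)² ≤ |x² - y²|`. -/
theorem sq_sub_le_of_mul_nonneg {x y c : ℝ} (h : 0 ≤ x * y) (h1 : x ^ 2 - y ^ 2 ≤ c)
    (h2 : y ^ 2 - x ^ 2 ≤ c) : (x - y) ^ 2 ≤ c := by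
  have h3 : |x - y| ≤ |x + y| := sq_le_sq.1 (by nlinarith)
  have h4 : |x - y| * |x + y| ≤ c := by
    rw [← abs_mul, abs_le]
    constructor <;> nlinarith
  nlinarith [sq_abs (x - y), abs_nonneg (x - y)]

/-- Planar geometry behind the counting of frequencies: two points `(x, y)`, `(x', y')` which,
together with their reflections in `(p, q) / 2`, lie in an annulus, and which lie on the same
side of the line through `0` and `(p, q)`, are close to each other. -/
theorem sq_dist_le_of_annulus {p q x y x' y' μ w : ℝ}
    (h1 : μ ≤ x ^ 2 + y ^ 2) (h2 : x ^ 2 + y ^ 2 ≤ μ + w)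
    (h3 : μ ≤ (p - x) ^ 2 + (q - y) ^ 2) (h4 : (p - x) ^ 2 + (q - y) ^ 2 ≤ μ + w)
    (h1' : μ ≤ x' ^ 2 + y' ^ 2) (h2' : x' ^ 2 + y' ^ 2 ≤ μ + w)
    (h3' : μ ≤ (p - x') ^ 2 + (q - y') ^ 2) (h4' : (p - x') ^ 2 + (q - y') ^ 2 ≤ μ + w)
    (hD : 0 ≤ (p * y - q * x) * (p * y' - q * x')) :
    4 * (p ^ 2 + q ^ 2) * ((x - x') ^ 2 + (y - y') ^ 2) ≤ 5 * w ^ 2 + 4 * w * (p ^ 2 + q ^ 2) := by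
  have hw : 0 ≤ w := by linarith
  set S := p ^ 2 + q ^ 2 with hS
  have hS0 : 0 ≤ S := by positivity
  -- For `m = 2(x, y) - (p, q)`: `B` and `D` are its components along and across `(p, q)`, scaled by
  -- `√S`, and `K = |m|²`. The annulus bounds `B`, a difference of two squared radii, by `w`, and by
  -- the parallelogram law confines `K` to an interval of length `4w`. So `D² = S K - B²` is nearly
  -- determined, and being on the same side fixes the sign of `D`.
  set B := p * (2 * x - p) + q * (2 * y - q) with hB
  set B' := p * (2 * x' - p) + q * (2 * y' - q) with hB'
  set D := p * (2 * y - q) - q * (2 * x - p) with hDD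
  set D' := p * (2 * y' - q) - q * (2 * x' - p) with hDD'
  set K := (2 * x - p) ^ 2 + (2 * y - q) ^ 2 with hK
  set K' := (2 * x' - p) ^ 2 + (2 * y' - q) ^ 2 with hK'
  have eB : B ^ 2 + D ^ 2 = S * K := by simp only [hB, hDD, hS, hK]; ring
  have eB' : B' ^ 2 + D' ^ 2 = S * K' := by simp only [hB', hDD', hS, hK']; ring
  have fB : B = (x ^ 2 + y ^ 2) - ((p - x) ^ 2 + (q - y) ^ 2) := by simp only [hB]; ring
  have fB' : B' = (x' ^ 2 + y' ^ 2) - ((p - x') ^ 2 + (q - y') ^ 2) := by simp only [hB']; ring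
  have fK : K = 2 * (x ^ 2 + y ^ 2) + 2 * ((p - x) ^ 2 + (q - y) ^ 2) - S := by
    simp only [hK, hS]; ring
  have fK' : K' = 2 * (x' ^ 2 + y' ^ 2) + 2 * ((p - x') ^ 2 + (q - y') ^ 2) - S := by
    simp only [hK', hS]; ring
  have b1 : |B| ≤ w := by rw [abs_le]; constructor <;> linarith
  have b1' : |B'| ≤ w := by rw [abs_le]; constructor <;> linarith
  have b2 : B ^ 2 ≤ w ^ 2 := sq_le_sq' (abs_le.1 b1).1 (abs_le.1 b1).2
  have b2' : B' ^ 2 ≤ w ^ 2 := sq_le_sq' (abs_le.1 b1').1 (abs_le.1 b1').2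
  have k1 : K - K' ≤ 4 * w := by linarith
  have k2 : K' - K ≤ 4 * w := by linarith
  have d3 : 0 ≤ D * D' := by
    have : D * D' = 4 * ((p * y - q * x) * (p * y' - q * x')) := by
      simp only [hDD, hDD']; ring
    rw [this]; positivity
  have e : (B - B') ^ 2 + (D - D') ^ 2 = 4 * S * ((x - x') ^ 2 + (y - y') ^ 2) := by
    simp only [hB, hB', hDD, hDD', hS]; ring
  rw [← e]
  clear_value S B B' D D' K K'
  clear fB fB' fK fK' hD h1 h2 h3 h4 h1' h2' h3' h4' hS hB hB' hDD hDD' hK hK'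
  have m1 := mul_le_mul_of_nonneg_left k1 hS0
  have m2 := mul_le_mul_of_nonneg_left k2 hS0
  have d1 : D ^ 2 - D' ^ 2 ≤ 4 * w * S + w ^ 2 := by linarith [sq_nonneg B]
  have d2 : D' ^ 2 - D ^ 2 ≤ 4 * w * S + w ^ 2 := by linarith [sq_nonneg B']
  have d4 := sq_sub_le_of_mul_nonneg d3 d1 d2
  have b3 : (B - B') ^ 2 ≤ 4 * w ^ 2 := by linarith [sq_nonneg (B + B')]
  linarith

/-- The number of representations of `p ≠ 0` as a sum of two frequencies in an eigenvalue window
of width `w` is bounded uniformly. -/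
theorem exists_card_window_le (hL : 0 < L) (w : ℝ) : ∃ N : ℕ, ∀ (μ : ℝ) (F : Finset (ℤ × ℤ)),
    (∀ n ∈ F, μ ≤ eigenvalue L n ∧ eigenvalue L n ≤ μ + w) → ∀ p : ℤ × ℤ, p ≠ 0 →
      (F.filter fun n => p - n ∈ F).card ≤ N := by
  classical
  obtain ⟨c, hc, hcn⟩ := exists_pos_le_eigenvalue hL
  -- `R` is the bound of `sq_dist_le_of_annulus` divided by `4 * eigenvalue L p`, with `c ≤
  -- eigenvalue L p`. On one side of the line through `p`, all admissible frequencies differ from a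
  -- fixed one by an element of `V`; the factor `2` counts the sides.
  set R : ℝ := (5 * w ^ 2 / c + 4 * w) / 4 with hR
  set V : Finset (ℤ × ℤ) := (finite_eigenvalue_le hL R).toFinset with hV
  refine ⟨2 * V.card, fun μ F hF p hp => ?_⟩
  set α : ℝ := 2 * Real.pi
  set β : ℝ := 2 * Real.pi / L
  have ev : ∀ n : ℤ × ℤ, eigenvalue L n = (α * n.1) ^ 2 + (β * n.2) ^ 2 := fun n => by
    simp only [eigenvalue, α, β]; ring
  -- Cross product with `p` in rescaled coordinates: its sign tells the side of the line through
  -- `p`.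
  let d : ℤ × ℤ → ℝ := fun n => (α * p.1) * (β * n.2) - (β * p.2) * (α * n.1)
  have close : ∀ n ∈ F.filter (fun n => p - n ∈ F), ∀ n' ∈ F.filter (fun n => p - n ∈ F),
      0 ≤ d n * d n' → n - n' ∈ V := by
    intro n hn n' hn' hd
    rw [Finset.mem_filter] at hn hn'
    have a1 := hF _ hn.1
    have a2 := hF _ hn.2
    have a3 := hF _ hn'.1
    have a4 := hF _ hn'.2
    rw [ev] at a1 a2 a3 a4
    simp only [Prod.fst_sub, Prod.snd_sub, Int.cast_sub, mul_sub] at a2 a4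
    have := sq_dist_le_of_annulus a1.1 a1.2 a2.1 a2.2 a3.1 a3.2 a4.1 a4.2 hd
    rw [hV, Set.Finite.mem_toFinset, mem_ofPred_eq, ev]
    have hS := hcn p hp
    rw [ev] at hS
    simp only [Prod.fst_sub, Prod.snd_sub, Int.cast_sub, mul_sub]
    set S := (α * p.1) ^ 2 + (β * p.2) ^ 2
    set X := (α * n.1 - α * n'.1) ^ 2 + (β * n.2 - β * n'.2) ^ 2
    have hS0 : 0 < S := hc.trans_le hS
    have h5 : 4 * X ≤ 5 * w ^ 2 / S + 4 * w := by
      have : 5 * w ^ 2 / S + 4 * w = (5 * w ^ 2 + 4 * w * S) / S := by field_simp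
      rw [this, le_div_iff₀ hS0]; linarith
    have h6 : 5 * w ^ 2 / S ≤ 5 * w ^ 2 / c := div_le_div_of_nonneg_left (by positivity) hc hS
    rw [hR]; linarith
  have clust : ∀ H : Finset (ℤ × ℤ), H ⊆ F.filter (fun n => p - n ∈ F) →
      (∀ n ∈ H, ∀ n' ∈ H, 0 ≤ d n * d n') → H.card ≤ V.card := by
    intro H hH hd
    rcases H.eq_empty_or_nonempty with rfl | ⟨m, hm⟩
    · simp
    · refine Finset.card_le_card_of_injOn (fun n => n - m)
        (fun n hn => close n (hH hn) m (hH hm) (hd n hn m hm)) ?_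
      intro x _ y _ hxy
      exact sub_left_injective hxy
  have hsplit := Finset.card_filter_add_card_filter_not (s := F.filter fun n => p - n ∈ F)
    (fun n => 0 ≤ d n)
  have c1 := clust ((F.filter fun n => p - n ∈ F).filter fun n => 0 ≤ d n)
    (Finset.filter_subset _ _) (fun n hn n' hn' =>
      mul_nonneg (Finset.mem_filter.1 hn).2 (Finset.mem_filter.1 hn').2)
  have c2 := clust ((F.filter fun n => p - n ∈ F).filter fun n => ¬ 0 ≤ d n)
    (Finset.filter_subset _ _) (fun n hn n' hn' =>
      mul_nonneg_of_nonpos_of_nonpos (le_of_not_ge (Finset.mem_filter.1 hn).2)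
        (le_of_not_ge (Finset.mem_filter.1 hn').2))
  omega

end Counting

/-! ### The space estimate for one eigenvalue window. -/

section Window

variable {L : ℝ} [hL : Fact (0 < L)]

theorem integrable_of_continuous {E : Type*} [NormedAddCommGroup E] {f : Torus L → E}
    (hf : Continuous f) : Integrable f := by
  rw [← integrableOn_univ]
  exact hf.continuousOn.integrableOn_compact isCompact_univ

theorem integral_norm_sq_sum_character (P : Finset (ℤ × ℤ)) (c : ℤ × ℤ → ℂ) :
    ∫ z : Torus L, ‖∑ p ∈ P, c p * character L p z‖ ^ 2 = L * ∑ p ∈ P, ‖c p‖ ^ 2 := by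
  have h1 : ∀ z : Torus L, ((‖∑ p ∈ P, c p * character L p z‖ ^ 2 : ℝ) : ℂ) =
      ∑ p ∈ P, ∑ q ∈ P, (conj (c p) * c q) * character L (-p + q) z := by
    intro z
    push_cast
    rw [← Complex.conj_mul', map_sum, Finset.sum_mul_sum]
    refine Finset.sum_congr rfl fun p _ => Finset.sum_congr rfl fun q _ => ?_
    rw [map_mul, character_add, character_neg]; ring
  have h2 : ((∫ z : Torus L, ‖∑ p ∈ P, c p * character L p z‖ ^ 2 : ℝ) : ℂ) =
      ((L * ∑ p ∈ P, ‖c p‖ ^ 2 : ℝ) : ℂ) := by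
    rw [← integral_complex_ofReal]
    simp only [h1]
    have hint : ∀ p q, Integrable fun z : Torus L => (conj (c p) * c q) * character L (-p + q) z :=
      fun p q => integrable_of_continuous (by fun_prop)
    rw [integral_finsetSum _ fun p _ => integrable_finsetSum _ fun q _ => hint p q]
    have : ∀ p ∈ P, ∫ z : Torus L, ∑ q ∈ P, (conj (c p) * c q) * character L (-p + q) z
        = L * (conj (c p) * c p) := by
      intro p hp
      rw [integral_finsetSum _ fun q _ => hint p q]
      simp only [integral_const_mul, integral_character, neg_add_eq_zero]
      simp [hp]; ring
    rw [Finset.sum_congr rfl this, ← Finset.mul_sum]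
    push_cast
    congr 1
    exact Finset.sum_congr rfl fun p _ => Complex.conj_mul' _
  exact_mod_cast h2

/-- The `L² → L⁴` estimate for functions with frequencies in an eigenvalue window. -/
theorem exists_integral_norm_pow_four_le (w : ℝ) : ∃ C : ℝ, 0 ≤ C ∧ ∀ (μ : ℝ) (F : Finset (ℤ × ℤ)),
    (∀ n ∈ F, μ ≤ eigenvalue L n ∧ eigenvalue L n ≤ μ + w) → ∀ b : ℤ × ℤ → ℂ,
      ∫ z : Torus L, ‖∑ n ∈ F, b n * character L n z‖ ^ 4 ≤ C * (∑ n ∈ F, ‖b n‖ ^ 2) ^ 2 := by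
  classical
  obtain ⟨N, hN⟩ := exists_card_window_le hL.out w
  refine ⟨L * (N + 1), mul_nonneg hL.out.le (by positivity), fun μ F hF b => ?_⟩
  set S := ∑ n ∈ F, ‖b n‖ ^ 2 with hS
  -- Extension by zero turns the coefficients `β p` of the squared sum into a convolution, with no
  -- condition on `p - n`.
  let b' : ℤ × ℤ → ℂ := fun n => if n ∈ F then b n else 0
  have hb' : ∀ n ∈ F, b' n = b n := fun n hn => if_pos hn
  have hb0 : ∀ n, n ∉ F → b' n = 0 := fun n hn => if_neg hn
  let P : Finset (ℤ × ℤ) := (F ×ˢ F).image fun x => x.1 + x.2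
  let β : ℤ × ℤ → ℂ := fun p => ∑ n ∈ F, b n * b' (p - n)
  -- translates of a sum over `F`
  have shift : ∀ {M : Type} [AddCommMonoid M] (f : ℤ × ℤ → ℤ × ℤ → M),
      (∀ p n, p - n ∉ F → f p n = 0) → ∀ n ∈ F, ∑ p ∈ P, f p n = ∑ m ∈ F, f (n + m) n := by
    intro M _ f hf n hn
    have hsub : F.image (fun m => n + m) ⊆ P := by
      intro p hp
      obtain ⟨m, hm, rfl⟩ := Finset.mem_image.1 hp
      exact Finset.mem_image.2 ⟨(n, m), Finset.mk_mem_product hn hm, rfl⟩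
    rw [← Finset.sum_subset hsub, Finset.sum_image fun x _ y _ h => add_left_cancel h]
    intro p _ hp
    refine hf p n fun h => hp (Finset.mem_image.2 ⟨p - n, h, by abel⟩)
  have hsq : ∀ z, (∑ n ∈ F, b n * character L n z) ^ 2 = ∑ p ∈ P, β p * character L p z := by
    intro z
    simp only [β, Finset.sum_mul]
    rw [Finset.sum_comm, sq, Finset.sum_mul_sum]
    refine Finset.sum_congr rfl fun n hn => ?_
    rw [shift (fun p n => b n * b' (p - n) * character L p z)
      (fun p n h => by simp [hb0 _ h]) n hn]
    refine Finset.sum_congr rfl fun m hm => ?_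
    rw [add_sub_cancel_left, hb' m hm, character_add]; ring
  have e1 : ∫ z : Torus L, ‖∑ n ∈ F, b n * character L n z‖ ^ 4 = L * ∑ p ∈ P, ‖β p‖ ^ 2 := by
    rw [← integral_norm_sq_sum_character]
    refine integral_congr_ae (Eventually.of_forall fun z => ?_)
    simp only [← hsq, norm_pow]; ring
  rw [e1, mul_assoc]
  refine mul_le_mul_of_nonneg_left ?_ hL.out.le
  have hS0 : 0 ≤ S := Finset.sum_nonneg fun _ _ => by positivity
  have htr : ∀ p, ∑ n ∈ F, ‖b' (p - n)‖ ^ 2 ≤ S := by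
    intro p
    have : ∑ n ∈ F, ‖b' (p - n)‖ ^ 2 = ∑ m ∈ F.image (fun n => p - n), ‖b' m‖ ^ 2 := by
      rw [Finset.sum_image fun x _ y _ h => sub_right_injective h]
    rw [this, ← Finset.sum_filter_add_sum_filter_not _ (fun m => m ∈ F)]
    have z0 : ∑ m ∈ (F.image fun n => p - n).filter (fun m => m ∉ F), ‖b' m‖ ^ 2 = 0 :=
      Finset.sum_eq_zero fun m hm => by rw [hb0 m (Finset.mem_filter.1 hm).2]; simp
    rw [z0, add_zero, hS]
    have : ∑ m ∈ F, ‖b m‖ ^ 2 = ∑ m ∈ F, ‖b' m‖ ^ 2 :=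
      Finset.sum_congr rfl fun m hm => by rw [hb' m hm]
    rw [this]
    refine Finset.sum_le_sum_of_subset_of_nonneg (fun m hm => (Finset.mem_filter.1 hm).2)
      fun _ _ _ => by positivity
  -- Needed at `p = 0`, where the representations `n + (-n)` are not boundedly many. Plain
  -- Cauchy–Schwarz gives `S²`, affordable for a single `p`; this is the `1` in `N + 1`.
  have bzero : ∀ p, ‖β p‖ ^ 2 ≤ S ^ 2 := by
    intro p
    have h1 : ‖β p‖ ≤ ∑ n ∈ F, ‖b n‖ * ‖b' (p - n)‖ := by
      refine (norm_sum_le _ _).trans_eq ?_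
      simp only [norm_mul]
    calc ‖β p‖ ^ 2 ≤ (∑ n ∈ F, ‖b n‖ * ‖b' (p - n)‖) ^ 2 := by gcongr
      _ ≤ (∑ n ∈ F, ‖b n‖ ^ 2) * ∑ n ∈ F, ‖b' (p - n)‖ ^ 2 := Finset.sum_mul_sq_le_sq_mul_sq _ _ _
      _ ≤ S * S := mul_le_mul_of_nonneg_left (htr p) hS0
      _ = S ^ 2 := (sq S).symm
  have bne : ∀ p, p ≠ 0 → ‖β p‖ ^ 2 ≤ N * ∑ n ∈ F, ‖b n‖ ^ 2 * ‖b' (p - n)‖ ^ 2 := by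
    intro p hp
    have h0 : β p = ∑ n ∈ F.filter (fun n => p - n ∈ F), b n * b' (p - n) := by
      refine (Finset.sum_filter_of_ne fun n _ hne => ?_).symm
      by_contra h
      exact hne (by simp [hb0 _ h])
    have h1 : ‖β p‖ ≤ ∑ n ∈ F.filter (fun n => p - n ∈ F), ‖b n‖ * ‖b' (p - n)‖ := by
      rw [h0]
      refine (norm_sum_le _ _).trans_eq ?_
      simp only [norm_mul]
    calc ‖β p‖ ^ 2 ≤ (∑ n ∈ F.filter (fun n => p - n ∈ F), ‖b n‖ * ‖b' (p - n)‖) ^ 2 := by gcongr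
      _ ≤ (F.filter (fun n => p - n ∈ F)).card *
          ∑ n ∈ F.filter (fun n => p - n ∈ F), (‖b n‖ * ‖b' (p - n)‖) ^ 2 :=
        sq_sum_le_card_mul_sum_sq
      _ ≤ N * ∑ n ∈ F, (‖b n‖ * ‖b' (p - n)‖) ^ 2 := by
        gcongr
        · exact hN μ F hF p hp
        · exact Finset.filter_subset _ _
      _ = _ := by simp only [mul_pow]
  have ball : ∀ p, ‖β p‖ ^ 2 ≤ (if p = 0 then S ^ 2 else 0)
      + N * ∑ n ∈ F, ‖b n‖ ^ 2 * ‖b' (p - n)‖ ^ 2 := by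
    intro p
    split_ifs with h
    · have : 0 ≤ N * ∑ n ∈ F, ‖b n‖ ^ 2 * ‖b' (p - n)‖ ^ 2 := by positivity
      linarith [bzero p]
    · linarith [bne p h]
  have tot : ∑ p ∈ P, ∑ n ∈ F, ‖b n‖ ^ 2 * ‖b' (p - n)‖ ^ 2 = S * S := by
    rw [Finset.sum_comm, hS, Finset.sum_mul]
    refine Finset.sum_congr rfl fun n hn => ?_
    rw [shift (fun p n => ‖b n‖ ^ 2 * ‖b' (p - n)‖ ^ 2) (fun p n h => by simp [hb0 _ h]) n hn,
      Finset.mul_sum]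
    refine Finset.sum_congr rfl fun m hm => ?_
    rw [add_sub_cancel_left, hb' m hm]
  calc ∑ p ∈ P, ‖β p‖ ^ 2 ≤ ∑ p ∈ P, ((if p = 0 then S ^ 2 else 0)
      + N * ∑ n ∈ F, ‖b n‖ ^ 2 * ‖b' (p - n)‖ ^ 2) := Finset.sum_le_sum fun p _ => ball p
    _ ≤ S ^ 2 + N * (S * S) := by
      rw [Finset.sum_add_distrib, ← Finset.mul_sum, tot, Finset.sum_ite_eq']
      have : (if (0 : ℤ × ℤ) ∈ P then S ^ 2 else 0) ≤ S ^ 2 := by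
        split_ifs
        · exact le_rfl
        · positivity
      linarith
    _ = (N + 1) * S ^ 2 := by ring

end Window

/-! ### Squared forms of the triangle and Cauchy–Schwarz inequalities in `ℝ≥0∞`. -/

section Auxiliary

theorem add_sq_le_four_mul (a b : ℝ≥0∞) : (a + b) ^ 2 ≤ 4 * (a ^ 2 + b ^ 2) := by
  have h : a + b ≤ 2 * max a b := by
    rw [two_mul]; exact add_le_add (le_max_left _ _) (le_max_right _ _)
  calc (a + b) ^ 2 ≤ (2 * max a b) ^ 2 := by gcongr
    _ = 4 * max a b ^ 2 := by rw [mul_pow]; norm_num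
    _ ≤ 4 * (a ^ 2 + b ^ 2) := by
      gcongr
      rcases le_total a b with h | h
      · rw [max_eq_right h]; exact le_add_self
      · rw [max_eq_left h]; exact le_self_add

theorem sq_lintegral_mul_le {α : Type*} [MeasurableSpace α] (μ : Measure α) {f g : α → ℝ≥0∞}
    (hf : AEMeasurable f μ) (hg : AEMeasurable g μ) :
    (∫⁻ x, f x * g x ∂μ) ^ 2 ≤ (∫⁻ x, f x ^ 2 ∂μ) * ∫⁻ x, g x ^ 2 ∂μ := by
  have h := ENNReal.lintegral_mul_le_Lp_mul_Lq μ (Real.HolderConjugate.two_two) hf hg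
  simp only [Pi.mul_apply, ENNReal.rpow_two] at h
  calc (∫⁻ x, f x * g x ∂μ) ^ 2
      ≤ ((∫⁻ x, f x ^ 2 ∂μ) ^ (1 / 2 : ℝ) * (∫⁻ x, g x ^ 2 ∂μ) ^ (1 / 2 : ℝ)) ^ 2 := by gcongr
    _ = _ := by
      rw [mul_pow, ← ENNReal.rpow_two, ← ENNReal.rpow_two, ← ENNReal.rpow_mul, ← ENNReal.rpow_mul]
      norm_num

theorem sq_lintegral_le {α : Type*} [MeasurableSpace α] (μ : Measure α) {f : α → ℝ≥0∞}
    (hf : AEMeasurable f μ) : (∫⁻ x, f x ∂μ) ^ 2 ≤ μ univ * ∫⁻ x, f x ^ 2 ∂μ := by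
  simpa using sq_lintegral_mul_le μ (aemeasurable_const (b := (1 : ℝ≥0∞))) hf

end Auxiliary

/-! ### Parseval's identity on the time interval. -/

section TimeOrthogonality

theorem integral_norm_sq_sum_fourier {T : ℝ} [hT : Fact (0 < T)] (M : Finset ℤ) (x : ℤ → ℂ) :
    ∫ t : AddCircle T, ‖∑ k ∈ M, x k * fourier k t‖ ^ 2 = T * ∑ k ∈ M, ‖x k‖ ^ 2 := by
  have h1 : ∀ t : AddCircle T, ((‖∑ k ∈ M, x k * fourier k t‖ ^ 2 : ℝ) : ℂ) =
      ∑ p ∈ M, ∑ q ∈ M, (conj (x p) * x q) * fourier (-p + q) t := by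
    intro t
    push_cast
    rw [← Complex.conj_mul', map_sum, Finset.sum_mul_sum]
    refine Finset.sum_congr rfl fun p _ => Finset.sum_congr rfl fun q _ => ?_
    rw [map_mul, fourier_add, fourier_neg]; ring
  have h2 : ((∫ t : AddCircle T, ‖∑ k ∈ M, x k * fourier k t‖ ^ 2 : ℝ) : ℂ) =
      ((T * ∑ p ∈ M, ‖x p‖ ^ 2 : ℝ) : ℂ) := by
    rw [← integral_complex_ofReal]
    simp only [h1]
    have hint : ∀ p q, Integrable fun t : AddCircle T => (conj (x p) * x q) * fourier (-p + q) t :=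
      fun p q => by
        rw [← integrableOn_univ]
        exact Continuous.continuousOn (by fun_prop) |>.integrableOn_compact isCompact_univ
    rw [integral_finsetSum _ fun p _ => integrable_finsetSum _ fun q _ => hint p q]
    have : ∀ p ∈ M, ∫ t : AddCircle T, ∑ q ∈ M, (conj (x p) * x q) * fourier (-p + q) t
        = T * (conj (x p) * x p) := by
      intro p hp
      rw [integral_finsetSum _ fun q _ => hint p q]
      simp only [integral_const_mul, integral_fourier, neg_add_eq_zero]
      simp [hp]; ring
    rw [Finset.sum_congr rfl this, ← Finset.mul_sum]
    push_cast
    congr 1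
    exact Finset.sum_congr rfl fun p _ => Complex.conj_mul' _
  exact_mod_cast h2

/-- Orthogonality in time of the harmonics of `(0, T)`. -/
theorem lintegral_norm_sq_sum_exp {T : ℝ} (hT : 0 < T) (M : Finset ℤ) (x : ℤ → ℂ) :
    ∫⁻ t in Set.Ioo 0 T, ‖∑ k ∈ M,
      x k * Complex.exp (-Complex.I * t * ((2 * Real.pi / T : ℝ) * k : ℝ))‖ₑ ^ 2 =
      ENNReal.ofReal T * ∑ k ∈ M, ‖x k‖ₑ ^ 2 := by
  have : Fact (0 < T) := ⟨hT⟩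
  -- The Schrödinger phases have a minus sign; conjugating the sum and its coefficients produces
  -- `fourier k` without changing moduli.
  have e : ∀ t : ℝ, ∑ k ∈ M, x k * Complex.exp (-Complex.I * t * ((2 * Real.pi / T : ℝ) * k : ℝ))
      = conj (∑ k ∈ M, conj (x k) * fourier k (t : AddCircle T)) := by
    intro t
    rw [map_sum]
    refine Finset.sum_congr rfl fun k _ => ?_
    rw [map_mul, Complex.conj_conj, fourier_coe_apply, ← Complex.exp_conj]
    congr 2
    simp only [map_div₀, map_mul, Complex.conj_I, Complex.conj_ofReal, map_ofNat, map_intCast]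
    push_cast
    ring
  have h := integral_norm_sq_sum_fourier (T := T) M (fun k => conj (x k))
  rw [← AddCircle.intervalIntegral_preimage T 0
    (fun t : AddCircle T => ‖∑ k ∈ M, conj (x k) * fourier k t‖ ^ 2), zero_add,
    intervalIntegral.integral_of_le hT.le, integral_Ioc_eq_integral_Ioo] at h
  have hc : Continuous fun t : ℝ => ‖∑ k ∈ M, conj (x k) * fourier k (t : AddCircle T)‖ ^ 2 := by
    have : Continuous fun t : ℝ => (t : AddCircle T) := AddCircle.continuous_mk' T
    fun_prop
  have h2 := ofReal_integral_eq_lintegral_ofReal (μ := volume.restrict (Set.Ioo 0 T))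
    ((hc.continuousOn.integrableOn_compact (isCompact_Icc (a := 0) (b := T))).mono_set
      Ioo_subset_Icc_self) (Eventually.of_forall fun _ => by positivity)
  rw [h] at h2
  have conv : ∀ y : ℂ, ‖y‖ₑ ^ 2 = ENNReal.ofReal (‖y‖ ^ 2) := fun y => by
    rw [ENNReal.ofReal_pow (norm_nonneg _), ofReal_norm]
  simp only [e, conv, RCLike.norm_conj]
  rw [← h2, ENNReal.ofReal_mul hT.le, ENNReal.ofReal_sum_of_nonneg fun _ _ => by positivity]
  simp only [RCLike.norm_conj]

end TimeOrthogonality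

/-! ### Zygmund's inequality for trigonometric polynomials. -/

section Strichartz

variable {L : ℝ} [hL : Fact (0 < L)]

/-- The window of width `w` to which the eigenvalue of `n` belongs. -/
def window (L w : ℝ) (n : ℤ × ℤ) : ℤ := ⌊eigenvalue L n / w⌋

/-- The position of the eigenvalue of `n` in its window. -/
def offset (L w : ℝ) (n : ℤ × ℤ) : ℝ := eigenvalue L n - w * window L w n

omit hL in
theorem offset_nonneg {w : ℝ} (hw : 0 < w) (n : ℤ × ℤ) : 0 ≤ offset L w n := by
  have := Int.floor_le (eigenvalue L n / w)
  rw [le_div_iff₀ hw] at this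
  unfold offset window; linarith

omit hL in
theorem offset_le {w : ℝ} (hw : 0 < w) (n : ℤ × ℤ) : offset L w n ≤ w := by
  have := (Int.lt_floor_add_one (eigenvalue L n / w)).le
  rw [div_le_iff₀ hw] at this
  unfold offset window; linarith

/-- The sum of the squares of the moduli of the pieces in the eigenvalue windows of a
trigonometric polynomial. -/
def squareSum (L w : ℝ) (F : Finset (ℤ × ℤ)) (c : ℤ × ℤ → ℂ) (z : Torus L) : ℝ≥0∞ :=
  ∑ k ∈ F.image (window L w), ‖∑ n ∈ F.filter (fun n => window L w n = k),
    c n * character L n z‖ₑ ^ 2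

/-- Expand the square over pairs of windows: the integral of `|g_k|² |g_l|²` is at most `C s_k s_l`
by the single-window estimate, and the masses `s_k` add up to the total mass. -/
theorem exists_lintegral_squareSum_le {w : ℝ} (hw : 0 < w) : ∃ C : ℝ≥0, ∀ (F : Finset (ℤ × ℤ))
    (c : ℤ × ℤ → ℂ), ∫⁻ z, squareSum L w F c z ^ 2 ≤ C * (∑ n ∈ F, ‖c n‖ₑ ^ 2) ^ 2 := by
  classical
  obtain ⟨C, hC, h⟩ := exists_integral_norm_pow_four_le (L := L) w
  refine ⟨C.toNNReal, fun F c => ?_⟩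
  set M := F.image (window L w)
  let G : ℤ → Finset (ℤ × ℤ) := fun k => F.filter (fun n => window L w n = k)
  let g : ℤ → Torus L → ℂ := fun k z => ∑ n ∈ G k, c n * character L n z
  let s : ℤ → ℝ := fun k => ∑ n ∈ G k, ‖c n‖ ^ 2
  have hs : ∀ k, 0 ≤ s k := fun k => Finset.sum_nonneg fun _ _ => by positivity
  have gc : ∀ k, Continuous (g k) := fun k => by fun_prop
  have hg : ∀ k, ∫ z, ‖g k z‖ ^ 4 ≤ C * s k ^ 2 := by
    intro k
    refine h (w * k) (G k) (fun n hn => ?_) c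
    have hn' : window L w n = k := (Finset.mem_filter.1 hn).2
    have h1 := offset_nonneg (L := L) hw n
    have h2 := offset_le (L := L) hw n
    rw [offset, hn'] at h1 h2
    constructor <;> linarith
  have hsum : ∑ k ∈ M, s k = ∑ n ∈ F, ‖c n‖ ^ 2 :=
    Finset.sum_fiberwise_of_maps_to (fun n hn => Finset.mem_image_of_mem _ hn) _
  have cross : ∀ k l, ∫ z, ‖g k z‖ ^ 2 * ‖g l z‖ ^ 2 ≤ C * (s k * s l) := by
    intro k l
    have i4 : ∀ k, Integrable fun z => ‖g k z‖ ^ 4 :=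
      fun k => integrable_of_continuous (by have := gc k; fun_prop)
    have ikl : Integrable fun z => ‖g k z‖ ^ 2 * ‖g l z‖ ^ 2 :=
      integrable_of_continuous (by have := gc k; have := gc l; fun_prop)
    rcases (hs k).eq_or_lt with hk | hk
    · have z0 : ∀ n ∈ G k, c n = 0 := by
        have := (Finset.sum_eq_zero_iff_of_nonneg fun n _ => by positivity).1 hk.symm
        intro n hn
        simpa using this n hn
      have : ∀ z, g k z = 0 := fun z => Finset.sum_eq_zero fun n hn => by rw [z0 n hn, zero_mul]
      simp [this, ← hk]
    rcases (hs l).eq_or_lt with hl | hl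
    · have z0 : ∀ n ∈ G l, c n = 0 := by
        have := (Finset.sum_eq_zero_iff_of_nonneg fun n _ => by positivity).1 hl.symm
        intro n hn
        simpa using this n hn
      have : ∀ z, g l z = 0 := fun z => Finset.sum_eq_zero fun n hn => by rw [z0 n hn, zero_mul]
      simp [this, ← hl]
    -- Young's inequality with weight `s l / s k`, chosen so that both terms integrate to half of `C
    -- * (s k * s l)`; hence the separate treatment of vanishing masses.
    have pw : ∀ z, ‖g k z‖ ^ 2 * ‖g l z‖ ^ 2 ≤
        (s l / s k / 2) * ‖g k z‖ ^ 4 + (s k / s l / 2) * ‖g l z‖ ^ 4 := by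
      intro z
      set a := ‖g k z‖ ^ 2
      set b := ‖g l z‖ ^ 2
      have e1 : ‖g k z‖ ^ 4 = a ^ 2 := by simp only [a]; ring
      have e2 : ‖g l z‖ ^ 4 = b ^ 2 := by simp only [b]; ring
      rw [e1, e2]
      have : s l / s k / 2 * a ^ 2 + s k / s l / 2 * b ^ 2 - a * b
          = (s l * a - s k * b) ^ 2 / (2 * s k * s l) := by field_simp; ring
      have h0 : 0 ≤ (s l * a - s k * b) ^ 2 / (2 * s k * s l) := by positivity
      linarith
    calc ∫ z, ‖g k z‖ ^ 2 * ‖g l z‖ ^ 2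
        ≤ ∫ z, ((s l / s k / 2) * ‖g k z‖ ^ 4 + (s k / s l / 2) * ‖g l z‖ ^ 4) :=
          integral_mono ikl (((i4 k).const_mul _).add ((i4 l).const_mul _)) pw
      _ = (s l / s k / 2) * (∫ z, ‖g k z‖ ^ 4) + (s k / s l / 2) * (∫ z, ‖g l z‖ ^ 4) := by
          rw [integral_add ((i4 k).const_mul _) ((i4 l).const_mul _), integral_const_mul,
            integral_const_mul]
      _ ≤ (s l / s k / 2) * (C * s k ^ 2) + (s k / s l / 2) * (C * s l ^ 2) := by
          gcongr
          · exact hg k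
          · exact hg l
      _ = C * (s k * s l) := by field_simp; ring
  have real : ∫ z, (∑ k ∈ M, ‖g k z‖ ^ 2) ^ 2 ≤ C * (∑ n ∈ F, ‖c n‖ ^ 2) ^ 2 := by
    have ikl : ∀ k l, Integrable fun z => ‖g k z‖ ^ 2 * ‖g l z‖ ^ 2 := fun k l =>
      integrable_of_continuous (by have := gc k; have := gc l; fun_prop)
    have : ∀ z, (∑ k ∈ M, ‖g k z‖ ^ 2) ^ 2 = ∑ k ∈ M, ∑ l ∈ M, ‖g k z‖ ^ 2 * ‖g l z‖ ^ 2 :=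
      fun z => by rw [sq, Finset.sum_mul_sum]
    simp only [this]
    rw [integral_finsetSum _ fun k _ => integrable_finsetSum _ fun l _ => ikl k l]
    rw [← hsum, sq, Finset.sum_mul_sum, Finset.mul_sum]
    refine Finset.sum_le_sum fun k _ => ?_
    rw [integral_finsetSum _ fun l _ => ikl k l, Finset.mul_sum]
    exact Finset.sum_le_sum fun l _ => cross k l
  have conv : ∀ y : ℂ, ‖y‖ₑ ^ 2 = ENNReal.ofReal (‖y‖ ^ 2) := fun y => by
    rw [ENNReal.ofReal_pow (norm_nonneg _), ofReal_norm]
  have e1 : ∀ z, squareSum L w F c z ^ 2 = ENNReal.ofReal ((∑ k ∈ M, ‖g k z‖ ^ 2) ^ 2) := by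
    intro z
    rw [ENNReal.ofReal_pow (Finset.sum_nonneg fun _ _ => by positivity),
      ENNReal.ofReal_sum_of_nonneg fun _ _ => by positivity, squareSum]
    simp only [conv]
    rfl
  simp only [e1]
  rw [← ofReal_integral_eq_lintegral_ofReal]
  · refine (ENNReal.ofReal_le_ofReal real).trans_eq ?_
    rw [ENNReal.ofReal_mul hC, ENNReal.ofReal_pow (Finset.sum_nonneg fun _ _ => by positivity),
      ENNReal.ofReal_sum_of_nonneg fun _ _ => by positivity]
    simp only [← conv]
    rfl
  · exact integrable_of_continuous (by fun_prop)
  · exact Eventually.of_forall fun _ => by positivity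

/-- A trigonometric polynomial in space, evolved with one frequency of time per window. -/
def windowEvol (L T : ℝ) (F : Finset (ℤ × ℤ)) (c : ℤ × ℤ → ℂ) (t : ℝ) (z : Torus L) : ℂ :=
  ∑ n ∈ F, c n * Complex.exp (-Complex.I * t * ((2 * Real.pi / T : ℝ) *
    window L (2 * Real.pi / T) n : ℝ)) * character L n z

omit hL in
-- All frequencies of one window share a time harmonic of `(0, T)`, and distinct windows have
-- distinct, hence orthogonal, harmonics.
theorem lintegral_windowEvol {T : ℝ} (hT : 0 < T) (F : Finset (ℤ × ℤ)) (c : ℤ × ℤ → ℂ)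
    (z : Torus L) : ∫⁻ t in Set.Ioo 0 T, ‖windowEvol L T F c t z‖ₑ ^ 2 =
      ENNReal.ofReal T * squareSum L (2 * Real.pi / T) F c z := by
  classical
  rw [squareSum, ← lintegral_norm_sq_sum_exp hT]
  refine lintegral_congr fun t => ?_
  congr 2
  rw [windowEvol, ← Finset.sum_fiberwise_of_maps_to
    (fun n hn => Finset.mem_image_of_mem (window L (2 * Real.pi / T)) hn)]
  refine Finset.sum_congr rfl fun k _ => ?_
  rw [Finset.sum_mul]
  refine Finset.sum_congr rfl fun n hn => ?_
  rw [(Finset.mem_filter.1 hn).2]; ring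

/-- The `L⁴(𝕋²; L²(0, T))` estimate for trigonometric polynomials in space whose coefficients,
up to the phases of the windows, vary slowly. -/
theorem exists_lintegral_windowEvol_le {T : ℝ} (hT : 0 < T) : ∃ C : ℝ≥0,
    ∀ (F : Finset (ℤ × ℤ)) (d d' : ℝ → ℤ × ℤ → ℂ) (D : ℝ≥0),
      (∀ n t, HasDerivAt (fun t => d t n) (d' t n) t) → (∀ n, Continuous fun t => d' t n) →
      ∑ n ∈ F, ‖d 0 n‖ₑ ^ 2 ≤ D → (∀ s ∈ Set.Ioo 0 T, ∑ n ∈ F, ‖d' s n‖ₑ ^ 2 ≤ D) →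
      ∫⁻ z, (∫⁻ t in Set.Ioo 0 T, ‖windowEvol L T F (d t) t z‖ₑ ^ 2) ^ 2 ≤ C * D ^ 2 := by
  obtain ⟨C, hC⟩ := exists_lintegral_squareSum_le (L := L) (w := 2 * Real.pi / T) (by positivity)
  set τ := T.toNNReal with hτ
  -- The fours come from `add_sq_le_four_mul`, used for the integrand and again for its time
  -- integral. Each `τ` is the length of `(0, T)`, from time orthogonality, Cauchy–Schwarz in `s`,
  -- or the final integration over `s`.
  refine ⟨4 * ((4 * τ) ^ 2 * C + (4 * τ ^ 2) ^ 2 * (τ * (τ * C))), fun F d d' D hd hd' h0 hD => ?_⟩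
  have hvol : (volume.restrict (Set.Ioo 0 T)) univ = τ := by
    rw [Measure.restrict_apply_univ, Real.volume_Ioo, sub_zero]; rfl
  -- joint continuity
  have jc : Continuous fun x : (ℝ × ℝ) × Torus L => windowEvol L T F (d' x.1.2) x.1.1 x.2 := by
    unfold windowEvol
    refine continuous_finsetSum _ fun n _ => ?_
    have h1 : Continuous fun x : (ℝ × ℝ) × Torus L => d' x.1.2 n := (hd' n).comp (by fun_prop)
    have h2 : Continuous fun x : (ℝ × ℝ) × Torus L => character L n x.2 :=
      (character L n).continuous.comp continuous_snd
    fun_prop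
  have sc : Continuous fun x : ℝ × Torus L => squareSum L (2 * Real.pi / T) F (d' x.1) x.2 := by
    unfold squareSum
    refine continuous_finsetSum _ fun k _ => ENNReal.continuous_pow 2 |>.comp
      (continuous_enorm.comp (continuous_finsetSum _ fun n _ => ?_))
    have h1 : Continuous fun x : ℝ × Torus L => d' x.1 n := (hd' n).comp (by fun_prop)
    have h2 : Continuous fun x : ℝ × Torus L => character L n x.2 :=
      (character L n).continuous.comp continuous_snd
    fun_prop
  have pt : ∀ z, ∀ t ∈ Set.Ioo 0 T, ‖windowEvol L T F (d t) t z‖ₑ ^ 2 ≤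
      4 * (‖windowEvol L T F (d 0) t z‖ₑ ^ 2 +
        τ * ∫⁻ s in Set.Ioo 0 T, ‖windowEvol L T F (d' s) t z‖ₑ ^ 2) := by
    intro z t ht
    have hcs : Continuous fun s => windowEvol L T F (d' s) t z :=
      jc.comp (f := fun s : ℝ => ((t, s), z)) (by fun_prop)
    -- The fundamental theorem of calculus acts only on the coefficients, with the fast time `t`
    -- frozen. For each fixed `s` the coefficients `d' s` are then constant in `t`, and
    -- orthogonality applies.
    have e : windowEvol L T F (d t) t z = windowEvol L T F (d 0) t z +
        ∫ s in (0 : ℝ)..t, windowEvol L T F (d' s) t z := by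
      have := intervalIntegral.integral_eq_sub_of_hasDerivAt (a := 0) (b := t)
        (f := fun s => windowEvol L T F (d s) t z) (f' := fun s => windowEvol L T F (d' s) t z)
        (fun s _ => HasDerivAt.fun_sum fun n _ => ((hd n s).mul_const _).mul_const _)
        (hcs.intervalIntegrable _ _)
      rw [this, add_sub_cancel]
    have b : ‖windowEvol L T F (d t) t z‖ₑ ≤ ‖windowEvol L T F (d 0) t z‖ₑ +
        ∫⁻ s in Set.Ioo 0 T, ‖windowEvol L T F (d' s) t z‖ₑ := by
      rw [e]
      refine (enorm_add_le _ _).trans (add_le_add le_rfl ?_)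
      rw [intervalIntegral.integral_of_le ht.1.le, integral_Ioc_eq_integral_Ioo]
      refine (enorm_integral_le_lintegral_enorm _).trans (lintegral_mono_set ?_)
      exact Ioo_subset_Ioo_right ht.2.le
    calc _ ≤ _ := by gcongr
      _ ≤ _ := add_sq_le_four_mul _ _
      _ ≤ _ := by
        gcongr
        refine (sq_lintegral_le _ hcs.enorm.measurable.aemeasurable).trans_eq ?_
        rw [hvol]
  have hz : ∀ z, ∫⁻ t in Set.Ioo 0 T, ‖windowEvol L T F (d t) t z‖ₑ ^ 2 ≤
      4 * τ * squareSum L (2 * Real.pi / T) F (d 0) z +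
        4 * τ ^ 2 * ∫⁻ s in Set.Ioo 0 T, squareSum L (2 * Real.pi / T) F (d' s) z := by
    intro z
    have jc' : Continuous fun x : ℝ × ℝ => ‖windowEvol L T F (d' x.2) x.1 z‖ₑ ^ 2 :=
      ENNReal.continuous_pow 2 |>.comp (continuous_enorm.comp
        (jc.comp (f := fun x : ℝ × ℝ => (x, z)) (by fun_prop)))
    have m0 : Measurable fun t => ‖windowEvol L T F (d 0) t z‖ₑ ^ 2 := by
      unfold windowEvol
      fun_prop
    calc _ ≤ ∫⁻ t in Set.Ioo 0 T, 4 * (‖windowEvol L T F (d 0) t z‖ₑ ^ 2 +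
          τ * ∫⁻ s in Set.Ioo 0 T, ‖windowEvol L T F (d' s) t z‖ₑ ^ 2) :=
          setLIntegral_mono' measurableSet_Ioo (pt z)
      _ = 4 * ((∫⁻ t in Set.Ioo 0 T, ‖windowEvol L T F (d 0) t z‖ₑ ^ 2) +
          τ * ∫⁻ t in Set.Ioo 0 T, ∫⁻ s in Set.Ioo 0 T, ‖windowEvol L T F (d' s) t z‖ₑ ^ 2) := by
          rw [lintegral_const_mul' _ _ (by simp), lintegral_add_left m0,
            lintegral_const_mul' _ _ (by simp)]
      _ = _ := by
          rw [lintegral_lintegral_swap jc'.measurable.aemeasurable]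
          simp only [lintegral_windowEvol hT]
          rw [lintegral_const_mul' _ _ (by simp)]
          change 4 * ((τ : ℝ≥0∞) * _ + τ * ((τ : ℝ≥0∞) * _)) = _
          ring
  have hz2 : ∀ z, (∫⁻ t in Set.Ioo 0 T, ‖windowEvol L T F (d t) t z‖ₑ ^ 2) ^ 2 ≤
      4 * ((4 * τ) ^ 2 * squareSum L (2 * Real.pi / T) F (d 0) z ^ 2 + (4 * τ ^ 2) ^ 2 * (τ *
        ∫⁻ s in Set.Ioo 0 T, squareSum L (2 * Real.pi / T) F (d' s) z ^ 2)) := by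
    intro z
    have scz : Measurable fun s => squareSum L (2 * Real.pi / T) F (d' s) z :=
      (sc.comp (f := fun s : ℝ => (s, z)) (by fun_prop)).measurable
    calc _ ≤ _ := by gcongr; exact hz z
      _ ≤ _ := add_sq_le_four_mul _ _
      _ ≤ _ := by
        rw [mul_pow, mul_pow (4 * (τ : ℝ≥0∞) ^ 2)]
        gcongr
        refine (sq_lintegral_le _ scz.aemeasurable).trans_eq ?_
        rw [hvol]
  have m0 : Measurable fun z => squareSum L (2 * Real.pi / T) F (d 0) z := by
    unfold squareSum
    fun_prop
  calc _ ≤ ∫⁻ z, 4 * ((4 * τ) ^ 2 * squareSum L (2 * Real.pi / T) F (d 0) z ^ 2 +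
        (4 * τ ^ 2) ^ 2 * (τ * ∫⁻ s in Set.Ioo 0 T,
          squareSum L (2 * Real.pi / T) F (d' s) z ^ 2)) := lintegral_mono hz2
    _ = 4 * ((4 * τ) ^ 2 * (∫⁻ z, squareSum L (2 * Real.pi / T) F (d 0) z ^ 2) +
        (4 * τ ^ 2) ^ 2 * (τ * ∫⁻ s in Set.Ioo 0 T, ∫⁻ z,
          squareSum L (2 * Real.pi / T) F (d' s) z ^ 2)) := by
      have fin1 : ((4 : ℝ≥0∞) * τ ^ 2) ^ 2 ≠ ∞ := by finiteness
      have fin2 : ((4 : ℝ≥0∞) * τ) ^ 2 ≠ ∞ := by finiteness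
      rw [lintegral_const_mul' _ _ (by simp), lintegral_add_left (by fun_prop),
        lintegral_const_mul' _ _ fin2, lintegral_const_mul' _ _ fin1,
        lintegral_const_mul' _ _ (by simp), lintegral_lintegral_swap]
      refine Measurable.aemeasurable ?_
      exact ((sc.comp (f := fun x : Torus L × ℝ => (x.2, x.1)) (by fun_prop)).measurable).pow_const 2
    _ ≤ 4 * ((4 * τ) ^ 2 * (C * D ^ 2) + (4 * τ ^ 2) ^ 2 * (τ * (τ * (C * D ^ 2)))) := by
      gcongr
      · exact (hC F (d 0)).trans (by gcongr)
      · calc ∫⁻ s in Set.Ioo 0 T, ∫⁻ z, squareSum L (2 * Real.pi / T) F (d' s) z ^ 2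
            ≤ ∫⁻ s in Set.Ioo 0 T, C * (D : ℝ≥0∞) ^ 2 :=
              setLIntegral_mono' measurableSet_Ioo fun s hs =>
                (hC F (d' s)).trans (by gcongr; exact hD s hs)
          _ = τ * (C * D ^ 2) := by rw [lintegral_const, hvol, mul_comm]
    _ = _ := by push_cast; ring

/-- **Zygmund's inequality** in the form of an `L⁴(𝕋²; L²(0, T))` estimate for trigonometric
polynomials in space which evolve freely up to slowly varying coefficients. -/
theorem exists_lintegral_sum_phase_le {T : ℝ} (hT : 0 < T) : ∃ C : ℝ≥0,
    ∀ (F : Finset (ℤ × ℤ)) (c c' : ℝ → ℤ × ℤ → ℂ) (D : ℝ≥0),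
      (∀ n t, HasDerivAt (fun t => c t n) (c' t n) t) → (∀ n, Continuous fun t => c' t n) →
      (∀ s ∈ Set.Ico 0 T, ∑ n ∈ F, ‖c s n‖ₑ ^ 2 ≤ D) →
      (∀ s ∈ Set.Ioo 0 T, ∑ n ∈ F, ‖c' s n‖ₑ ^ 2 ≤ D) →
      ∫⁻ z, (∫⁻ t in Set.Ioo 0 T,
        ‖∑ n ∈ F, phase L t n * c t n * character L n z‖ₑ ^ 2) ^ 2 ≤ C * D ^ 2 := by
  obtain ⟨C, hC⟩ := exists_lintegral_windowEvol_le (L := L) hT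
  set w := 2 * Real.pi / T with hw
  have hw0 : 0 < w := by positivity
  set ω := w.toNNReal
  have hK : (1 : ℝ≥0) ≤ 4 * (1 + ω ^ 2) := by
    have : (0 : ℝ≥0) ≤ ω ^ 2 := zero_le
    calc (1 : ℝ≥0) ≤ 4 * (1 + 0) := by norm_num
      _ ≤ _ := by gcongr
  refine ⟨C * (4 * (1 + ω ^ 2)) ^ 2, fun F c c' D hc hc' h0 hD => ?_⟩
  have cc : ∀ n, Continuous fun t => c t n := fun n =>
    continuous_iff_continuousAt.2 fun t => (hc n t).continuousAt
  -- The part of the phase left over after extracting the window harmonic. Its frequency lies in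
  -- `[0, w]`, so it can be moved into the coefficients at the price of a derivative bounded by `ω`.
  let e : ℝ → ℤ × ℤ → ℂ := fun t n => Complex.exp (-Complex.I * t * offset L w n)
  have he : ∀ t n, ‖e t n‖ₑ = 1 := by
    intro t n
    rw [← ofReal_norm]
    simp only [e]
    rw [show -Complex.I * t * offset L w n = ((-(t * offset L w n) : ℝ) : ℂ) * Complex.I by
      push_cast; ring, Complex.norm_exp_ofReal_mul_I, ENNReal.ofReal_one]
  have hde : ∀ n t, HasDerivAt (fun t => e t n) (-Complex.I * offset L w n * e t n) t := by
    intro n t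
    have h1 : HasDerivAt (fun t : ℝ => -Complex.I * (t : ℂ) * offset L w n)
        (-Complex.I * 1 * offset L w n) t :=
      ((Complex.ofRealCLM.hasDerivAt (x := t)).const_mul _).mul_const _
    have := h1.cexp
    convert this using 1
    simp only [e]; ring
  have hec : ∀ n, Continuous fun t => e t n := fun n => by simp only [e]; fun_prop
  have key := hC F (fun t n => c t n * e t n)
    (fun t n => c' t n * e t n + c t n * (-Complex.I * offset L w n * e t n))
    (4 * (1 + ω ^ 2) * D) (fun n t => (hc n t).mul (hde n t))
    (fun n => by have := hc' n; have := cc n; have := hec n; fun_prop) ?_ ?_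
  · refine Eq.trans_le ?_ (key.trans_eq ?_)
    · refine lintegral_congr fun z => ?_
      congr 1
      refine lintegral_congr fun t => ?_
      congr 2
      refine Finset.sum_congr rfl fun n _ => ?_
      congr 1
      have : phase L t n = e t n *
          Complex.exp (-Complex.I * t * ((2 * Real.pi / T : ℝ) * window L w n : ℝ)) := by
        simp only [phase, e]
        rw [← Complex.exp_add, offset, ← hw]
        congr 1
        push_cast; ring
      rw [this, ← hw]; ring
    · push_cast; ring
  · simp only [enorm_mul, he, mul_one]
    refine (h0 0 ⟨le_rfl, hT⟩).trans ?_
    rw [ENNReal.coe_le_coe]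
    calc D = 1 * D := (one_mul D).symm
      _ ≤ _ := by gcongr
  · intro s hs
    have ho : ∀ n, ‖(offset L w n : ℂ)‖ₑ ≤ ω := by
      intro n
      rw [← ofReal_norm, Complex.norm_real, Real.norm_of_nonneg (offset_nonneg hw0 n)]
      exact ENNReal.ofReal_le_ofReal (offset_le hw0 n)
    calc ∑ n ∈ F, ‖c' s n * e s n + c s n * (-Complex.I * offset L w n * e s n)‖ₑ ^ 2
        ≤ ∑ n ∈ F, 4 * (‖c' s n‖ₑ ^ 2 + ω ^ 2 * ‖c s n‖ₑ ^ 2) := by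
          refine Finset.sum_le_sum fun n _ => ?_
          calc _ ≤ (‖c' s n‖ₑ + ω * ‖c s n‖ₑ) ^ 2 := by
                gcongr
                refine (enorm_add_le _ _).trans ?_
                simp only [enorm_mul, he, mul_one, enorm_neg]
                have : ‖Complex.I‖ₑ = 1 := by rw [← ofReal_norm]; simp
                rw [this, one_mul, mul_comm]
                gcongr
                exact ho n
            _ ≤ _ := by
              refine (add_sq_le_four_mul _ _).trans_eq ?_
              rw [mul_pow]
      _ = 4 * (∑ n ∈ F, ‖c' s n‖ₑ ^ 2 + ω ^ 2 * ∑ n ∈ F, ‖c s n‖ₑ ^ 2) := by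
          rw [← Finset.mul_sum, Finset.sum_add_distrib, ← Finset.mul_sum]
      _ ≤ 4 * (D + ω ^ 2 * D) := by
          gcongr
          · exact hD s hs
          · exact h0 s ⟨hs.1.le, hs.2⟩
      _ = _ := by push_cast; ring

end Strichartz

/-! ### Integral expressions for the powers of the norms. -/

section Norms

theorem sq_eLpNorm_two {α E : Type*} [MeasurableSpace α] {μ : Measure α} [TopologicalSpace E]
    [ContinuousENorm E] (f : α → E) : eLpNorm f 2 μ ^ 2 = ∫⁻ x, ‖f x‖ₑ ^ 2 ∂μ := by
  have h := eLpNorm_nnreal_pow_eq_lintegral (f := f) (μ := μ) (p := 2) (by simp)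
  simp only [NNReal.coe_ofNat, ENNReal.rpow_ofNat, ENNReal.coe_ofNat] at h
  exact h

theorem pow_four_eLpNorm_four {α E : Type*} [MeasurableSpace α] {μ : Measure α}
    [TopologicalSpace E] [ContinuousENorm E] (f : α → E) :
    eLpNorm f 4 μ ^ 4 = ∫⁻ x, ‖f x‖ₑ ^ 4 ∂μ := by
  have h := eLpNorm_nnreal_pow_eq_lintegral (f := f) (μ := μ) (p := 4) (by simp)
  simp only [NNReal.coe_ofNat, ENNReal.rpow_ofNat, ENNReal.coe_ofNat] at h
  exact h

variable {L : ℝ} [hL : Fact (0 < L)]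

theorem sq_enorm_eq_lintegral (v : L2 L) : ‖v‖ₑ ^ 2 = ∫⁻ z, ‖v z‖ₑ ^ 2 := by
  rw [Lp.enorm_def, sq_eLpNorm_two]

/-- The fourth power of the norm of `L⁴(𝕋²; L²(0, T))`. -/
def mixedNormPow (L T : ℝ) [Fact (0 < L)] (f : ℝ × Torus L → ℂ) : ℝ≥0∞ :=
  ∫⁻ z : Torus L, (∫⁻ t in Set.Ioo 0 T, ‖f (t, z)‖ₑ ^ 2) ^ 2

theorem eLpNorm_eLpNorm_pow_four (T : ℝ) (f : ℝ × Torus L → ℂ) :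
    eLpNorm (fun z : Torus L => eLpNorm (fun t : ℝ => f (t, z)) 2
      (volume.restrict (Set.Ioo 0 T))) 4 volume ^ 4 = mixedNormPow L T f := by
  rw [pow_four_eLpNorm_four, mixedNormPow]
  refine lintegral_congr fun z => ?_
  rw [← sq_eLpNorm_two, enorm_eq_self, ← pow_mul]

theorem memLpL2_four_iff (T : ℝ) (f : ℝ × Torus L → ℂ) :
    MemLpL2 L T 4 f ↔ AEStronglyMeasurable f (spaceTime L T) ∧ mixedNormPow L T f < ∞ := by
  rw [MemLpL2, ← eLpNorm_eLpNorm_pow_four, ENNReal.pow_lt_top_iff]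
  simp

end Norms

/-! ### Jointly measurable representatives and passage to the limit. -/

section Truncation

variable {L : ℝ} [hL : Fact (0 < L)]

instance (T : ℝ) : IsFiniteMeasure (spaceTime L T) := by
  unfold spaceTime; infer_instance

theorem fourierCoef_eq (v : L2 L) (n : ℤ × ℤ) :
    fourierCoef L v n = ((√L : ℝ) : ℂ)⁻¹ * (charBasis L).repr v n := by
  rw [charBasis_repr, inv_mul_cancel_left₀ sqrt_complex_ne_zero]

theorem trunc_eq (F : Finset (ℤ × ℤ)) (v : L2 L) :
    trunc L F v = ∑ n ∈ F, fourierCoef L v n • charLp L n := by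
  rw [trunc]
  refine Finset.sum_congr rfl fun n _ => ?_
  rw [charBasis_apply, unitChar, smul_smul, fourierCoef_eq, mul_comm]

theorem coeFn_trunc (F : Finset (ℤ × ℤ)) (v : L2 L) :
    trunc L F v =ᵐ[volume] fun z => ∑ n ∈ F, fourierCoef L v n * character L n z := by
  rw [trunc_eq]
  refine (Lp.coeFn_finsetSum F _).trans ?_
  have h : ∀ n ∈ F, (fourierCoef L v n • charLp L n : L2 L) =ᵐ[volume]
      fun z => fourierCoef L v n * character L n z := fun n _ => by
    filter_upwards [Lp.coeFn_smul (fourierCoef L v n) (charLp L n), coeFn_charLp n] with z h1 h2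
    rw [h1, Pi.smul_apply, h2, smul_eq_mul]
  have h' : ∀ᵐ z, ∀ n ∈ F, (fourierCoef L v n • charLp L n : L2 L) z =
      fourierCoef L v n * character L n z := (Finset.eventually_all F).2 h
  filter_upwards [h'] with z hz
  rw [Finset.sum_apply]
  exact Finset.sum_congr rfl hz

theorem sum_enorm_sq_fourierCoef_le (F : Finset (ℤ × ℤ)) (v : L2 L) :
    ∑ n ∈ F, ‖fourierCoef L v n‖ₑ ^ 2 ≤ (L⁻¹).toNNReal * ‖v‖ₑ ^ 2 := by
  have h : ∑ n ∈ F, ‖fourierCoef L v n‖ ^ 2 ≤ L⁻¹ * ‖v‖ ^ 2 := by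
    have h1 := (charBasis L).orthonormal.sum_inner_products_le (s := F) v
    have h2 : ∀ n, ‖fourierCoef L v n‖ ^ 2 = L⁻¹ * ‖inner ℂ (charBasis L n) v‖ ^ 2 := by
      intro n
      rw [fourierCoef_eq, HilbertBasis.repr_apply_apply, norm_mul, mul_pow, norm_inv,
        Complex.norm_real, Real.norm_of_nonneg (Real.sqrt_nonneg _), inv_pow,
        Real.sq_sqrt hL.out.le]
    simp only [h2, ← Finset.mul_sum]
    exact mul_le_mul_of_nonneg_left h1 (inv_nonneg.2 hL.out.le)
  have conv : ∀ {E : Type} [NormedAddCommGroup E] (y : E), ‖y‖ₑ ^ 2 = ENNReal.ofReal (‖y‖ ^ 2) :=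
    fun y => by rw [ENNReal.ofReal_pow (norm_nonneg _), ofReal_norm]
  have h3 := ENNReal.ofReal_le_ofReal h
  rw [ENNReal.ofReal_mul (inv_nonneg.2 hL.out.le),
    ENNReal.ofReal_sum_of_nonneg fun _ _ => by positivity] at h3
  rw [← ofReal_norm (v : L2 L), ← ENNReal.ofReal_pow (norm_nonneg _)]
  simp only [conv]
  exact h3

theorem continuous_trunc (F : Finset (ℤ × ℤ)) : Continuous (trunc L F) := by
  unfold trunc
  simp only [HilbertBasis.repr_apply_apply]
  fun_prop

variable (L) in
/-- The truncation of a curve in `L²`, as a function of space and time. -/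
def truncFun (u : ℝ → L2 L) (F : Finset (ℤ × ℤ)) (p : ℝ × Torus L) : ℂ :=
  ∑ n ∈ F, fourierCoef L (u p.1) n * character L n p.2

theorem continuous_fourierCoef (n : ℤ × ℤ) : Continuous fun v : L2 L => fourierCoef L v n := by
  simp only [fourierCoef_eq, HilbertBasis.repr_apply_apply]
  fun_prop

theorem continuous_truncFun {u : ℝ → L2 L} (hu : Continuous u) (F : Finset (ℤ × ℤ)) :
    Continuous (truncFun L u F) := by
  unfold truncFun
  refine continuous_finsetSum _ fun n _ => ?_
  exact ((continuous_fourierCoef n).comp (hu.comp continuous_fst)).mul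
    ((character L n).continuous.comp continuous_snd)

theorem truncFun_ae (u : ℝ → L2 L) (F : Finset (ℤ × ℤ)) (t : ℝ) :
    trunc L F (u t) =ᵐ[volume] fun z => truncFun L u F (t, z) := coeFn_trunc F (u t)

/-- Pointwise convergence of Fourier truncations, dominated because the curve is bounded on the
compact `[0, T]`. -/
theorem tendsto_lintegral_sub_trunc {u : ℝ → L2 L} (hu : Continuous u) (T : ℝ) :
    Tendsto (fun N => ∫⁻ t in Set.Ioo 0 T, ‖u t - trunc L (freqs N) (u t)‖ₑ ^ 2) atTop (𝓝 0) := by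
  obtain ⟨B, hB⟩ := (isCompact_Icc (a := 0) (b := T)).exists_bound_of_continuousOn hu.continuousOn
  have h := tendsto_lintegral_of_dominated_convergence (μ := volume.restrict (Set.Ioo 0 T))
    (F := fun N t => ‖u t - trunc L (freqs N) (u t)‖ₑ ^ 2) (f := fun _ => 0)
    (fun _ => ENNReal.ofReal (2 * B) ^ 2)
    (fun N => ((hu.sub ((continuous_trunc _).comp hu)).enorm.measurable).pow_const 2) ?_ ?_ ?_
  · simpa using h
  · intro N
    filter_upwards [ae_restrict_mem measurableSet_Ioo] with t ht
    gcongr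
    rw [← ofReal_norm]
    refine ENNReal.ofReal_le_ofReal ((norm_sub_trunc_le _ _).trans ?_)
    have := hB t (Ioo_subset_Icc_self ht)
    linarith
  · rw [lintegral_const, Measure.restrict_apply_univ, Real.volume_Ioo]
    finiteness
  · refine Eventually.of_forall fun t => ?_
    have h1 : Tendsto (fun N => u t - trunc L (freqs N) (u t)) atTop (𝓝 (u t - u t)) :=
      tendsto_const_nhds.sub (tendsto_trunc (u t))
    have h2 : Tendsto (fun N => ‖u t - trunc L (freqs N) (u t)‖ₑ ^ 2) atTop
        (𝓝 (‖u t - u t‖ₑ ^ 2)) :=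
      ((ENNReal.continuous_pow 2).tendsto _).comp ((continuous_enorm.tendsto _).comp h1)
    simpa using h2

theorem lintegral_spaceTime {T : ℝ} {f : ℝ × Torus L → ℝ≥0∞}
    (hf : AEMeasurable f (spaceTime L T)) :
    ∫⁻ p, f p ∂spaceTime L T = ∫⁻ t in Set.Ioo 0 T, ∫⁻ z, f (t, z) :=
  lintegral_prod _ hf

/-- A continuous curve in `L²` is represented by a function of space and time. -/
theorem exists_representative {u : ℝ → L2 L} (hu : Continuous u) (T : ℝ) :
    ∃ (w : ℝ × Torus L → ℂ) (ns : ℕ → ℕ), AEStronglyMeasurable w (spaceTime L T) ∧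
      (∀ᵐ t ∂(volume.restrict (Set.Ioo 0 T)), (fun z => w (t, z)) =ᵐ[volume] u t) ∧
      ∀ᵐ p ∂(spaceTime L T),
        Tendsto (fun k => truncFun L u (freqs (ns k)) p) atTop (𝓝 (w p)) := by
  set f : ℕ → ℝ × Torus L → ℂ := fun N => truncFun L u (freqs N) with hf
  set X : ℕ → ℝ≥0∞ := fun N => ∫⁻ t in Set.Ioo 0 T, ‖u t - trunc L (freqs N) (u t)‖ₑ ^ 2 with hX
  have hX0 : Tendsto X atTop (𝓝 0) := tendsto_lintegral_sub_trunc hu T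
  have fc : ∀ N, Continuous (f N) := fun N => continuous_truncFun hu _
  have slice : ∀ N t, ∫⁻ z, ‖f N (t, z)‖ₑ ^ 2 = ‖trunc L (freqs N) (u t)‖ₑ ^ 2 := by
    intro N t
    rw [sq_enorm_eq_lintegral]
    refine lintegral_congr_ae ?_
    filter_upwards [truncFun_ae u (freqs N) t] with z hz
    rw [hz]
  have mem : ∀ N, MemLp (f N) 2 (spaceTime L T) := by
    intro N
    refine ⟨(fc N).aestronglyMeasurable, ?_⟩
    have h1 : eLpNorm (f N) 2 (spaceTime L T) ^ 2 < ∞ := by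
      rw [sq_eLpNorm_two, lintegral_spaceTime (by have := fc N; fun_prop)]
      simp only [slice]
      obtain ⟨B, hB⟩ := (isCompact_Icc (a := 0) (b := T)).exists_bound_of_continuousOn
        hu.continuousOn
      calc ∫⁻ t in Set.Ioo 0 T, ‖trunc L (freqs N) (u t)‖ₑ ^ 2
          ≤ ∫⁻ t in Set.Ioo 0 T, ENNReal.ofReal B ^ 2 := by
            refine setLIntegral_mono' measurableSet_Ioo fun t ht => ?_
            gcongr
            rw [← ofReal_norm]
            exact ENNReal.ofReal_le_ofReal
              ((norm_trunc_le _ _).trans (hB t (Ioo_subset_Icc_self ht)))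
        _ < ∞ := by
            rw [lintegral_const, Measure.restrict_apply_univ, Real.volume_Ioo]
            finiteness
    exact (ENNReal.pow_lt_top_iff.1 h1).resolve_right (by simp)
  have diff : ∀ N M, eLpNorm (f N - f M) 2 (spaceTime L T) ^ 2 ≤ 4 * (X N + X M) := by
    intro N M
    rw [sq_eLpNorm_two, lintegral_spaceTime (by have := fc N; have := fc M; fun_prop)]
    have h1 : ∀ t, ∫⁻ z, ‖(f N - f M) (t, z)‖ₑ ^ 2 ≤
        4 * (‖u t - trunc L (freqs N) (u t)‖ₑ ^ 2 + ‖u t - trunc L (freqs M) (u t)‖ₑ ^ 2) := by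
      intro t
      have : ∫⁻ z, ‖(f N - f M) (t, z)‖ₑ ^ 2 =
          ‖trunc L (freqs N) (u t) - trunc L (freqs M) (u t)‖ₑ ^ 2 := by
        rw [sq_enorm_eq_lintegral]
        refine lintegral_congr_ae ?_
        filter_upwards [truncFun_ae u (freqs N) t, truncFun_ae u (freqs M) t,
          Lp.coeFn_sub (trunc L (freqs N) (u t)) (trunc L (freqs M) (u t))] with z h1 h2 h3
        rw [h3, Pi.sub_apply, Pi.sub_apply, h1, h2]
      rw [this]
      refine le_trans ?_ (add_sq_le_four_mul _ _)
      gcongr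
      rw [← enorm_neg (u t - trunc L (freqs N) (u t))]
      refine le_trans (le_of_eq ?_) (enorm_add_le _ _)
      congr 1; abel
    refine (lintegral_mono h1).trans ?_
    rw [lintegral_const_mul' _ _ (by simp), lintegral_add_left]
    exact ((hu.sub ((continuous_trunc _).comp hu)).enorm.measurable).pow_const 2
  have cauchy : CauchySeq fun N => (mem N).toLp (f N) := by
    rw [EMetric.cauchySeq_iff]
    intro ε hε
    rcases eq_or_ne ε ∞ with rfl | hεt
    · exact ⟨0, fun m _ n _ => edist_lt_top _ _⟩
    -- With this threshold `4 * (X m + X n)` is at most `ε ^ 2 / 2`, which leaves room for the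
    -- strict inequality.
    have hδ : 0 < ε ^ 2 / 16 := by
      apply ENNReal.div_pos
      · positivity
      · simp
    obtain ⟨N0, hN0⟩ := eventually_atTop.1 ((tendsto_order.1 hX0).2 _ hδ)
    refine ⟨N0, fun m hm n hn => ?_⟩
    rw [Lp.edist_toLp_toLp]
    suffices h : 4 * (X m + X n) < ε ^ 2 from
      lt_of_not_ge fun hle => ((diff m n).trans_lt h).not_ge (pow_le_pow_left' hle 2)
    have h16 : ε ^ 2 = 4 * (ε ^ 2 / 16 + ε ^ 2 / 16) + 8 * (ε ^ 2 / 16) := by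
      rw [← two_mul, ← mul_assoc, ← add_mul]
      norm_num
      rw [ENNReal.mul_div_cancel (by simp) (by simp)]
    have hfin : ε ^ 2 / 16 ≠ ∞ := by finiteness
    calc 4 * (X m + X n) ≤ 4 * (ε ^ 2 / 16 + ε ^ 2 / 16) := by
          gcongr
          · exact (hN0 m hm).le
          · exact (hN0 n hn).le
      _ < 4 * (ε ^ 2 / 16 + ε ^ 2 / 16) + 8 * (ε ^ 2 / 16) := by
          refine ENNReal.lt_add_right (by finiteness) ?_
          exact (ENNReal.mul_pos (by simp) hδ.ne').ne'
      _ = ε ^ 2 := h16.symm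
  obtain ⟨W, hW⟩ := cauchySeq_tendsto_of_complete cauchy
  have hW' : Tendsto (fun N => eLpNorm (f N - (W : ℝ × Torus L → ℂ)) 2 (spaceTime L T)) atTop (𝓝 0) := by
    rw [Lp.tendsto_Lp_iff_tendsto_eLpNorm'] at hW
    refine hW.congr fun N => eLpNorm_congr_ae ?_
    filter_upwards [(mem N).coeFn_toLp] with p hp
    simp [hp]
  obtain ⟨ns, hns, hconv⟩ := (tendstoInMeasure_of_tendsto_eLpNorm (by simp)
    (fun N => (fc N).aestronglyMeasurable) (Lp.aestronglyMeasurable W) hW').exists_seq_tendsto_ae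
  refine ⟨W, ns, Lp.aestronglyMeasurable W, ?_, hconv⟩
  -- On almost every time slice the truncations converge in measure both to the slice of `W` and to
  -- `u t`; uniqueness of limits in measure identifies the two.
  filter_upwards [Measure.ae_ae_of_ae_prod hconv] with t ht
  have m1 : TendstoInMeasure volume (fun k z => f (ns k) (t, z)) atTop (fun z => W (t, z)) :=
    tendstoInMeasure_of_tendsto_ae (fun k => ((fc (ns k)).comp
      (f := fun z : Torus L => (t, z)) (by fun_prop)).aestronglyMeasurable) ht
  have m2 : TendstoInMeasure volume (fun k z => f (ns k) (t, z)) atTop (u t) := by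
    refine tendstoInMeasure_of_tendsto_eLpNorm (p := 2) (by simp) (fun k => ((fc (ns k)).comp
      (f := fun z : Torus L => (t, z)) (by fun_prop)).aestronglyMeasurable)
      (Lp.aestronglyMeasurable _) ?_
    have h1 := (Lp.tendsto_Lp_iff_tendsto_eLpNorm' _ _).1
      ((tendsto_trunc (u t)).comp hns.tendsto_atTop)
    refine h1.congr fun k => eLpNorm_congr_ae ?_
    filter_upwards [truncFun_ae u (freqs (ns k)) t] with z hz
    simp only [Pi.sub_apply, Function.comp_apply, hz]
    rfl
  exact tendstoInMeasure_ae_unique m1 m2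

/-- Fatou in `t`, then Fatou in `z`; squaring, being monotone and continuous, commutes with the
lower limit in between. This carries uniform bounds on truncations over to the representative. -/
theorem mixedNormPow_le_liminf {T : ℝ} {w : ℝ × Torus L → ℂ} {f : ℕ → ℝ × Torus L → ℂ}
    (hf : ∀ k, Continuous (f k))
    (h : ∀ᵐ p ∂(spaceTime L T), Tendsto (fun k => f k p) atTop (𝓝 (w p))) :
    mixedNormPow L T w ≤ liminf (fun k => mixedNormPow L T (f k)) atTop := by
  have hsw : ∀ᵐ z : Torus L, ∀ᵐ t ∂(volume.restrict (Set.Ioo 0 T)),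
      Tendsto (fun k => f k (t, z)) atTop (𝓝 (w (t, z))) := by
    have := (Measure.measurePreserving_swap (μ := (volume : Measure (Torus L)))
      (ν := volume.restrict (Set.Ioo 0 T))).quasiMeasurePreserving.ae h
    exact Measure.ae_ae_of_ae_prod this
  have hcz : ∀ k z, Continuous fun t => f k (t, z) := fun k z => (hf k).comp (by fun_prop)
  have meas : ∀ k, Measurable fun z => (∫⁻ t in Set.Ioo 0 T, ‖f k (t, z)‖ₑ ^ 2) ^ 2 := fun k => by
    refine Measurable.pow_const ?_ 2
    exact Measurable.lintegral_prod_left' ((hf k).enorm.measurable.pow_const 2)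
  refine le_trans ?_ (lintegral_liminf_le meas)
  refine lintegral_mono_ae ?_
  filter_upwards [hsw] with z hz
  have h1 : ∫⁻ t in Set.Ioo 0 T, ‖w (t, z)‖ₑ ^ 2 ≤
      liminf (fun k => ∫⁻ t in Set.Ioo 0 T, ‖f k (t, z)‖ₑ ^ 2) atTop := by
    refine le_trans (lintegral_mono_ae ?_)
      (lintegral_liminf_le fun k => (hcz k z).enorm.measurable.pow_const 2)
    filter_upwards [hz] with t ht
    have : Tendsto (fun k => ‖f k (t, z)‖ₑ ^ 2) atTop (𝓝 (‖w (t, z)‖ₑ ^ 2)) :=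
      ((ENNReal.continuous_pow 2).tendsto _).comp ((continuous_enorm.tendsto _).comp ht)
    rw [this.liminf_eq]
  have hmono : Monotone fun x : ℝ≥0∞ => x ^ 2 := fun a b h => by dsimp only; gcongr
  calc _ ≤ (liminf (fun k => ∫⁻ t in Set.Ioo 0 T, ‖f k (t, z)‖ₑ ^ 2) atTop) ^ 2 := by gcongr
    _ = _ := hmono.map_liminf_of_continuousAt _ (ENNReal.continuous_pow 2).continuousAt

/-- Curves of the form `e^{itΔ} q(t)` with `q` of class `C¹` have a representative in
`L⁴(𝕋²; L²(0, T))`. -/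
theorem exists_representative_evol {T : ℝ} (hT : 0 < T) : ∃ C : ℝ≥0, ∀ (q q' : ℝ → L2 L) (D : ℝ≥0),
    (∀ t, HasDerivAt q (q' t) t) → Continuous q' → (∀ s ∈ Set.Icc 0 T, ‖q s‖ₑ ≤ D) →
    (∀ s ∈ Set.Icc 0 T, ‖q' s‖ₑ ≤ D) →
    ∃ w : ℝ × Torus L → ℂ, AEStronglyMeasurable w (spaceTime L T) ∧
      (∀ᵐ t ∂(volume.restrict (Set.Ioo 0 T)), (fun z => w (t, z)) =ᵐ[volume] evol L t (q t)) ∧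
      mixedNormPow L T w ≤ C * D ^ 4 := by
  obtain ⟨C, hC⟩ := exists_lintegral_sum_phase_le (L := L) hT
  refine ⟨C * (L⁻¹).toNNReal ^ 2, fun q q' D hq hq' hD hD' => ?_⟩
  have hqc : Continuous q := continuous_iff_continuousAt.2 fun t => (hq t).continuousAt
  have hu : Continuous fun t => evol L t (q t) := continuous_evol_comp continuous_id hqc
  obtain ⟨w, ns, h1, h2, h3⟩ := exists_representative hu T
  refine ⟨w, h1, h2, (mixedNormPow_le_liminf (fun k => continuous_truncFun hu _) h3).trans ?_⟩
  refine (liminf_le_liminf (v := fun _ => C * ((L⁻¹).toNNReal * D ^ 2 : ℝ≥0∞) ^ 2)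
    (Eventually.of_forall fun k => ?_)).trans ?_
  · have hd : ∀ n t, HasDerivAt (fun t => fourierCoef L (q t) n) (fourierCoef L (q' t) n) t := by
      intro n t
      simp only [fourierCoef_eq, HilbertBasis.repr_apply_apply]
      exact (((innerSL ℂ (charBasis L n)).restrictScalars ℝ).hasFDerivAt.comp_hasDerivAt t
        (hq t)).const_mul _
    have := hC (freqs (ns k)) (fun t n => fourierCoef L (q t) n) (fun t n => fourierCoef L (q' t) n)
      ((L⁻¹).toNNReal * D ^ 2) hd (fun n => (continuous_fourierCoef n).comp hq')
      (fun s hs => (sum_enorm_sq_fourierCoef_le _ _).trans (by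
        push_cast; gcongr; exact hD s (Ico_subset_Icc_self hs)))
      (fun s hs => (sum_enorm_sq_fourierCoef_le _ _).trans (by
        push_cast; gcongr; exact hD' s (Ioo_subset_Icc_self hs)))
    refine le_trans (le_of_eq ?_) (this.trans_eq (by push_cast; rfl))
    refine lintegral_congr fun z => ?_
    congr 1
    refine lintegral_congr fun t => ?_
    congr 2
    refine Finset.sum_congr rfl fun n _ => ?_
    rw [fourierCoef_eq, repr_evol, fourierCoef_eq]; ring
  · rw [liminf_const]
    push_cast
    apply le_of_eq; ring

end Truncation

/-! ### Test functions, integration by parts and the weak Laplacian. -/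

section SmoothFunctions

variable {L : ℝ}

variable (L) in
/-- The covering map of the torus. -/
def cover (x : ℝ × ℝ) : Torus L := ((x.1 : AddCircle (1 : ℝ)), (x.2 : AddCircle L))

theorem isOpenQuotientMap_cover : IsOpenQuotientMap (cover L) :=
  (QuotientAddGroup.isOpenQuotientMap_mk (N := AddSubgroup.zmultiples (1 : ℝ))).prodMap
    (QuotientAddGroup.isOpenQuotientMap_mk (N := AddSubgroup.zmultiples L))

theorem cover_add (x y : ℝ × ℝ) : cover L (x + y) = cover L x + cover L y := by
  simp [cover]

/-- The derivative of `Φ` in the direction `v`. -/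
def dirDeriv (v : ℝ × ℝ) (Φ : ℝ × ℝ → ℂ) (x : ℝ × ℝ) : ℂ := fderiv ℝ Φ x v

theorem contDiff_dirDeriv {Φ : ℝ × ℝ → ℂ} (h : ContDiff ℝ ((⊤ : ℕ∞) : WithTop ℕ∞) Φ) (v : ℝ × ℝ) :
    ContDiff ℝ ((⊤ : ℕ∞) : WithTop ℕ∞) (dirDeriv v Φ) :=
  (h.fderiv_right (m := ((⊤ : ℕ∞) : WithTop ℕ∞)) (by norm_num)).clm_apply contDiff_const

theorem hasDerivAt_line {Φ : ℝ × ℝ → ℂ} (h : ContDiff ℝ ((⊤ : ℕ∞) : WithTop ℕ∞) Φ) (x v : ℝ × ℝ)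
    (s : ℝ) : HasDerivAt (fun s : ℝ => Φ (x + s • v)) (dirDeriv v Φ (x + s • v)) s := by
  have h1 : HasDerivAt (fun s : ℝ => x + s • v) v s := by
    simpa using ((hasDerivAt_id s).smul_const v).const_add x
  exact ((h.differentiable (by simp)).differentiableAt.hasFDerivAt).comp_hasDerivAt s h1

theorem iteratedDeriv_two_line {Φ : ℝ × ℝ → ℂ} (h : ContDiff ℝ ((⊤ : ℕ∞) : WithTop ℕ∞) Φ)
    (x v : ℝ × ℝ) :
    iteratedDeriv 2 (fun s : ℝ => Φ (x + s • v)) 0 = dirDeriv v (dirDeriv v Φ) x := by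
  rw [iteratedDeriv_succ, iteratedDeriv_one]
  have h1 : deriv (fun s : ℝ => Φ (x + s • v)) = fun s => dirDeriv v Φ (x + s • v) :=
    funext fun s => (hasDerivAt_line h x v s).deriv
  rw [h1, (hasDerivAt_line (contDiff_dirDeriv h v) x v 0).deriv]
  simp

/-- The second derivative of `φ` along the direction `v`. -/
def secondDeriv (φ : Torus L → ℂ) (v : ℝ × ℝ) (z : Torus L) : ℂ :=
  iteratedDeriv 2 (fun s : ℝ => φ (z + cover L (s • v))) 0

theorem laplacian_eq (φ : Torus L → ℂ) (z : Torus L) :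
    laplacian L φ z = secondDeriv φ (1, 0) z + secondDeriv φ (0, 1) z := by
  simp only [laplacian, secondDeriv, cover, Prod.smul_mk, smul_eq_mul, mul_one, mul_zero]
  congr 3
  · ext s
    congr 1
    ext <;> simp
  · ext s
    congr 1
    ext <;> simp

theorem IsSmooth.contDiff {φ : Torus L → ℂ} (h : IsSmooth L φ) :
    ContDiff ℝ ((⊤ : ℕ∞) : WithTop ℕ∞) (φ ∘ cover L) := h

theorem IsSmooth.continuous {φ : Torus L → ℂ} (h : IsSmooth L φ) : Continuous φ :=
  isOpenQuotientMap_cover.continuous_comp_iff.1 h.contDiff.continuous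

theorem secondDeriv_cover {φ : Torus L → ℂ} (h : IsSmooth L φ) (v x : ℝ × ℝ) :
    secondDeriv φ v (cover L x) = dirDeriv v (dirDeriv v (φ ∘ cover L)) x := by
  rw [← iteratedDeriv_two_line h.contDiff, secondDeriv]
  simp [cover_add]

theorem IsSmooth.continuous_secondDeriv {φ : Torus L → ℂ} (h : IsSmooth L φ) (v : ℝ × ℝ) :
    Continuous (secondDeriv φ v) := by
  refine isOpenQuotientMap_cover.continuous_comp_iff.1 ?_
  have : secondDeriv φ v ∘ cover L = dirDeriv v (dirDeriv v (φ ∘ cover L)) :=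
    funext fun x => secondDeriv_cover h v x
  rw [this]
  exact (contDiff_dirDeriv (contDiff_dirDeriv h.contDiff v) v).continuous

theorem IsSmooth.continuous_laplacian {φ : Torus L → ℂ} (h : IsSmooth L φ) :
    Continuous (laplacian L φ) := by
  rw [funext (laplacian_eq φ)]
  exact (h.continuous_secondDeriv _).add (h.continuous_secondDeriv _)

theorem hasDerivAt_fourier_coe (T : ℝ) (n : ℤ) (x : ℝ) :
    HasDerivAt (fun y : ℝ => fourier n (y : AddCircle T))
      (2 * Real.pi * Complex.I * n / T * fourier n (x : AddCircle T)) x :=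
  hasDerivAt_fourier T n x

/-- Integration by parts on the circle against a character. -/
theorem integral_fourier_mul_deriv_deriv {T : ℝ} [hT : Fact (0 < T)] (n : ℤ)
    {ψ χ : AddCircle T → ℂ} {p' : ℝ → ℂ} (h1 : ∀ x : ℝ, HasDerivAt (fun y : ℝ => ψ y) (p' x) x)
    (h2 : ∀ x : ℝ, HasDerivAt p' (χ x) x) (hχ : Continuous χ) :
    ∫ y, fourier n y * χ y = -(2 * Real.pi * n / T) ^ 2 * ∫ y, fourier n y * ψ y := by
  set k : ℂ := 2 * Real.pi * Complex.I * n / T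
  have hmk : Continuous fun x : ℝ => (x : AddCircle T) := AddCircle.continuous_mk' T
  have he : ∀ x : ℝ, HasDerivAt (fun y : ℝ => fourier n (y : AddCircle T))
    (k * fourier n (x : AddCircle T)) x := hasDerivAt_fourier_coe T n
  have hec : Continuous fun x : ℝ => fourier n (x : AddCircle T) := by fun_prop
  have hp'c : Continuous p' := continuous_iff_continuousAt.2 fun x => (h2 x).continuousAt
  -- The derivative lives on the line; it inherits periodicity from `ψ`, and this is what cancels
  -- the boundary terms.
  have hper : p' (0 + T) = p' 0 := by
    have e : (fun y : ℝ => ψ (y + T : ℝ)) = fun y : ℝ => ψ y := by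
      ext y; congr 1; exact AddCircle.coe_add_period T y
    have := (h1 (0 + T)).comp_add_const 0 T
    rw [e] at this
    exact this.unique (h1 0)
  have hT0 : ((0 + T : ℝ) : AddCircle T) = ((0 : ℝ) : AddCircle T) := AddCircle.coe_add_period T 0
  rw [← AddCircle.intervalIntegral_preimage T 0 (fun y => fourier n y * χ y),
    ← AddCircle.intervalIntegral_preimage T 0 (fun y => fourier n y * ψ y)]
  rw [intervalIntegral.integral_mul_deriv_eq_deriv_mul (fun x _ => he x) (fun x _ => h2 x)
    (Continuous.intervalIntegrable (by fun_prop) _ _)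
    ((hχ.comp hmk).intervalIntegrable _ _), hper, hT0, sub_self, zero_sub]
  simp only [mul_assoc]
  rw [intervalIntegral.integral_const_mul,
    intervalIntegral.integral_mul_deriv_eq_deriv_mul (fun x _ => he x) (fun x _ => h1 x)
    (Continuous.intervalIntegrable (by fun_prop) _ _) (hp'c.intervalIntegrable _ _), hT0, sub_self,
    zero_sub]
  simp only [mul_assoc]
  rw [intervalIntegral.integral_const_mul]
  have hk : k * k = -(2 * Real.pi * n / T) ^ 2 := by
    simp only [k]
    ring_nf
    rw [Complex.I_sq]; ring
  linear_combination (∫ x in (0 : ℝ)..(0 + T), fourier n (x : AddCircle T) * ψ x) * hk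

variable [hL : Fact (0 < L)]

theorem integral_character_mul_secondDeriv_fst {φ : Torus L → ℂ} (h : IsSmooth L φ) (n : ℤ × ℤ) :
    ∫ z, character L n z * secondDeriv φ (1, 0) z =
      -(2 * Real.pi * n.1) ^ 2 * ∫ z, character L n z * φ z := by
  have hφ := h.continuous
  have hs := h.continuous_secondDeriv (1, 0)
  have i1 : Integrable fun z : Torus L => character L n z * secondDeriv φ (1, 0) z :=
    integrable_of_continuous (by fun_prop)
  have i2 : Integrable fun z : Torus L => character L n z * φ z :=
    integrable_of_continuous (by fun_prop)
  rw [Measure.volume_eq_prod] at i1 i2 ⊢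
  rw [integral_prod_symm _ i1, integral_prod_symm _ i2, ← integral_const_mul]
  refine integral_congr_ae (Eventually.of_forall fun z2 => ?_)
  obtain ⟨y, rfl⟩ := QuotientAddGroup.mk_surjective z2
  have key := integral_fourier_mul_deriv_deriv (T := 1) n.1
    (ψ := fun z1 => φ (z1, (y : AddCircle L)))
    (χ := fun z1 => secondDeriv φ (1, 0) (z1, (y : AddCircle L)))
    (p' := fun x => dirDeriv (1, 0) (φ ∘ cover L) (x, y)) ?_ ?_ (by fun_prop)
  · simp only [character_apply, mul_assoc, mul_left_comm _ (fourier n.2 _)]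
    rw [integral_const_mul, integral_const_mul]
    refine (congrArg _ key).trans ?_
    simp only [Complex.ofReal_one, div_one]
    ring_nf
  · intro x
    have := hasDerivAt_line h.contDiff (0, y) (1, 0) x
    simpa [cover] using this
  · intro x
    have := hasDerivAt_line (contDiff_dirDeriv h.contDiff (1, 0)) (0, y) (1, 0) x
    have e := secondDeriv_cover h (1, 0) (x, y)
    simp only [cover] at e
    rw [e]
    simpa using this

theorem integral_character_mul_secondDeriv_snd {φ : Torus L → ℂ} (h : IsSmooth L φ) (n : ℤ × ℤ) :
    ∫ z, character L n z * secondDeriv φ (0, 1) z =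
      -(2 * Real.pi * n.2 / L) ^ 2 * ∫ z, character L n z * φ z := by
  have hφ := h.continuous
  have hs := h.continuous_secondDeriv (0, 1)
  have i1 : Integrable fun z : Torus L => character L n z * secondDeriv φ (0, 1) z :=
    integrable_of_continuous (by fun_prop)
  have i2 : Integrable fun z : Torus L => character L n z * φ z :=
    integrable_of_continuous (by fun_prop)
  rw [Measure.volume_eq_prod] at i1 i2 ⊢
  rw [integral_prod _ i1, integral_prod _ i2, ← integral_const_mul]
  refine integral_congr_ae (Eventually.of_forall fun z1 => ?_)
  obtain ⟨x, rfl⟩ := QuotientAddGroup.mk_surjective z1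
  have key := integral_fourier_mul_deriv_deriv (T := L) n.2
    (ψ := fun z2 => φ ((x : AddCircle (1 : ℝ)), z2))
    (χ := fun z2 => secondDeriv φ (0, 1) ((x : AddCircle (1 : ℝ)), z2))
    (p' := fun y => dirDeriv (0, 1) (φ ∘ cover L) (x, y)) ?_ ?_ (by fun_prop)
  · simp only [character_apply, mul_assoc]
    rw [integral_const_mul, integral_const_mul]
    refine (congrArg _ key).trans ?_
    ring_nf
  · intro y
    have := hasDerivAt_line h.contDiff (x, 0) (0, 1) y
    simpa [cover] using this
  · intro y
    have := hasDerivAt_line (contDiff_dirDeriv h.contDiff (0, 1)) (x, 0) (0, 1) y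
    have e := secondDeriv_cover h (0, 1) (x, y)
    simp only [cover] at e
    rw [e]
    simpa using this

theorem integral_character_mul_laplacian {φ : Torus L → ℂ} (h : IsSmooth L φ) (n : ℤ × ℤ) :
    ∫ z, character L n z * laplacian L φ z =
      -eigenvalue L n * ∫ z, character L n z * φ z := by
  simp only [laplacian_eq, mul_add]
  have hs1 := h.continuous_secondDeriv (1, 0)
  have hs2 := h.continuous_secondDeriv (0, 1)
  rw [integral_add (integrable_of_continuous (by fun_prop)) (integrable_of_continuous (by fun_prop)),
    integral_character_mul_secondDeriv_fst h, integral_character_mul_secondDeriv_snd h, eigenvalue]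
  push_cast
  ring

omit hL in
theorem isSmooth_character (n : ℤ × ℤ) : IsSmooth L (character L n) := by
  unfold IsSmooth
  simp only [character_apply, fourier_coe_apply]
  have h1 : ContDiff ℝ ((⊤ : ℕ∞) : WithTop ℕ∞) fun x : ℝ × ℝ => (x.1 : ℂ) :=
    Complex.ofRealCLM.contDiff.comp contDiff_fst
  have h2 : ContDiff ℝ ((⊤ : ℕ∞) : WithTop ℕ∞) fun x : ℝ × ℝ => (x.2 : ℂ) :=
    Complex.ofRealCLM.contDiff.comp contDiff_snd
  fun_prop

theorem laplacian_character (n : ℤ × ℤ) (z : Torus L) :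
    laplacian L (character L n) z = -eigenvalue L n * character L n z := by
  have key : ∀ (k c : ℂ), iteratedDeriv 2 (fun s : ℝ => c * Complex.exp (k * s)) 0 = k ^ 2 * c := by
    intro k c
    have hd : ∀ (c : ℂ) (s : ℝ), HasDerivAt (fun s : ℝ => c * Complex.exp (k * s))
        (c * k * Complex.exp (k * s)) s := by
      intro c s
      have h1 : HasDerivAt (fun s : ℝ => k * (s : ℂ)) (k * 1) s :=
        (Complex.ofRealCLM.hasDerivAt (x := s)).const_mul k
      exact (h1.cexp.const_mul c).congr_deriv (by ring)
    rw [iteratedDeriv_succ, iteratedDeriv_one, funext fun s => (hd c s).deriv, (hd _ 0).deriv,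
      Complex.ofReal_zero, mul_zero, Complex.exp_zero]
    ring
  have hL0 : (L : ℂ) ≠ 0 := by exact_mod_cast hL.out.ne'
  rw [laplacian]
  have e1 : (fun s : ℝ => character L n (z.1 + (s : AddCircle (1 : ℝ)), z.2)) = fun s : ℝ =>
      character L n z * Complex.exp ((2 * Real.pi * Complex.I * n.1) * s) := by
    ext s
    simp only [character_apply, fourier_apply, smul_add, AddCircle.toCircle_add]
    have := fourier_coe_apply (T := 1) (n := n.1) (x := s)
    rw [fourier_apply] at this
    simp only [Circle.coe_mul, this]
    simp; ring
  have e2 : (fun s : ℝ => character L n (z.1, z.2 + (s : AddCircle L))) = fun s : ℝ =>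
      character L n z * Complex.exp ((2 * Real.pi * Complex.I * n.2 / L) * s) := by
    ext s
    simp only [character_apply, fourier_apply, smul_add, AddCircle.toCircle_add]
    have := fourier_coe_apply (T := L) (n := n.2) (x := s)
    rw [fourier_apply] at this
    simp only [Circle.coe_mul, this]
    rw [show (2 * Real.pi * Complex.I * n.2 * s / L : ℂ) = 2 * Real.pi * Complex.I * n.2 / L * s by
      ring]
    ring
  rw [e1, e2, key, key, eigenvalue]
  push_cast
  ring_nf
  rw [Complex.I_sq]; ring

/-- Pairing with a continuous function, as a continuous linear functional on `L²`. -/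
theorem exists_pairing {φ : Torus L → ℂ} (hφ : Continuous φ) : ∃ ψ : L2 L,
    ∀ v : L2 L, inner ℂ ψ v = ∫ z, v z * φ z := by
  let f : C(Torus L, ℂ) := ⟨fun z => conj (φ z), by fun_prop⟩
  refine ⟨ContinuousMap.toLp 2 volume ℂ f, fun v => ?_⟩
  rw [L2.inner_def]
  refine integral_congr_ae ?_
  filter_upwards [ContinuousMap.coeFn_toLp (p := 2) (𝕜 := ℂ) (volume : Measure (Torus L)) f]
    with z hz
  rw [hz, RCLike.inner_apply]
  simp [f]

theorem integral_charBasis_mul (n : ℤ × ℤ) (φ : Torus L → ℂ) :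
    ∫ z, (charBasis L n) z * φ z = ((√L : ℝ) : ℂ)⁻¹ * ∫ z, character L n z * φ z := by
  rw [← integral_const_mul]
  refine integral_congr_ae ?_
  rw [charBasis_apply, unitChar]
  filter_upwards [Lp.coeFn_smul (((√L : ℝ) : ℂ)⁻¹) (charLp L n), coeFn_charLp n] with z h1 h2
  rw [h1, Pi.smul_apply, h2, smul_eq_mul, mul_assoc]

/-- If `X = -Δ Y` in the sense of Fourier coefficients, then this holds weakly. -/
theorem integral_add_integral_laplacian {X Y : L2 L}
    (h : ∀ n, (charBasis L).repr X n = eigenvalue L n * (charBasis L).repr Y n)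
    {φ : Torus L → ℂ} (hφ : IsSmooth L φ) :
    (∫ z, X z * φ z) + ∫ z, Y z * laplacian L φ z = 0 := by
  obtain ⟨ψ, hψ⟩ := exists_pairing hφ.continuous
  obtain ⟨χ, hχ⟩ := exists_pairing hφ.continuous_laplacian
  rw [← hψ, ← hχ]
  have s1 := (charBasis L).hasSum_inner_mul_inner ψ X
  have s2 := (charBasis L).hasSum_inner_mul_inner χ Y
  -- Both pairings are expanded by Parseval. The terms cancel one by one: the coefficient of `X`
  -- carries `λ`, while integrating by parts against the character brings out `-λ`.
  refine (s1.add s2).unique ?_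
  convert hasSum_zero using 1
  ext n
  rw [← HilbertBasis.repr_apply_apply, ← HilbertBasis.repr_apply_apply, h, hψ, hχ,
    integral_charBasis_mul, integral_charBasis_mul, integral_character_mul_laplacian hφ]
  ring

end SmoothFunctions

/-! ### Duhamel's formula solves the equation. -/

section Duhamel

variable {L : ℝ} [hL : Fact (0 < L)]

/-- The profile of the solution of the inhomogeneous equation. -/
def profile (L : ℝ) [Fact (0 < L)] (u₀ : L2 L) (g : ℝ → L2 L) (t : ℝ) : L2 L :=
  u₀ - Complex.I • ∫ s in (0 : ℝ)..t, evol L (-s) (g s)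

theorem profile_zero (u₀ : L2 L) (g : ℝ → L2 L) : profile L u₀ g 0 = u₀ := by
  simp [profile]

theorem continuous_evol_neg {g : ℝ → L2 L} (hg : Continuous g) :
    Continuous fun t => evol L (-t) (g t) :=
  continuous_evol_comp continuous_neg hg

theorem hasDerivAt_profile (u₀ : L2 L) {g : ℝ → L2 L} (hg : Continuous g) (t : ℝ) :
    HasDerivAt (profile L u₀ g) (-(Complex.I • evol L (-t) (g t))) t := by
  have h1 := (continuous_evol_neg hg).integral_hasStrictDerivAt 0 t
  exact (h1.hasDerivAt.const_smul Complex.I).const_sub u₀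

/-- Solution of `(i∂ₜ + Δ) u = g`, `u(0) = u₀` given by Duhamel's formula. -/
def duhamel (L : ℝ) [Fact (0 < L)] (u₀ : L2 L) (g : ℝ → L2 L) (t : ℝ) : L2 L :=
  evol L t (profile L u₀ g t)

theorem continuous_duhamel (u₀ : L2 L) {g : ℝ → L2 L} (hg : Continuous g) :
    Continuous (duhamel L u₀ g) :=
  continuous_evol_comp continuous_id
    (continuous_iff_continuousAt.2 fun t => (hasDerivAt_profile u₀ hg t).continuousAt)

theorem repr_intervalIntegral {f : ℝ → L2 L} (hf : Continuous f) (a b : ℝ) (n : ℤ × ℤ) :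
    (charBasis L).repr (∫ s in a..b, f s) n = ∫ s in a..b, (charBasis L).repr (f s) n := by
  simp only [HilbertBasis.repr_apply_apply]
  exact ((innerSL ℂ (charBasis L n)).intervalIntegral_comp_comm (hf.intervalIntegrable a b)).symm

/-- Each coefficient solves the scalar equation `i y' = λ y + g`, integrated here from `0` to `t`.
The grouping matches the hypothesis of `integral_add_integral_laplacian`. -/
theorem repr_duhamel (u₀ : L2 L) {g : ℝ → L2 L} (hg : Continuous g) (t : ℝ) (n : ℤ × ℤ) :
    Complex.I * ((charBasis L).repr (duhamel L u₀ g t) n - (charBasis L).repr u₀ n) -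
      ∫ s in (0 : ℝ)..t, (charBasis L).repr (g s) n =
    eigenvalue L n * ∫ s in (0 : ℝ)..t, (charBasis L).repr (duhamel L u₀ g s) n := by
  have hu := continuous_duhamel u₀ hg
  have cr : ∀ {f : ℝ → L2 L}, Continuous f → Continuous fun s => (charBasis L).repr (f s) n := by
    intro f hf
    simp only [HilbertBasis.repr_apply_apply]
    fun_prop
  have hd : ∀ s, HasDerivAt (fun s => (charBasis L).repr (duhamel L u₀ g s) n)
      (-Complex.I * eigenvalue L n * (charBasis L).repr (duhamel L u₀ g s) n -
        Complex.I * (charBasis L).repr (g s) n) s := by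
    intro s
    have h1 : HasDerivAt (fun s => (charBasis L).repr (profile L u₀ g s) n)
        ((charBasis L).repr (-(Complex.I • evol L (-s) (g s))) n) s := by
      simp only [HilbertBasis.repr_apply_apply]
      exact ((innerSL ℂ (charBasis L n)).restrictScalars ℝ).hasFDerivAt.comp_hasDerivAt s
        (hasDerivAt_profile u₀ hg s)
    have h2 := (hasDerivAt_phase (L := L) s n).mul h1
    simp only [duhamel, repr_evol]
    refine h2.congr_deriv ?_
    simp only [map_neg, map_smul, lp.coeFn_neg, lp.coeFn_smul, Pi.neg_apply, Pi.smul_apply,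
      smul_eq_mul, repr_evol]
    have : phase L s n * phase L (-s) n = 1 := by rw [← phase_add, add_neg_cancel, phase_zero]
    linear_combination -(Complex.I * (charBasis L).repr (g s) n) * this
  have ftc := intervalIntegral.integral_eq_sub_of_hasDerivAt (a := 0) (b := t) (fun s _ => hd s)
    (Continuous.intervalIntegrable (by have := cr hu; have := cr hg; fun_prop) _ _)
  rw [intervalIntegral.integral_sub
    (Continuous.intervalIntegrable (by have := cr hu; fun_prop) _ _)
    (Continuous.intervalIntegrable (by have := cr hg; fun_prop) _ _),
    intervalIntegral.integral_const_mul, intervalIntegral.integral_const_mul] at ftc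
  have h0 : duhamel L u₀ g 0 = u₀ := by rw [duhamel, profile_zero, evol_zero]
  rw [h0] at ftc
  rw [← ftc]
  linear_combination (-(eigenvalue L n : ℂ) *
    (∫ s in (0 : ℝ)..t, (charBasis L).repr (duhamel L u₀ g s) n) -
    ∫ s in (0 : ℝ)..t, (charBasis L).repr (g s) n) * Complex.I_mul_I

/-- Sources continuous in time suffice for the controls built below. Continuity makes the profile
`C¹`, so that `exists_representative_evol` places the solution in `L⁴(𝕋²; L²(0, T))`. -/
theorem isSolution_duhamel {T : ℝ} (hT : 0 < T) (u₀ : L2 L) {g : ℝ → L2 L} (hg : Continuous g)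
    {G : ℝ × Torus L → ℂ} (hG : ∀ᵐ t ∂(volume.restrict (Set.Ioo 0 T)),
      (fun z => G (t, z)) =ᵐ[volume] g t) :
    IsSolution L T G u₀ (duhamel L u₀ g) where
  continuousOn := (continuous_duhamel u₀ hg).continuousOn
  memLpL2 := by
    obtain ⟨C, hC⟩ := exists_representative_evol (L := L) hT
    have hq : Continuous (profile L u₀ g) :=
      continuous_iff_continuousAt.2 fun t => (hasDerivAt_profile u₀ hg t).continuousAt
    have hq' : Continuous fun t => -(Complex.I • evol L (-t) (g t)) :=
      ((continuous_evol_neg hg).const_smul Complex.I).neg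
    obtain ⟨B, hB⟩ := (isCompact_Icc (a := 0) (b := T)).exists_bound_of_continuousOn hq.continuousOn
    obtain ⟨B', hB'⟩ := (isCompact_Icc (a := 0) (b := T)).exists_bound_of_continuousOn
      hq'.continuousOn
    obtain ⟨w, h1, h2, h3⟩ := hC (profile L u₀ g) _ (max B B').toNNReal
      (hasDerivAt_profile u₀ hg) hq'
      (fun s hs => by
        rw [← ofReal_norm]
        exact ENNReal.ofReal_le_ofReal ((hB s hs).trans (le_max_left _ _)))
      (fun s hs => by
        rw [← ofReal_norm]
        exact ENNReal.ofReal_le_ofReal ((hB' s hs).trans (le_max_right _ _)))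
    exact ⟨w, (memLpL2_four_iff T w).2 ⟨h1, h3.trans_lt (by finiteness)⟩, h2⟩
  initial := by rw [duhamel, profile_zero, evol_zero]
  weak φ hφ t ht := by
    have hu := continuous_duhamel u₀ hg
    obtain ⟨ψ, hψ⟩ := exists_pairing hφ.continuous
    obtain ⟨χ, hχ⟩ := exists_pairing hφ.continuous_laplacian
    have hR : ∫ s in (0 : ℝ)..t, ∫ z, G (s, z) * φ z = ∫ s in (0 : ℝ)..t, inner ℂ ψ (g s) := by
      rw [intervalIntegral.integral_of_le ht.1, intervalIntegral.integral_of_le ht.1,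
        integral_Ioc_eq_integral_Ioo, integral_Ioc_eq_integral_Ioo]
      refine integral_congr_ae ?_
      filter_upwards [ae_mono (Measure.restrict_mono (Ioo_subset_Ioo_right ht.2) le_rfl) hG]
        with s hs
      rw [hψ]
      refine integral_congr_ae ?_
      filter_upwards [hs] with z hz
      rw [hz]
    rw [hR]
    simp only [← hψ, ← hχ]
    have c1 : ∫ s in (0 : ℝ)..t, inner ℂ ψ (g s) = inner ℂ ψ (∫ s in (0 : ℝ)..t, g s) :=
      (innerSL ℂ ψ).intervalIntegral_comp_comm (hg.intervalIntegrable 0 t)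
    have c2 : ∫ s in (0 : ℝ)..t, inner ℂ χ (duhamel L u₀ g s) =
        inner ℂ χ (∫ s in (0 : ℝ)..t, duhamel L u₀ g s) :=
      (innerSL ℂ χ).intervalIntegral_comp_comm (hu.intervalIntegrable 0 t)
    rw [c1, c2]
    have key := integral_add_integral_laplacian
      (X := Complex.I • (duhamel L u₀ g t - u₀) - ∫ s in (0 : ℝ)..t, g s)
      (Y := ∫ s in (0 : ℝ)..t, duhamel L u₀ g s) (fun n => ?_) hφ
    · rw [← hψ, ← hχ, inner_sub_right, inner_smul_right, inner_sub_right] at key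
      linear_combination key
    · rw [repr_intervalIntegral hu, ← repr_duhamel u₀ hg, map_sub, map_smul, map_sub,
        lp.coeFn_sub, lp.coeFn_smul, Pi.sub_apply, Pi.smul_apply, lp.coeFn_sub, Pi.sub_apply,
        repr_intervalIntegral hg, smul_eq_mul]

end Duhamel

/-! ### The scalar equation in integral form. -/

section MomentScalar

/-- Integration by parts of a smooth function against a primitive of an integrable function. -/
theorem integral_mul_eq_sub_integral_primitive {T : ℝ} (hT : 0 < T) {E E' h : ℝ → ℂ}
    (hE : ∀ t, HasDerivAt E (E' t) t) (hE' : Continuous E')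
    (hh : IntervalIntegrable h volume 0 T) :
    ∫ s in (0 : ℝ)..T, E s * h s =
      E T * (∫ s in (0 : ℝ)..T, h s) - ∫ r in (0 : ℝ)..T, E' r * ∫ s in (0 : ℝ)..r, h s := by
  have hEc : Continuous E := continuous_iff_continuousAt.2 fun t => (hE t).continuousAt
  set μ := volume.restrict (Set.Ioc 0 T)
  have hh' : Integrable h μ := (intervalIntegrable_iff_integrableOn_Ioc_of_le hT.le).1 hh
  have hE'i : Integrable E' μ := (hE'.integrableOn_Icc (a := 0) (b := T)).mono_set Ioc_subset_Icc_self
  have hm : MeasurableSet {p : ℝ × ℝ | p.1 < p.2} := measurableSet_lt measurable_fst measurable_snd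
  -- Since `h` is merely integrable, integration by parts is done by Fubini for `h(s) E'(r)` on the
  -- triangle `s < r`.
  have hF : Integrable (fun p : ℝ × ℝ => {p : ℝ × ℝ | p.1 < p.2}.indicator
      (fun p => h p.1 * E' p.2) p) (μ.prod μ) := (hh'.mul_prod hE'i).indicator hm
  have swap := integral_integral_swap (f := fun s r => {p : ℝ × ℝ | p.1 < p.2}.indicator
      (fun p => h p.1 * E' p.2) (s, r)) hF
  have left : ∀ s ∈ Set.Ioc 0 T, ∫ r, {p : ℝ × ℝ | p.1 < p.2}.indicator
      (fun p => h p.1 * E' p.2) (s, r) ∂μ = h s * (E T - E s) := by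
    intro s hs
    have e : (fun r => {p : ℝ × ℝ | p.1 < p.2}.indicator (fun p => h p.1 * E' p.2) (s, r)) =
        (Set.Ioi s).indicator fun r => h s * E' r := by
      ext r; simp [Set.indicator]
    rw [e, integral_indicator measurableSet_Ioi, Measure.restrict_restrict measurableSet_Ioi,
      integral_const_mul]
    have : Set.Ioi s ∩ Set.Ioc 0 T = Set.Ioc s T := by
      ext r
      simp only [mem_inter_iff, mem_Ioi, mem_Ioc]
      exact ⟨fun h => ⟨h.1, h.2.2⟩, fun h => ⟨h.1, hs.1.trans h.1, h.2⟩⟩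
    rw [this, ← intervalIntegral.integral_of_le hs.2,
      intervalIntegral.integral_eq_sub_of_hasDerivAt (fun x _ => hE x) (hE'.intervalIntegrable _ _)]
  have right : ∀ r ∈ Set.Ioc 0 T, ∫ s, {p : ℝ × ℝ | p.1 < p.2}.indicator
      (fun p => h p.1 * E' p.2) (s, r) ∂μ = E' r * ∫ s in (0 : ℝ)..r, h s := by
    intro r hr
    have e : (fun s => {p : ℝ × ℝ | p.1 < p.2}.indicator (fun p => h p.1 * E' p.2) (s, r)) =
        (Set.Iio r).indicator fun s => h s * E' r := by
      ext s; simp [Set.indicator]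
    rw [e, integral_indicator measurableSet_Iio, Measure.restrict_restrict measurableSet_Iio,
      integral_mul_const]
    have : Set.Iio r ∩ Set.Ioc 0 T = Set.Ioo 0 r := by
      ext s
      simp only [mem_inter_iff, mem_Iio, mem_Ioc, mem_Ioo]
      exact ⟨fun h => ⟨h.2.1, h.1⟩, fun h => ⟨h.2, h.1, h.2.le.trans hr.2⟩⟩
    rw [this, intervalIntegral.integral_of_le hr.1.le, integral_Ioc_eq_integral_Ioo, mul_comm]
  rw [setIntegral_congr_fun measurableSet_Ioc left, setIntegral_congr_fun measurableSet_Ioc right,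
    ← intervalIntegral.integral_of_le hT.le, ← intervalIntegral.integral_of_le hT.le] at swap
  rw [← swap, ← intervalIntegral.integral_const_mul, ← intervalIntegral.integral_sub]
  · exact intervalIntegral.integral_congr fun s _ => by ring
  · exact hh.const_mul _
  · exact hh.mul_continuousOn (continuous_const.sub hEc).continuousOn

/-- The solution formula for the equation `i y' - λ y = G` in integral form. -/
theorem initial_eq_of_integral_eq {T lam : ℝ} (hT : 0 < T) {y G : ℝ → ℂ}
    (hy : ContinuousOn y (Set.Icc 0 T)) (hG : IntervalIntegrable G volume 0 T)
    (h : ∀ t ∈ Set.Icc 0 T, Complex.I * (y t - y 0) - lam * ∫ s in (0 : ℝ)..t, y s =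
      ∫ s in (0 : ℝ)..t, G s) (hyT : y T = 0) :
    y 0 = Complex.I * ∫ s in (0 : ℝ)..T, Complex.exp (Complex.I * lam * s) * G s := by
  have hyi : ∀ t ∈ Set.Icc 0 T, IntervalIntegrable y volume 0 t := fun t ht =>
    (hy.mono (by rw [uIcc_of_le ht.1]; exact Icc_subset_Icc_right ht.2)).intervalIntegrable
  have hT' : T ∈ Set.Icc 0 T := ⟨hT.le, le_rfl⟩
  -- The integrating factor: after integration by parts the terms containing the integral of `E y`
  -- cancel.
  set E : ℝ → ℂ := fun s => Complex.exp (Complex.I * lam * s) with hEdef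
  have hE : ∀ t, HasDerivAt E (Complex.I * lam * E t) t := by
    intro t
    have h1 : HasDerivAt (fun s : ℝ => Complex.I * lam * (s : ℂ)) (Complex.I * lam * 1) t :=
      (Complex.ofRealCLM.hasDerivAt (x := t)).const_mul _
    exact h1.cexp.congr_deriv (by simp only [hEdef]; ring)
  have hEc : Continuous E := continuous_iff_continuousAt.2 fun t => (hE t).continuousAt
  have hprim : ∀ t ∈ Set.Icc 0 T, ∫ s in (0 : ℝ)..t, (lam * y s + G s) =
      Complex.I * (y t - y 0) := by
    intro t ht
    have hGt : IntervalIntegrable G volume 0 t := hG.mono_set (by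
      rw [uIcc_of_le ht.1, uIcc_of_le hT.le]; exact Icc_subset_Icc_right ht.2)
    rw [intervalIntegral.integral_add ((hyi t ht).const_mul _) hGt,
      intervalIntegral.integral_const_mul]
    linear_combination -h t ht
  have parts := integral_mul_eq_sub_integral_primitive hT hE (by fun_prop)
    (((hyi T hT').const_mul (lam : ℂ)).add hG)
  have i1 : IntervalIntegrable (fun s => E s * y s) volume 0 T :=
    (hyi T hT').continuousOn_mul hEc.continuousOn
  have i2 : IntervalIntegrable (fun s => E s * G s) volume 0 T :=
    hG.continuousOn_mul hEc.continuousOn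
  have e1 : ∫ s in (0 : ℝ)..T, E s * (lam * y s + G s) =
      lam * (∫ s in (0 : ℝ)..T, E s * y s) + ∫ s in (0 : ℝ)..T, E s * G s := by
    rw [← intervalIntegral.integral_const_mul, ← intervalIntegral.integral_add (i1.const_mul _) i2]
    exact intervalIntegral.integral_congr fun s _ => by ring
  have e2 : ∫ r in (0 : ℝ)..T, Complex.I * lam * E r * ∫ s in (0 : ℝ)..r, (lam * y s + G s) =
      -(Complex.I * y 0) * (E T - E 0) - lam * ∫ s in (0 : ℝ)..T, E s * y s := by
    have hEi : ∫ r in (0 : ℝ)..T, Complex.I * lam * E r = E T - E 0 :=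
      intervalIntegral.integral_eq_sub_of_hasDerivAt (fun x _ => hE x)
        (Continuous.intervalIntegrable (by fun_prop) _ _)
    have : ∫ r in (0 : ℝ)..T, Complex.I * lam * E r * ∫ s in (0 : ℝ)..r, (lam * y s + G s) =
        ∫ r in (0 : ℝ)..T, ((-(Complex.I * y 0)) * (Complex.I * lam * E r) -
          lam * (E r * y r)) := by
      refine intervalIntegral.integral_congr fun r hr => ?_
      rw [uIcc_of_le hT.le] at hr
      simp only [hprim r hr]
      linear_combination (lam * E r * y r) * Complex.I_mul_I
    rw [this, intervalIntegral.integral_sub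
      (Continuous.intervalIntegrable (by fun_prop) _ _) (i1.const_mul _),
      intervalIntegral.integral_const_mul, hEi, intervalIntegral.integral_const_mul]
  have hE0 : E 0 = 1 := by simp [hEdef]
  rw [e1, hprim T hT', e2, hyT, hE0] at parts
  linear_combination (-Complex.I) * parts + y 0 * Complex.I_mul_I

end MomentScalar

/-! ### Hölder's inequality for a weight in `L⁴`. -/

section Hoelder

variable {L : ℝ} [hL : Fact (0 < L)]

/-- Tonelli puts the time integral inside; Cauchy–Schwarz in `z` then separates `|a|²` from the time
integral of `|w|²`. -/
theorem sq_lintegral_lintegral_mul_le {T : ℝ} {a : Torus L → ℝ} (ha : AEStronglyMeasurable a)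
    {w : ℝ × Torus L → ℂ} (hw : AEStronglyMeasurable w (spaceTime L T)) :
    (∫⁻ t in Set.Ioo 0 T, ∫⁻ z, ‖(a z : ℂ) * w (t, z)‖ₑ ^ 2) ^ 2 ≤
      (∫⁻ z, ‖a z‖ₑ ^ 4) * mixedNormPow L T w := by
  have hw' : AEMeasurable (fun p : ℝ × Torus L => ‖w p‖ₑ ^ 2) (spaceTime L T) :=
    hw.enorm.pow_const 2
  have ha' : AEMeasurable (fun p : ℝ × Torus L => ‖a p.2‖ₑ ^ 2) (spaceTime L T) :=
    (ha.comp_quasiMeasurePreserving Measure.quasiMeasurePreserving_snd).enorm.pow_const 2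
  have e : ∫⁻ t in Set.Ioo 0 T, ∫⁻ z, ‖(a z : ℂ) * w (t, z)‖ₑ ^ 2 =
      ∫⁻ z, ‖a z‖ₑ ^ 2 * ∫⁻ t in Set.Ioo 0 T, ‖w (t, z)‖ₑ ^ 2 := by
    have h1 : ∀ p : ℝ × Torus L, ‖(a p.2 : ℂ) * w p‖ₑ ^ 2 = ‖a p.2‖ₑ ^ 2 * ‖w p‖ₑ ^ 2 := by
      intro p
      rw [enorm_mul, mul_pow, ← ofReal_norm (a p.2 : ℂ), Complex.norm_real, ofReal_norm]
    simp only [fun t z => h1 (t, z)]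
    rw [lintegral_lintegral_swap (ha'.mul hw')]
    refine lintegral_congr fun z => ?_
    exact lintegral_const_mul' _ _ (by finiteness)
  rw [e]
  have hh : AEMeasurable fun z : Torus L => ∫⁻ t in Set.Ioo 0 T, ‖w (t, z)‖ₑ ^ 2 :=
    hw'.lintegral_prod_left'
  refine (sq_lintegral_mul_le _ (ha.enorm.pow_const 2) hh).trans_eq ?_
  simp only [← pow_mul]
  rfl

end Hoelder

/-! ### Controllability implies observability. -/

section Observability

variable {L : ℝ} [hL : Fact (0 < L)]

theorem memLp_snd {T : ℝ} {a : Torus L → ℝ} {p : ℝ≥0∞} (ha : MemLp a p) :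
    MemLp (fun x : ℝ × Torus L => (a x.2 : ℂ)) p (spaceTime L T) :=
  (ha.ofReal (K := ℂ)).comp_snd _

/-- The moment condition satisfied by a control which drives `u₀` to rest. -/
theorem DrivesToRest.inner_charLp {T : ℝ} (hT : 0 < T) {a : Torus L → ℝ} (ha : MemLp a 2)
    {f : ℝ × Torus L → ℂ} (hf : MemLp f 2 (spaceTime L T)) {u₀ : L2 L}
    (h : DrivesToRest L T a f u₀) (n : ℤ × ℤ) :
    inner ℂ (charLp L n) u₀ = Complex.I * ∫ p, conj (phase L p.1 n * character L n p.2) *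
      (a p.2 * f p) ∂spaceTime L T := by
  obtain ⟨u, hu, huT⟩ := h
  set g : ℝ × Torus L → ℂ := fun p => a p.2 * f p with hg
  have hgi : Integrable g (spaceTime L T) := (memLp_snd ha).integrable_mul hf
  have hgc : Integrable (fun p : ℝ × Torus L => g p * character L (-n) p.2) (spaceTime L T) := by
    refine (hgi.mul_bdd (c := 1) ?_ ?_)
    · exact ((character L (-n)).continuous.comp continuous_snd).aestronglyMeasurable
    · exact Eventually.of_forall fun p => (norm_character_apply _ _).le
  have hGi : Integrable (fun s => ∫ z, g (s, z) * character L (-n) z)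
      (volume.restrict (Set.Ioo 0 T)) := hgc.integral_prod_left
  obtain ⟨ψ, hψ⟩ := exists_pairing (character L (-n)).continuous
  -- The test function is the character of frequency `-n`, because the weak form pairs without
  -- conjugation; the eigenvalue is even in `n`.
  have key := initial_eq_of_integral_eq (lam := eigenvalue L n) hT
    (y := fun t => ∫ z, u t z * character L (-n) z)
    (G := fun s => ∫ z, g (s, z) * character L (-n) z) ?_ ?_ ?_ ?_
  · simp only [hu.initial] at key
    rw [TorusControl.inner_charLp]
    simp only [character_neg, mul_comm _ (conj _)] at key ⊢
    rw [key]
    congr 1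
    have hprod : Integrable (fun p : ℝ × Torus L => conj (character L n p.2) *
        conj (phase L p.1 n) * g p) (spaceTime L T) := by
      simp only [character_neg, mul_comm _ (conj _)] at hgc
      have := hgc.bdd_mul (f := fun p : ℝ × Torus L => conj (phase L p.1 n)) (c := 1) ?_ ?_
      · refine this.congr (Eventually.of_forall fun p => ?_)
        dsimp only; ring
      · have := continuous_phase (L := L) n
        exact Continuous.aestronglyMeasurable (by fun_prop)
      · exact Eventually.of_forall fun p => by simp [norm_phase]
    simp only [map_mul, mul_comm (conj (phase _ _ _))]
    rw [intervalIntegral.integral_of_le hT.le, integral_Ioc_eq_integral_Ioo]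
    refine Eq.trans ?_ (integral_prod _ hprod).symm
    refine integral_congr_ae (Eventually.of_forall fun s => ?_)
    dsimp only
    rw [← integral_const_mul]
    refine integral_congr_ae (Eventually.of_forall fun z => ?_)
    have : conj (phase L s n) = Complex.exp (Complex.I * eigenvalue L n * s) := by
      rw [phase, ← Complex.exp_conj]
      congr 1
      simp only [map_mul, map_neg, Complex.conj_I, Complex.conj_ofReal]
      ring
    dsimp only
    rw [this]; ring
  · simp only [← hψ]
    exact (innerSL ℂ ψ).continuous.comp_continuousOn hu.continuousOn
  · rw [intervalIntegrable_iff_integrableOn_Ioc_of_le hT.le,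
      integrableOn_Ioc_iff_integrableOn_Ioo]
    exact hGi
  · intro t ht
    have hw := hu.weak _ (isSmooth_character (-n)) t ht
    simp only [laplacian_character] at hw
    rw [← hw]
    have : eigenvalue L (-n) = eigenvalue L n := by
      simp only [eigenvalue, Prod.fst_neg, Prod.snd_neg, Int.cast_neg]; ring
    have e : ∀ s, ∫ z, u s z * (-(eigenvalue L (-n) : ℂ) * character L (-n) z) =
        -(eigenvalue L n : ℂ) * ∫ z, u s z * character L (-n) z := by
      intro s
      rw [← integral_const_mul, this]
      refine integral_congr_ae (Eventually.of_forall fun z => ?_)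
      dsimp only; ring
    simp only [e]
    rw [intervalIntegral.integral_const_mul, hu.initial]
    ring
  · simp only [huT]
    rw [← integral_zero (Torus L) ℂ]
    refine integral_congr_ae ?_
    filter_upwards [Lp.coeFn_zero ℂ 2 (volume : Measure (Torus L))] with z hz
    rw [hz]; simp

/-- Evolved trigonometric polynomials are bounded, so a weight in `L²` is enough and Zygmund's
inequality is not needed. -/
theorem memLp_mul_truncFun {T : ℝ} {a : Torus L → ℝ} (ha : MemLp a 2) (F : Finset (ℤ × ℤ))
    (v : L2 L) : MemLp (fun p : ℝ × Torus L => (a p.2 : ℂ) *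
      truncFun L (fun t => evol L t v) F p) 2 (spaceTime L T) := by
  have hc := continuous_truncFun (continuous_evol v) F
  have hb : ∀ p, ‖truncFun L (fun t => evol L t v) F p‖ ≤ ∑ n ∈ F, ‖fourierCoef L v n‖ := by
    intro p
    refine (norm_sum_le _ _).trans (Finset.sum_le_sum fun n _ => le_of_eq ?_)
    rw [norm_mul, norm_character_apply, mul_one, fourierCoef_eq, repr_evol, fourierCoef_eq]
    simp [norm_phase]
  simp only [mul_comm ((a _ : ℝ) : ℂ)]
  refine (memLp_snd ha).of_le_mul (c := ∑ n ∈ F, ‖fourierCoef L v n‖) ?_ ?_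
  · exact hc.aestronglyMeasurable.mul (memLp_snd ha).aestronglyMeasurable
  · refine Eventually.of_forall fun p => ?_
    rw [norm_mul]
    exact mul_le_mul_of_nonneg_right (hb p) (norm_nonneg _)

/-- The moment conditions combine linearly into a pairing of `a e^{itΔ} P_F v` with the control;
Cauchy–Schwarz finishes. -/
theorem DrivesToRest.enorm_inner_trunc_le {T : ℝ} (hT : 0 < T) {a : Torus L → ℝ} (ha : MemLp a 2)
    {f : ℝ × Torus L → ℂ} (hf : MemLp f 2 (spaceTime L T)) {u₀ : L2 L}
    (h : DrivesToRest L T a f u₀) (F : Finset (ℤ × ℤ)) (v : L2 L) :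
    ‖inner ℂ (trunc L F v) u₀‖ₑ ≤ eLpNorm (fun p : ℝ × Torus L => (a p.2 : ℂ) *
      truncFun L (fun t => evol L t v) F p) 2 (spaceTime L T) * eLpNorm f 2 (spaceTime L T) := by
  have hgi : Integrable (fun p => (a p.2 : ℂ) * f p) (spaceTime L T) :=
    (memLp_snd ha).integrable_mul hf
  have hm := memLp_mul_truncFun (T := T) ha F v
  have hint : ∀ n, Integrable (fun p : ℝ × Torus L => conj (phase L p.1 n * character L n p.2) *
      (a p.2 * f p)) (spaceTime L T) := by
    intro n
    refine hgi.bdd_mul (c := 1) ?_ ?_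
    · have := continuous_phase (L := L) n
      exact Continuous.aestronglyMeasurable (by fun_prop)
    · exact Eventually.of_forall fun p => by
        simp [norm_phase, norm_character_apply]
  have e : inner ℂ (trunc L F v) u₀ = Complex.I * ∫ p, conj ((a p.2 : ℂ) *
      truncFun L (fun t => evol L t v) F p) * f p ∂spaceTime L T := by
    rw [trunc_eq, sum_inner]
    simp only [inner_smul_left, h.inner_charLp hT ha hf]
    have : ∀ p : ℝ × Torus L, conj ((a p.2 : ℂ) * truncFun L (fun t => evol L t v) F p) * f p =
        ∑ n ∈ F, conj (fourierCoef L v n) * (conj (phase L p.1 n * character L n p.2) *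
          (a p.2 * f p)) := by
      intro p
      simp only [truncFun, map_mul, map_sum, Complex.conj_ofReal, Finset.mul_sum, Finset.sum_mul]
      refine Finset.sum_congr rfl fun n _ => ?_
      rw [fourierCoef_eq, repr_evol, fourierCoef_eq]
      simp only [map_mul]
      ring
    simp only [this]
    rw [integral_finsetSum _ fun n _ => (hint n).const_mul _, Finset.mul_sum]
    refine Finset.sum_congr rfl fun n _ => ?_
    rw [integral_const_mul]; ring
  rw [e, enorm_mul]
  have hI : ‖Complex.I‖ₑ = 1 := by rw [← ofReal_norm]; simp
  rw [hI, one_mul]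
  have hsq : (∫⁻ p, ‖conj ((a p.2 : ℂ) * truncFun L (fun t => evol L t v) F p)‖ₑ * ‖f p‖ₑ
      ∂spaceTime L T) ^ 2 ≤ (eLpNorm (fun p : ℝ × Torus L => (a p.2 : ℂ) *
      truncFun L (fun t => evol L t v) F p) 2 (spaceTime L T) *
        eLpNorm f 2 (spaceTime L T)) ^ 2 := by
    rw [mul_pow, sq_eLpNorm_two, sq_eLpNorm_two]
    simp only [RCLike.enorm_conj]
    exact sq_lintegral_mul_le _ hm.aestronglyMeasurable.enorm hf.aestronglyMeasurable.enorm
  refine ((enorm_integral_le_lintegral_enorm _).trans_eq ?_).trans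
    ((ENNReal.pow_right_strictMono two_ne_zero).le_iff_le.1 hsq)
  simp only [enorm_mul]

/-- Controllability implies observability of trigonometric polynomials. -/
theorem exists_norm_trunc_le {T : ℝ} (hT : 0 < T) {a : Torus L → ℝ} (ha : MemLp a 2)
    (h : ∀ u₀ : L2 L, ∃ f : ℝ × Torus L → ℂ, MemLp f 2 (spaceTime L T) ∧ DrivesToRest L T a f u₀) :
    ∃ K : ℝ, 0 ≤ K ∧ ∀ (F : Finset (ℤ × ℤ)) (v : L2 L), ‖trunc L F v‖ ≤
      K * (eLpNorm (fun p : ℝ × Torus L => (a p.2 : ℂ) *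
        truncFun L (fun t => evol L t v) F p) 2 (spaceTime L T)).toReal := by
  let Nr : Finset (ℤ × ℤ) → L2 L → ℝ≥0∞ := fun F v => eLpNorm (fun p : ℝ × Torus L => (a p.2 : ℂ) *
        truncFun L (fun t => evol L t v) F p) 2 (spaceTime L T)
  have hfin : ∀ F v, Nr F v ≠ ∞ := fun F v => (memLp_mul_truncFun ha F v).2.ne
  -- Banach–Steinhaus is applied to all truncations of observed norm at most one. At each `u₀`, the
  -- norm of any control for `u₀` is a pointwise bound.
  let ι := {i : Finset (ℤ × ℤ) × L2 L // Nr i.1 i.2 ≤ 1}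
  have bs := banach_steinhaus (g := fun i : ι => innerSL ℂ (trunc L i.1.1 i.1.2)) (by
    intro u₀
    obtain ⟨f, hf, hd⟩ := h u₀
    refine ⟨(eLpNorm f 2 (spaceTime L T)).toReal, fun i => ?_⟩
    have h1 := (hd.enorm_inner_trunc_le hT ha hf i.1.1 i.1.2).trans
      (mul_le_of_le_one_left zero_le i.2)
    rw [innerSL_apply_apply, ← toReal_enorm]
    exact ENNReal.toReal_mono hf.2.ne h1)
  obtain ⟨K, hK⟩ := bs
  have hK0 : 0 ≤ max K 0 := le_max_right _ _
  refine ⟨max K 0, hK0, fun F v => le_of_forall_pos_le_add fun ε hε => ?_⟩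
  change ‖trunc L F v‖ ≤ max K 0 * (Nr F v).toReal + ε
  set K' := max K 0
  -- The extra term keeps the normalising factor positive even if the observed norm vanishes; it
  -- costs at most `ε` in the end.
  set r : ℝ := (Nr F v).toReal + ε / (K' + 1) with hr
  have hr0 : 0 < r := by positivity
  have hsmul : ∀ c : ℂ, Nr F (c • v) = ‖c‖ₑ * Nr F v := by
    intro c
    simp only [Nr]
    rw [← eLpNorm_const_smul]
    congr 1
    ext p
    simp only [truncFun, map_smul, Pi.smul_apply, smul_eq_mul, fourierCoef_eq, lp.coeFn_smul,
      Finset.mul_sum]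
    exact Finset.sum_congr rfl fun n _ => by ring
  have htr : ∀ c : ℂ, trunc L F (c • v) = c • trunc L F v := by
    intro c
    simp only [trunc, map_smul, lp.coeFn_smul, Pi.smul_apply, Finset.smul_sum, smul_smul,
      smul_eq_mul]
  have hmem : Nr F (((r⁻¹ : ℝ) : ℂ) • v) ≤ 1 := by
    rw [hsmul, ← ofReal_norm, Complex.norm_real, Real.norm_of_nonneg (inv_nonneg.2 hr0.le),
      ← ENNReal.ofReal_toReal (hfin F v), ← ENNReal.ofReal_mul (inv_nonneg.2 hr0.le)]
    refine ENNReal.ofReal_le_one.2 ?_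
    rw [inv_mul_le_iff₀ hr0, mul_one, hr]
    linarith [show 0 ≤ ε / (K' + 1) by positivity]
  have h2 := hK ⟨(F, ((r⁻¹ : ℝ) : ℂ) • v), hmem⟩
  rw [innerSL_apply_norm, htr, norm_smul, Complex.norm_real,
    Real.norm_of_nonneg (inv_nonneg.2 hr0.le), inv_mul_le_iff₀ hr0] at h2
  calc ‖trunc L F v‖ ≤ r * K := h2
    _ ≤ r * K' := mul_le_mul_of_nonneg_left (le_max_left _ _) hr0.le
    _ = K' * (Nr F v).toReal + ε * (K' / (K' + 1)) := by rw [hr]; field_simp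
    _ ≤ K' * (Nr F v).toReal + ε * 1 := by
      gcongr
      rw [div_le_one (by positivity)]; linarith
    _ = _ := by rw [mul_one]

/-- `a e^{itΔ}` is bounded from `L²` to `L²((0, T) × 𝕋²)` for `a ∈ L⁴`. -/
theorem exists_lintegral_mul_evol_le {T : ℝ} (hT : 0 < T) {a : Torus L → ℝ} (ha : MemLp a 4) :
    ∃ C : ℝ≥0, ∀ v : L2 L, ∃ w : ℝ × Torus L → ℂ, AEStronglyMeasurable w (spaceTime L T) ∧
      (∀ᵐ t ∂(volume.restrict (Set.Ioo 0 T)), (fun z => w (t, z)) =ᵐ[volume] evol L t v) ∧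
      mixedNormPow L T w < ∞ ∧
      ∫⁻ t in Set.Ioo 0 T, ∫⁻ z, ‖(a z : ℂ) * w (t, z)‖ₑ ^ 2 ≤ C * ‖v‖ₑ ^ 2 := by
  obtain ⟨C, hC⟩ := exists_representative_evol (L := L) hT
  have hA : ∫⁻ z, ‖a z‖ₑ ^ 4 ≠ ∞ := by
    rw [← pow_four_eLpNorm_four]
    exact ENNReal.pow_ne_top ha.2.ne
  set A := (∫⁻ z, ‖a z‖ₑ ^ 4).toNNReal with hAdef
  have hA' : ∫⁻ z, ‖a z‖ₑ ^ 4 = A := (ENNReal.coe_toNNReal hA).symm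
  -- The estimate is obtained squared, with constant `A * C`; `A * C ≤ (A * C + 1) ^ 2` avoids a
  -- square root.
  refine ⟨A * C + 1, fun v => ?_⟩
  obtain ⟨w, h1, h2, h3⟩ := hC (fun _ => v) (fun _ => 0) ‖v‖₊ (fun t => hasDerivAt_const t v)
    continuous_const (fun _ _ => le_rfl) (fun _ _ => by simp)
  refine ⟨w, h1, h2, h3.trans_lt (by finiteness), ?_⟩
  refine (ENNReal.pow_right_strictMono two_ne_zero).le_iff_le.1 ?_
  refine (sq_lintegral_lintegral_mul_le ha.1 h1).trans ?_
  rw [hA']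
  calc (A : ℝ≥0∞) * mixedNormPow L T w ≤ A * (C * ‖v‖ₑ ^ 4) := by gcongr; exact h3
    _ = ((A * C : ℝ≥0) : ℝ≥0∞) * ‖v‖ₑ ^ 4 := by push_cast; ring
    _ ≤ (((A * C + 1) ^ 2 : ℝ≥0) : ℝ≥0∞) * ‖v‖ₑ ^ 4 := by
      gcongr
      have : (0 : ℝ≥0) ≤ A * C := zero_le
      nlinarith [sq_nonneg (A * C)]
    _ = _ := by push_cast; ring

/-- Exact controllability implies observability. -/
theorem exists_observability {T : ℝ} (hT : 0 < T) {a : Torus L → ℝ} (ha : MemLp a 4)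
    (h : ∀ u₀ : L2 L, ∃ f : ℝ × Torus L → ℂ, MemLp f 2 (spaceTime L T) ∧ DrivesToRest L T a f u₀) :
    ∃ C : ℝ≥0, 0 < C ∧ ∀ v₀ : L2 L, ‖v₀‖ₑ ^ 2 ≤ C * ∫⁻ t in Set.Ioo 0 T, ∫⁻ z,
      ‖(a z : ℂ) * freeEvolution L t v₀ z‖ₑ ^ 2 := by
  have ha2 : MemLp a 2 := ha.mono_exponent (by norm_num)
  obtain ⟨K, hK0, hK⟩ := exists_norm_trunc_le hT ha2 h
  obtain ⟨C, hC⟩ := exists_lintegral_mul_evol_le hT ha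
  set κ := K.toNNReal
  refine ⟨κ ^ 2 * 4 + 1, by positivity, fun v => ?_⟩
  set R := ∫⁻ t in Set.Ioo 0 T, ∫⁻ z, ‖(a z : ℂ) * freeEvolution L t v z‖ₑ ^ 2 with hR
  -- The observation of the truncation is that of `v` minus that of the remainder, which is small
  -- because `a e^{itΔ}` is bounded on `L²`.
  have step : ∀ N, ‖trunc L (freqs N) v‖ₑ ^ 2 ≤
      κ ^ 2 * (4 * (C * ‖v - trunc L (freqs N) v‖ₑ ^ 2 + R)) := by
    intro N
    obtain ⟨w, w1, w2, -, w3⟩ := hC (v - trunc L (freqs N) v)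
    have hm := memLp_mul_truncFun (T := T) ha2 (freqs N) v
    have h1 : ‖trunc L (freqs N) v‖ₑ ^ 2 ≤ κ ^ 2 * ∫⁻ t in Set.Ioo 0 T, ∫⁻ z,
        ‖(a z : ℂ) * truncFun L (fun t => evol L t v) (freqs N) (t, z)‖ₑ ^ 2 := by
      rw [← lintegral_spaceTime (f := fun p => ‖(a p.2 : ℂ) *
        truncFun L (fun t => evol L t v) (freqs N) p‖ₑ ^ 2)
        (hm.aestronglyMeasurable.enorm.pow_const 2), ← sq_eLpNorm_two, ← mul_pow]
      gcongr
      have := ENNReal.ofReal_le_ofReal (hK (freqs N) v)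
      rwa [ofReal_norm, ENNReal.ofReal_mul hK0, ENNReal.ofReal_toReal hm.2.ne] at this
    refine h1.trans ?_
    gcongr
    -- `freeEvolution` picks a representative for each `t` separately. Only the summand with `w` is
    -- shown measurable in time, which is all that additivity of the lower integral requires.
    have meas : AEMeasurable (fun t => ∫⁻ z, ‖(a z : ℂ) * w (t, z)‖ₑ ^ 2)
        (volume.restrict (Set.Ioo 0 T)) := by
      have : AEMeasurable (fun p : ℝ × Torus L => ‖(a p.2 : ℂ) * w p‖ₑ ^ 2) (spaceTime L T) :=
        ((memLp_snd ha).aestronglyMeasurable.mul w1).enorm.pow_const 2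
      exact this.lintegral_prod_right'
    calc _ ≤ ∫⁻ t in Set.Ioo 0 T, 4 * ((∫⁻ z, ‖(a z : ℂ) * w (t, z)‖ₑ ^ 2) +
          ∫⁻ z, ‖(a z : ℂ) * freeEvolution L t v z‖ₑ ^ 2) := by
          refine lintegral_mono_ae ?_
          filter_upwards [w2, ((memLp_snd ha).aestronglyMeasurable.mul w1).prodMk_left]
            with t ht hmt
          have hmt' : AEMeasurable (fun z => ‖(a z : ℂ) * w (t, z)‖ₑ ^ 2) volume :=
            hmt.enorm.pow_const 2
          rw [← lintegral_add_left' hmt', ← lintegral_const_mul' _ _ (by simp)]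
          refine lintegral_mono_ae ?_
          have e : evol L t (v - trunc L (freqs N) v) =
              evol L t v - trunc L (freqs N) (evol L t v) := by rw [map_sub, evol_trunc]
          filter_upwards [ht, truncFun_ae (fun t => evol L t v) (freqs N) t,
            Lp.coeFn_sub (evol L t v) (trunc L (freqs N) (evol L t v))] with z hz1 hz2 hz3
          rw [e, hz3, Pi.sub_apply, hz2] at hz1
          refine le_trans ?_ (add_sq_le_four_mul _ _)
          gcongr
          rw [← enorm_neg ((a z : ℂ) * w (t, z))]
          refine le_trans (le_of_eq ?_) (enorm_add_le _ _)
          rw [hz1, ← evol_apply]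
          congr 1; ring
      _ = 4 * ((∫⁻ t in Set.Ioo 0 T, ∫⁻ z, ‖(a z : ℂ) * w (t, z)‖ₑ ^ 2) + R) := by
          rw [lintegral_const_mul' _ _ (by simp), lintegral_add_left' meas]
      _ ≤ _ := by gcongr
  have l1 : Tendsto (fun N => ‖trunc L (freqs N) v‖ₑ ^ 2) atTop (𝓝 (‖v‖ₑ ^ 2)) :=
    ((ENNReal.continuous_pow 2).tendsto _).comp ((continuous_enorm.tendsto _).comp (tendsto_trunc v))
  have l2 : Tendsto (fun N => ‖v - trunc L (freqs N) v‖ₑ ^ 2) atTop (𝓝 0) := by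
    have h1 : Tendsto (fun N => v - trunc L (freqs N) v) atTop (𝓝 (v - v)) :=
      tendsto_const_nhds.sub (tendsto_trunc v)
    have h2 : Tendsto (fun N => ‖v - trunc L (freqs N) v‖ₑ ^ 2) atTop (𝓝 (‖v - v‖ₑ ^ 2)) :=
      ((ENNReal.continuous_pow 2).tendsto _).comp ((continuous_enorm.tendsto _).comp h1)
    simpa using h2
  have l3 : Tendsto (fun N => (κ : ℝ≥0∞) ^ 2 * (4 * (C * ‖v - trunc L (freqs N) v‖ₑ ^ 2 + R))) atTop
      (𝓝 (κ ^ 2 * (4 * (C * 0 + R)))) :=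
    ENNReal.Tendsto.const_mul (ENNReal.Tendsto.const_mul
      ((ENNReal.Tendsto.const_mul l2 (Or.inr (by simp))).add tendsto_const_nhds)
      (Or.inr (by simp))) (Or.inr (by finiteness))
  refine (le_of_tendsto_of_tendsto' l1 l3 step).trans ?_
  rw [mul_zero, zero_add, ← mul_assoc]
  gcongr
  push_cast
  exact le_self_add

end Observability

/-! ### Observability implies controllability: the Gramian and the choice of control. -/

section Localisation

variable {L : ℝ} [hL : Fact (0 < L)]

/-- Multiplication by the indicator function of `E` on `L²`. -/
def cutoff {E : Set (Torus L)} (hE : MeasurableSet E) : L2 L →L[ℂ] L2 L :=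
  LinearMap.mkContinuous
    { toFun := fun v => ((Lp.memLp v).indicator hE).toLp (E.indicator v)
      map_add' := fun v w => by
        rw [← MemLp.toLp_add]
        refine MemLp.toLp_congr _ _ ?_
        filter_upwards [Lp.coeFn_add v w] with z hz
        by_cases h : z ∈ E
        · rw [Pi.add_apply, indicator_of_mem h, indicator_of_mem h, indicator_of_mem h, hz,
            Pi.add_apply]
        · rw [Pi.add_apply, indicator_of_notMem h, indicator_of_notMem h, indicator_of_notMem h,
            add_zero]
      map_smul' := fun c v => by
        rw [RingHom.id_apply, ← MemLp.toLp_const_smul]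
        refine MemLp.toLp_congr _ _ ?_
        filter_upwards [Lp.coeFn_smul c v] with z hz
        by_cases h : z ∈ E
        · rw [Pi.smul_apply, indicator_of_mem h, indicator_of_mem h, hz, Pi.smul_apply]
        · rw [Pi.smul_apply, indicator_of_notMem h, indicator_of_notMem h, smul_zero] } 1 fun v => by
      rw [one_mul]
      refine Lp.norm_le_norm_of_ae_le ?_
      filter_upwards [((Lp.memLp v).indicator hE).coeFn_toLp] with z hz
      change ‖((Lp.memLp v).indicator hE).toLp (E.indicator v) z‖ ≤ _
      rw [hz]
      exact norm_indicator_le_norm_self _ _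

theorem coeFn_cutoff {E : Set (Torus L)} (hE : MeasurableSet E) (v : L2 L) :
    cutoff hE v =ᵐ[volume] E.indicator v :=
  ((Lp.memLp v).indicator hE).coeFn_toLp

theorem inner_cutoff {E : Set (Torus L)} (hE : MeasurableSet E) (v : L2 L) :
    inner ℂ v (cutoff hE v) = ((‖cutoff hE v‖ ^ 2 : ℝ) : ℂ) := by
  have h := inner_self_eq_norm_sq_to_K (𝕜 := ℂ) (cutoff hE v)
  refine Eq.trans ?_ (h.trans (by push_cast; rfl))
  rw [L2.inner_def, L2.inner_def]
  refine integral_congr_ae ?_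
  filter_upwards [coeFn_cutoff hE v] with z hz
  rw [hz]
  by_cases h : z ∈ E <;> simp [h]

theorem norm_cutoff_le {E : Set (Torus L)} (hE : MeasurableSet E) (v : L2 L) :
    ‖cutoff hE v‖ ≤ ‖v‖ := by
  refine Lp.norm_le_norm_of_ae_le ?_
  filter_upwards [coeFn_cutoff hE v] with z hz
  rw [hz]
  exact norm_indicator_le_norm_self _ _

theorem continuous_cutoff_evol {E : Set (Torus L)} (hE : MeasurableSet E) (v : L2 L) :
    Continuous fun t => cutoff hE (evol L t v) :=
  (cutoff hE).continuous.comp (continuous_evol v)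

/-- The controllability Gramian `∫₀ᵀ e^{-isΔ} 1_E e^{isΔ} ds`. -/
def gramian {E : Set (Torus L)} (hE : MeasurableSet E) {T : ℝ} (hT : 0 < T) :
    L2 L →L[ℂ] L2 L :=
  LinearMap.mkContinuous
    { toFun := fun v => ∫ s in (0 : ℝ)..T, evol L (-s) (cutoff hE (evol L s v))
      map_add' := fun v w => by
        rw [← intervalIntegral.integral_add
          ((continuous_evol_neg (continuous_cutoff_evol hE v)).intervalIntegrable _ _)
          ((continuous_evol_neg (continuous_cutoff_evol hE w)).intervalIntegrable _ _)]
        simp only [map_add]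
      map_smul' := fun c v => by
        rw [RingHom.id_apply, ← intervalIntegral.integral_smul]
        simp only [map_smul] } T fun v => by
      have := intervalIntegral.norm_integral_le_of_norm_le_const (a := 0) (b := T) (C := ‖v‖)
        (f := fun s => evol L (-s) (cutoff hE (evol L s v))) (fun s _ => by
          rw [LinearIsometryEquiv.norm_map]
          exact (norm_cutoff_le hE _).trans_eq (LinearIsometryEquiv.norm_map _ _))
      rwa [sub_zero, abs_of_pos hT, mul_comm] at this

theorem gramian_apply {E : Set (Torus L)} (hE : MeasurableSet E) {T : ℝ} (hT : 0 < T) (v : L2 L) :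
    gramian hE hT v = ∫ s in (0 : ℝ)..T, evol L (-s) (cutoff hE (evol L s v)) := rfl

/-- The group is unitary and the cutoff an orthogonal projection, so the quadratic form of the
Gramian is exactly the observed energy; observability is its coercivity. -/
theorem inner_gramian {E : Set (Torus L)} (hE : MeasurableSet E) {T : ℝ} (hT : 0 < T) (v : L2 L) :
    inner ℂ v (gramian hE hT v) =
      ((∫ s in (0 : ℝ)..T, ‖cutoff hE (evol L s v)‖ ^ 2 : ℝ) : ℂ) := by
  have h : inner ℂ v (gramian hE hT v) =
      ∫ s in (0 : ℝ)..T, inner ℂ v (evol L (-s) (cutoff hE (evol L s v))) :=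
    ((innerSL ℂ v).intervalIntegral_comp_comm
      ((continuous_evol_neg (continuous_cutoff_evol hE v)).intervalIntegrable _ _)).symm
  rw [h, ← intervalIntegral.integral_ofReal]
  refine intervalIntegral.integral_congr fun s _ => ?_
  rw [← inner_evol_left, inner_cutoff]

/-- Observability from `E` makes the Gramian surjective. -/
theorem gramian_surjective {E : Set (Torus L)} (hE : MeasurableSet E) {T : ℝ} (hT : 0 < T)
    {C : ℝ≥0} (h : ∀ v : L2 L, ‖v‖ₑ ^ 2 ≤ C * ∫⁻ t in Set.Ioo 0 T, ∫⁻ z,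
      ‖((E.indicator (fun _ => (1 : ℝ)) z : ℝ) : ℂ) * freeEvolution L t v z‖ₑ ^ 2) :
    Function.Surjective (gramian hE hT) := by
  have hreal : ∀ v : L2 L, ‖v‖ ^ 2 ≤ C * ∫ s in (0 : ℝ)..T, ‖cutoff hE (evol L s v)‖ ^ 2 := by
    intro v
    have e : ∀ t, ∫⁻ z, ‖((E.indicator (fun _ => (1 : ℝ)) z : ℝ) : ℂ) *
        freeEvolution L t v z‖ₑ ^ 2 = ENNReal.ofReal (‖cutoff hE (evol L t v)‖ ^ 2) := by
      intro t
      rw [ENNReal.ofReal_pow (norm_nonneg _), ofReal_norm, sq_enorm_eq_lintegral]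
      refine lintegral_congr_ae ?_
      filter_upwards [coeFn_cutoff hE (evol L t v)] with z hz
      rw [hz, evol_apply]
      by_cases h : z ∈ E <;> simp [h]
    have hv := h v
    simp only [e] at hv
    have hc : Continuous fun t => ‖cutoff hE (evol L t v)‖ ^ 2 := by
      have := continuous_cutoff_evol hE v
      fun_prop
    rw [← ofReal_integral_eq_lintegral_ofReal
      ((hc.integrableOn_Icc (a := 0) (b := T)).mono_set Ioo_subset_Icc_self)
      (Eventually.of_forall fun _ => by positivity), ← integral_Ioc_eq_integral_Ioo,
      ← intervalIntegral.integral_of_le hT.le, ← ofReal_norm, ← ENNReal.ofReal_pow (norm_nonneg _),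
      ← ENNReal.ofReal_coe_nnreal, ← ENNReal.ofReal_mul C.coe_nonneg] at hv
    refine (ENNReal.ofReal_le_ofReal_iff ?_).1 hv
    exact mul_nonneg C.coe_nonneg
      (intervalIntegral.integral_nonneg hT.le fun _ _ => by positivity)
  have hI : ∀ v : L2 L, ‖v‖ ^ 2 ≤ C * ‖inner ℂ v (gramian hE hT v)‖ := by
    intro v
    refine (hreal v).trans ?_
    rw [inner_gramian, Complex.norm_real]
    gcongr
    exact Real.le_norm_self _
  have bound : ∀ v : L2 L, ‖v‖ ≤ C * ‖gramian hE hT v‖ := by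
    intro v
    rcases (norm_nonneg v).eq_or_lt with h0 | h0
    · rw [← h0]; positivity
    · refine le_of_mul_le_mul_left ?_ h0
      calc ‖v‖ * ‖v‖ = ‖v‖ ^ 2 := (sq _).symm
        _ ≤ C * (‖v‖ * ‖gramian hE hT v‖) := (hI v).trans (by gcongr; exact norm_inner_le_norm _ _)
        _ = _ := by ring
  have hanti : AntilipschitzWith C (gramian hE hT) :=
    AddMonoidHomClass.antilipschitz_of_bound _ bound
  have hclosed : IsClosed (Set.range (gramian hE hT)) :=
    hanti.isClosed_range (gramian hE hT).uniformContinuous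
  have hclosed' : IsClosed ((LinearMap.range (gramian hE hT).toLinearMap : Submodule ℂ (L2 L)) :
    Set (L2 L)) := hclosed
  have : CompleteSpace (LinearMap.range (gramian hE hT).toLinearMap) :=
    hclosed'.completeSpace_coe
  -- The range is closed by the lower bound. A vector orthogonal to it is orthogonal to its own
  -- image, hence zero by coercivity.
  have htop : LinearMap.range (gramian hE hT).toLinearMap = ⊤ := by
    rw [← Submodule.orthogonal_eq_bot_iff, Submodule.eq_bot_iff]
    intro w hw
    have h0 : inner ℂ (gramian hE hT w) w = 0 := hw _ ⟨w, rfl⟩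
    have h1 := hI w
    rw [← inner_conj_symm, h0] at h1
    simpa using h1
  exact LinearMap.range_eq_top.1 htop

theorem exists_pos_measure_lt_abs {α : Type*} [MeasurableSpace α] {μ : Measure α} {a : α → ℝ}
    (h : ¬ a =ᵐ[μ] 0) : ∃ ε : ℝ, 0 < ε ∧ μ {z | ε < |a z|} ≠ 0 := by
  by_contra! hc
  apply h
  have : ∀ᵐ z ∂μ, ∀ k : ℕ, |a z| ≤ 1 / ((k : ℝ) + 1) := by
    rw [ae_all_iff]
    intro k
    have := hc (1 / ((k : ℝ) + 1)) (by positivity)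
    rw [ae_iff]
    simpa only [not_le] using this
  filter_upwards [this] with z hz
  have h0 : |a z| ≤ 0 := ge_of_tendsto' tendsto_one_div_add_atTop_nhds_zero_nat hz
  simpa using h0

/-- Observability for all weights implies exact controllability with the weight `a`. -/
theorem exists_control {T : ℝ} (hT : 0 < T)
    (h : ∀ b : Torus L → ℝ, MemLp b 4 volume → 0 < eLpNorm b 4 volume →
      ∃ C : ℝ≥0, 0 < C ∧ ∀ v : L2 L, ‖v‖ₑ ^ 2 ≤ C * ∫⁻ t in Set.Ioo 0 T, ∫⁻ z,
        ‖(b z : ℂ) * freeEvolution L t v z‖ₑ ^ 2)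
    {a : Torus L → ℝ} (ha : AEStronglyMeasurable a) (ha0 : ¬ a =ᵐ[volume] 0) (u₀ : L2 L) :
    ∃ f : ℝ × Torus L → ℂ, MemLpL2 L T 4 f ∧ DrivesToRest L T a f u₀ := by
  set a' := ha.mk a with ha'
  have haa' : a =ᵐ[volume] a' := ha.ae_eq_mk
  have hm : StronglyMeasurable a' := ha.stronglyMeasurable_mk
  obtain ⟨ε, hε, hpos⟩ := exists_pos_measure_lt_abs (fun h0 => ha0 (haa'.trans h0))
  set E := {z | ε < |a' z|} with hEdef
  have hE : MeasurableSet E := measurableSet_lt measurable_const hm.measurable.abs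
  set b : Torus L → ℝ := E.indicator fun _ => 1 with hb
  have hb4 : MemLp b 4 volume := memLp_indicator_const 4 hE 1 (Or.inr (measure_ne_top _ _))
  obtain ⟨C, -, hC⟩ := h b hb4 (by
    rw [hb, eLpNorm_indicator_const hE (by simp) (by simp)]
    simp only [enorm_one, one_mul]
    exact ENNReal.rpow_pos (pos_iff_ne_zero.2 hpos) (measure_ne_top _ _))
  -- With source `1_E e^{itΔ} v` the final profile is `u₀ - i` times the Gramian of `v`, which
  -- vanishes for this right-hand side.
  obtain ⟨v, hv⟩ := gramian_surjective hE hT hC (-(Complex.I • u₀))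
  obtain ⟨C', hw⟩ := exists_lintegral_mul_evol_le (L := L) hT hb4
  obtain ⟨w, w1, w2, w3, -⟩ := hw v
  -- Dividing by the weight on `E`, where `|a'| > ε`: the factor is bounded, so the control inherits
  -- the mixed norm of `w`, and `a c = 1_E` almost everywhere.
  set c : Torus L → ℝ := E.indicator fun z => (a' z)⁻¹ with hc
  have hcm : Measurable c := hm.measurable.inv.indicator hE
  have hcb : ∀ z, ‖(c z : ℂ)‖ₑ ≤ ENNReal.ofReal ε⁻¹ := by
    intro z
    rw [← ofReal_norm, Complex.norm_real]
    refine ENNReal.ofReal_le_ofReal ?_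
    by_cases hz : z ∈ E
    · have : ε < |a' z| := hz
      rw [hc, indicator_of_mem hz, norm_inv, Real.norm_eq_abs]
      exact inv_anti₀ hε this.le
    · rw [hc, indicator_of_notMem hz, norm_zero]
      positivity
  refine ⟨fun p => (c p.2 : ℂ) * w p, (memLpL2_four_iff T _).2 ⟨?_, ?_⟩,
    duhamel L u₀ fun t => cutoff hE (evol L t v), ?_, ?_⟩
  · refine AEStronglyMeasurable.mul ?_ w1
    exact (Complex.measurable_ofReal.comp (hcm.comp measurable_snd)).aestronglyMeasurable
  · have hle : mixedNormPow L T (fun p => (c p.2 : ℂ) * w p) ≤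
        (ENNReal.ofReal ε⁻¹ ^ 2) ^ 2 * mixedNormPow L T w := by
      rw [mixedNormPow, mixedNormPow, ← lintegral_const_mul' _ _ (by finiteness)]
      refine lintegral_mono fun z => ?_
      dsimp only
      rw [← mul_pow, ← lintegral_const_mul' _ _ (by finiteness)]
      gcongr with t
      rw [enorm_mul, mul_pow]
      gcongr
      exact hcb z
    exact hle.trans_lt (ENNReal.mul_lt_top (by finiteness) w3)
  · refine isSolution_duhamel hT u₀ (continuous_cutoff_evol hE v) ?_
    filter_upwards [w2] with t ht
    filter_upwards [ht, haa', coeFn_cutoff hE (evol L t v)] with z hz1 hz2 hz3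
    rw [hz3, hz1, hz2]
    by_cases hz : z ∈ E
    · have : ε < |a' z| := hz
      have hne : (a' z : ℂ) ≠ 0 := by
        have : a' z ≠ 0 := abs_pos.1 (hε.trans this)
        exact_mod_cast this
      rw [hc, indicator_of_mem hz, indicator_of_mem hz, Complex.ofReal_inv,
        mul_inv_cancel_left₀ hne]
    · rw [hc, indicator_of_notMem hz, indicator_of_notMem hz]
      simp
  · rw [duhamel, profile, ← gramian_apply hE hT, hv, smul_neg, smul_smul, Complex.I_mul_I]
    simp

/-- A control in `L⁴(𝕋²; L²(0, T))` for the weight `a²` yields one in `L²` for the weight `a`. -/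
theorem exists_control_of_sq {T : ℝ} {a : Torus L → ℝ} (ha : MemLp a 4) {u₀ : L2 L}
    {f : ℝ × Torus L → ℂ} (hf : MemLpL2 L T 4 f)
    (hd : DrivesToRest L T (fun z => a z * a z) f u₀) :
    ∃ f : ℝ × Torus L → ℂ, MemLp f 2 (spaceTime L T) ∧ DrivesToRest L T a f u₀ := by
  obtain ⟨f1, f2⟩ := (memLpL2_four_iff T f).1 hf
  have hm : AEStronglyMeasurable (fun p : ℝ × Torus L => (a p.2 : ℂ) * f p) (spaceTime L T) :=
    (memLp_snd ha).aestronglyMeasurable.mul f1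
  refine ⟨fun p => (a p.2 : ℂ) * f p, ⟨hm, ?_⟩, ?_⟩
  · have hA : ∫⁻ z, ‖a z‖ₑ ^ 4 < ∞ := by
      rw [← pow_four_eLpNorm_four]
      exact ENNReal.pow_lt_top ha.2
    have h1 := (sq_lintegral_lintegral_mul_le (T := T) ha.1 f1).trans_lt (ENNReal.mul_lt_top hA f2)
    rw [← lintegral_spaceTime (f := fun p => ‖(a p.2 : ℂ) * f p‖ₑ ^ 2) (hm.enorm.pow_const 2),
      ← sq_eLpNorm_two, ← pow_mul] at h1
    exact (ENNReal.pow_lt_top_iff.1 h1).resolve_right (by simp)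
  · have e : (fun p : ℝ × Torus L => (a p.2 : ℂ) * ((a p.2 : ℂ) * f p)) =
        fun p => ((a p.2 * a p.2 : ℝ) : ℂ) * f p := by
      ext p; push_cast; ring
    rw [DrivesToRest, e]
    exact hd

theorem eLpNorm_pos_iff {α : Type*} [MeasurableSpace α] {μ : Measure α} {a : α → ℝ} {p : ℝ≥0∞}
    (hp : p ≠ 0) (ha : AEStronglyMeasurable a μ) : 0 < eLpNorm a p μ ↔ ¬ a =ᵐ[μ] 0 := by
  rw [pos_iff_ne_zero, Ne, eLpNorm_eq_zero_iff ha hp]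

end Localisation

end TorusControl

end

/-! ### The cycle of implications. -/

theorem proposition4p1 (γ : ℝ) (hγ : γ ≠ 0) (T : ℝ) (hT : 0 < T) :
    -- `ℝ² / (ℤ × γℤ)` is the torus with second period `|γ|`.
    haveI : Fact (0 < |γ|) := ⟨abs_pos.mpr hγ⟩
    List.TFAE [
      ∀ a : TorusControl.Torus |γ| → ℝ, MemLp a 2 volume → 0 < eLpNorm a 2 volume →
        ∀ u₀ : TorusControl.L2 |γ|, ∃ f : ℝ × TorusControl.Torus |γ| → ℂ,
          TorusControl.MemLpL2 |γ| T 4 f ∧ TorusControl.DrivesToRest |γ| T a f u₀,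
      ∀ a : TorusControl.Torus |γ| → ℝ, MemLp a 4 volume → 0 < eLpNorm a 4 volume →
        ∀ u₀ : TorusControl.L2 |γ|, ∃ f : ℝ × TorusControl.Torus |γ| → ℂ,
          MemLp f 2 (TorusControl.spaceTime |γ| T) ∧ TorusControl.DrivesToRest |γ| T a f u₀,
      ∀ a : TorusControl.Torus |γ| → ℝ, MemLp a 4 volume → 0 < eLpNorm a 4 volume →
        ∃ C : ℝ≥0, 0 < C ∧ ∀ v₀ : TorusControl.L2 |γ|,
          ‖v₀‖ₑ ^ 2 ≤ C * ∫⁻ t in Set.Ioo 0 T, ∫⁻ z,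
            ‖(a z : ℂ) * TorusControl.freeEvolution |γ| t v₀ z‖ₑ ^ 2] := by
  have : Fact (0 < |γ|) := ⟨abs_pos.mpr hγ⟩
  tfae_have 1 → 2 := by
    intro h a ha ha0 u₀
    have ha2 : MemLp (fun z => a z * a z) 2 volume := by
      have : ENNReal.HolderTriple 4 4 2 := ⟨by
        rw [show (4 : ℝ≥0∞) = 2 * 2 by norm_num,
          ENNReal.mul_inv (by simp) (by simp), ← mul_add, ENNReal.inv_two_add_inv_two, mul_one]⟩
      exact ha.mul (r := 2) ha
    rw [TorusControl.eLpNorm_pos_iff (by simp) ha.1] at ha0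
    obtain ⟨f, hf, hd⟩ := h _ ha2 ((TorusControl.eLpNorm_pos_iff (by simp) ha2.1).2
      fun h0 => ha0 (h0.mono fun z hz => by simpa using hz)) u₀
    exact TorusControl.exists_control_of_sq ha hf hd
  tfae_have 2 → 3 := fun h a ha ha0 => TorusControl.exists_observability hT ha (h a ha ha0)
  tfae_have 3 → 1 := fun h a ha ha0 u₀ => TorusControl.exists_control hT h ha.1
    ((TorusControl.eLpNorm_pos_iff (by simp) ha.1).1 ha0) u₀
  tfae_finish
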